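/- **Setting.** Let $\mathcal E$ be a positive Heyting category (finite limits, regular, disjoint stable finite sums, right adjoints $\forall_f$ to pulling back subobjects) and let $\mathcal S$ be a class of maps in $\mathcal E$ such that $(\mathcal E,\mathcal S)$ is a *predicative category with small maps*. That is, writing "cover" for a map that factors through no proper subobject, $\mathcal S$ satisfies: (A1) stability under pullback; (A2) descent along covers; (A3) closure under sums; (A4) $0\to1$, $1\to1$, $1+1\to1$ are in $\mathcal S$; (A5) closure under composition; (A6) if $f$ is a cover and $gf\in\mathcal S$, then $g\in\mathcal S$; (A7) collection: for a cover $p:Y\to X$ and $f:X\to A$ in $\mathcal S$ there is a covering square from some $g:Z\to B$ in $\mathcal S$ to $f$ whose top map $Z\to X$ factors through $p$; (A8) $\forall_f$ preserves small monos for $f\in\mathcal S$; (A9) all diagonals are in $\mathcal S$; and moreover: all $f\in\mathcal S$ are exponentiable; (WE) holds; there is a natural numbers object $N$ with $N\to1$ in $\mathcal S$; there is a universal small map (every small map is covered by a pullback of it); and equivalence relations given by small monos have stable effective quotients. For an exponentiable map $f:B\to A$, i.e. one for which pulling back along $f$ has a right adjoint $\Pi_f$, let $P_f(Z)=\sum_{a\in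 A}Z^{B_a}$ be the polynomial functor $\Sigma_A\Pi_fB^*$; the W-type $W_f$ is its initial algebra. An object $X$ is small if $X\to1$ is in $\mathcal S$. The axioms concerned are: * **(WE)** for every $f:B\to A$ in $\mathcal S$ the W-type $W_f$ exists (in particular $f$ is exponentiable); * **(WS)** for every $f:B\to A$ in $\mathcal S$ with $A$ small, the W-type $W_f$ exists and is small. This is understood to hold in $(\mathcal E,\mathcal S)$ and in all its slices $(\mathcal E/I,\mathcal S/I)$. Let $\mathbb C$ be an internal category in $\mathcal E$ whose codomain map $\mathbb C_1\to\mathbb C_0$ is in $\mathcal S$, let $\mathrm{Psh}_{\mathcal E}(\mathbb C)$ be the category of internal presheaves on $\mathbb C$, and call a map of presheaves *pointwise small* if its underlying map in $\mathcal E/\mathbb C_0$ is in $\mathcal S/\mathbb C_0$. **Theorem.** 1. $\mathrm{Psh}_{\mathcal E}(\mathbb C)$ with the pointwise small maps satisfies (WE). 2. If $(\mathcal E,\mathcal S)$ satisfies (WS), then so does $\mathrm{Psh}_{\mathcal E}(\mathbb C)$ with the pointwise small maps. 3. Let $F:Y\to X$ be a pointwise small map of presheaves. For $x\in X(a)$ put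 $Y^M_x=\{(f,y): f:b\to a \text{ in }\mathbb C,\ y\in Y(b),\ F(y)=x\cdot f\}$, and let $\varphi:\sum_{a}\sum_{x\in X(a)}Y^M_x\to\sum_aX(a)$ be the map in $\mathcal E$ with fibre $Y^M_x$ over $x$. Then $\varphi\in\mathcal S$, both $\varphi$ and $F$ are exponentiable, and for every W-type $V$ of $\varphi$ in $\mathcal E$ the hereditarily natural trees form a subobject $W$ of $V$ which is an internal presheaf, with root and restriction as in $V$, and which, with its algebra structure $P_F(W)\to W$ given by the operation $\sup$ of $V$, is the W-type of $F$ in $\mathrm{Psh}_{\mathcal E}(\mathbb C)$. Here, in the internal language of $\mathcal E$, the elements of $V$ are the trees $v=\sup_xt$ with $x\in X(a)$ and $t:Y^M_x\to V$. The root of $v=\sup_x t$ is $\rho(v)=a$, and its restriction along $f:b\to a$ is $v\cdot f=\sup_{x\cdot f}f^*t$ with $(f^*t)(g,y)=t(fg,y)$. The tree $v$ is *composable* if $\rho(t(f,y))=\mathrm{dom}(f)$ for all $(f,y)\in Y_x^M$; it is *natural* if it is composable and $t(f,y)\cdot g=t(fg,y\cdot g)$ for all $(f,y)\in Y^M_x$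 and all $g$ with $\mathrm{cod}(g)=\mathrm{dom}(f)$; and it is *hereditarily natural* if $v$ and all its subtrees are natural, the subtrees of $v$ being the $t(f,y)$, their immediate subtrees, and so on. -/

import Mathlib

open CategoryTheory CategoryTheory.Limits

universe v u

noncomputable section

/-! ### Polynomial functors and W-types in a category with finite limits -/

section Polynomial

variable {D : Type u} [Category.{v} D] [HasFiniteLimits D]

/-- `f : B ⟶ A` is exponentiable if pulling back along `f`, as a functor `D/A ⥤ D/B`, has a right
adjoint (the functor `Π_f`). -/
abbrev IsExponentiableMap {B A : D} (f : B ⟶ A) : Prop :=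
  (Over.pullback f).IsLeftAdjoint

/-- The polynomial functor `P_f(Z) = ∑_{a ∈ A} Z ^ (B_a)` of an exponentiable map `f : B ⟶ A`, as
the composite `D ⥤ D/B ⥤ D/A ⥤ D` of `B^*`, `Π_f` and the forgetful functor. -/
def polynomialFunctor {B A : D} (f : B ⟶ A) [IsExponentiableMap f] : D ⥤ D :=
  Over.star B ⋙ (Over.pullback f).rightAdjoint ⋙ Over.forget A

/-- A generalized element `p : T ⟶ P_f(Z)` has a label `T ⟶ A`. -/
def polyLabel {B A : D} (f : B ⟶ A) [IsExponentiableMap f] {Z T : D}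
    (p : T ⟶ (polynomialFunctor f).obj Z) : T ⟶ A :=
  p ≫ ((Over.pullback f).rightAdjoint.obj ((Over.star B).obj Z)).hom

lemma comp_polyLabel {B A : D} (f : B ⟶ A) [IsExponentiableMap f] {Z T U : D} (k : U ⟶ T)
    (p : T ⟶ (polynomialFunctor f).obj Z) : polyLabel f (k ≫ p) = k ≫ polyLabel f p :=
  Category.assoc _ _ _

/-- A generalized element `p : T ⟶ P_f(Z)` with label `a` has an underlying function
`T ×_A B ⟶ Z`, obtained by transposing `p` along the adjunctions defining `P_f`. -/
def polyFun {B A : D} (f : B ⟶ A) [IsExponentiableMap f] {Z T : D}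
    (p : T ⟶ (polynomialFunctor f).obj Z) : pullback (polyLabel f p) f ⟶ Z :=
  ((Over.forgetAdjStar B).homEquiv ((Over.pullback f).obj (Over.mk (polyLabel f p))) Z).symm
    (((Adjunction.ofIsLeftAdjoint (Over.pullback f)).homEquiv
      (Over.mk (polyLabel f p)) ((Over.star B).obj Z)).symm (Over.homMk p))

/-- The generalized element `(a, t)` of `P_f(Z)` with label `a : T ⟶ A` and underlying function
`t : T ×_A B ⟶ Z`. -/
def polyMk {B A : D} (f : B ⟶ A) [IsExponentiableMap f] {Z T : D}
    (a : T ⟶ A) (t : pullback a f ⟶ Z) : T ⟶ (polynomialFunctor f).obj Z :=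
  (((Adjunction.ofIsLeftAdjoint (Over.pullback f)).homEquiv
    (Over.mk a) ((Over.star B).obj Z))
      (((Over.forgetAdjStar B).homEquiv ((Over.pullback f).obj (Over.mk a)) Z) t)).left

/-- The W-type associated to `f` exists: `f` is exponentiable and `P_f` has an initial algebra. -/
def HasWType {B A : D} (f : B ⟶ A) : Prop :=
  ∃ _ : IsExponentiableMap f, ∃ W : Endofunctor.Algebra (polynomialFunctor f),
    Nonempty (IsInitial W)

/-- An object is small if its map to the terminal object is small. -/
def IsSmallObject (S : MorphismProperty D) (X : D) : Prop :=
  S (terminal.from X)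

/-- The axiom **(WE)**: for all `f` in `S` the W-type associated to `f` exists. -/
def AxiomWE (S : MorphismProperty D) : Prop :=
  ∀ ⦃B A : D⦄ (f : B ⟶ A), S f → HasWType f

/-- For all `f : B ⟶ A` in `S` with `A` small, the W-type associated to `f` exists and is small. -/
def SmallWTypes (S : MorphismProperty D) : Prop :=
  ∀ ⦃B A : D⦄ (f : B ⟶ A), S f → IsSmallObject S A →
    ∃ _ : IsExponentiableMap f, ∃ W : Endofunctor.Algebra (polynomialFunctor f),
      Nonempty (IsInitial W) ∧ IsSmallObject S W.a

/-- The class `S/I` of maps in the slice `D/I` whose underlying map is in `S`. -/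
def sliceSmall (S : MorphismProperty D) (I : D) : MorphismProperty (Over I) :=
  S.inverseImage (Over.forget I)

/-- The axiom **(WS)**, valid in `(D, S)` and all its slices `(D/I, S/I)`: if `f : B ⟶ A` is in `S`
and `A` is small, then `W_f` is small. (The slice over the terminal object is `(D, S)` itself.) -/
def AxiomWS (S : MorphismProperty D) : Prop :=
  ∀ I : D, SmallWTypes (sliceSmall S I)

end Polynomial

/-! ### Predicative categories with small maps -/

section SmallMaps

/-- Positive Heyting categories: regular categories (with finite limits) with finite sums that are
disjoint and stable, in which pulling back subobjects has a right adjoint. -/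
class PositiveHeytingCategory (E : Type u) [Category.{v} E] : Prop extends
    Regular E, FinitaryExtensive E where
  heyting : ∀ {Y X : E} (f : Y ⟶ X), ∃ forallAlong : Subobject Y → Subobject X,
    GaloisConnection (Subobject.pullback f).obj forallAlong

variable {E : Type u} [Category.{v} E] [PositiveHeytingCategory E]

/-- The square with top `t : D ⟶ C`, left `f : D ⟶ B`, right `g : C ⟶ A` and bottom `p : B ⟶ A` is
a covering square: it commutes, the map `D ⟶ B ×_A C` is a cover, and `p` is a cover. Covers are
the maps that factor through no proper subobject, that is, the extremal epimorphisms. -/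
structure IsCoveringSquare {D C B A : E} (t : D ⟶ C) (f : D ⟶ B) (g : C ⟶ A) (p : B ⟶ A) :
    Prop where
  w : f ≫ p = t ≫ g
  cover_lift : ExtremalEpi (pullback.lift f t w)
  cover_base : ExtremalEpi p

/-- Classes of small maps, axioms **(A1-9)**. -/
structure IsClassOfSmallMaps (S : MorphismProperty E) : Prop where
  /-- (A1) -/
  pullback_stable : S.IsStableUnderBaseChange
  /-- (A2) -/
  descent : ∀ {D B C A : E} {t : D ⟶ B} {g : D ⟶ C} {f : B ⟶ A} {p : C ⟶ A},
    IsPullback t g f p → ExtremalEpi p → S g → S f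
  /-- (A3) -/
  sums : ∀ {X Y X' Y' : E} (f : X ⟶ Y) (f' : X' ⟶ Y'), S f → S f' → S (coprod.map f f')
  /-- (A4) -/
  zero_one : S (terminal.from (⊥_ E))
  one_one : S (terminal.from (⊤_ E))
  two_one : S (terminal.from ((⊤_ E) ⨿ (⊤_ E)))
  /-- (A5) -/
  composition : ∀ {X Y Z : E} (f : X ⟶ Y) (g : Y ⟶ Z), S f → S g → S (f ≫ g)
  /-- (A6) -/
  quotients : ∀ {Z Y X : E} (f : Z ⟶ Y) (g : Y ⟶ X), ExtremalEpi f → S (f ≫ g) → S g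
  /-- (A7) -/
  collection : ∀ {Y X A : E} (p : Y ⟶ X) (f : X ⟶ A), ExtremalEpi p → S f →
    ∃ (Z B : E) (t : Z ⟶ Y) (g : Z ⟶ B) (h : B ⟶ A), S g ∧ IsCoveringSquare (t ≫ p) g f h
  /-- (A8) -/
  heyting : ∀ {Y X : E} (f : Y ⟶ X), S f → ∀ forallAlong : Subobject Y → Subobject X,
    GaloisConnection (Subobject.pullback f).obj forallAlong →
      ∀ A : Subobject Y, S A.arrow → S (forallAlong A).arrow
  /-- (A9) -/
  diagonals : ∀ X : E, S (diag X)

/-- `N` with `0 : 1 ⟶ N` and `s : N ⟶ N` is a natural numbers object. -/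
def IsNaturalNumbersObject (N : E) (zero : ⊤_ E ⟶ N) (succ : N ⟶ N) : Prop :=
  ∀ (X : E) (a : ⊤_ E ⟶ X) (s : X ⟶ X), ∃! r : N ⟶ X, zero ≫ r = a ∧ succ ≫ r = r ≫ s

/-- Predicative categories with small maps. -/
structure IsPredicativeCategoryWithSmallMaps (S : MorphismProperty E) : Prop extends
    IsClassOfSmallMaps S where
  /-- (ΠE) -/
  exponentiable : ∀ {Y X : E} (f : Y ⟶ X), S f → IsExponentiableMap f
  /-- (WE) -/
  wTypes : AxiomWE S
  /-- (NE) and (NS) -/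
  nno : ∃ (N : E) (zero : ⊤_ E ⟶ N) (succ : N ⟶ N),
    IsNaturalNumbersObject N zero succ ∧ IsSmallObject S N
  /-- (Representability) -/
  representability : ∃ (U' U : E) (π : U' ⟶ U), S π ∧ ∀ {Y X : E} (f : Y ⟶ X), S f →
    ∃ (B A : E) (b : B ⟶ A) (t : B ⟶ Y) (p : A ⟶ X) (t' : B ⟶ U') (p' : A ⟶ U),
      IsCoveringSquare t b f p ∧ IsPullback t' b π p'
  /-- (Bounded exactness): an equivalence relation given by a small mono has a stable quotient. -/
  boundedExactness : ∀ {R X : E} (p₁ p₂ : R ⟶ X), IsEquivalenceRelation p₁ p₂ →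
    S (prod.lift p₁ p₂) → IsUniversallyEffectiveEquivalenceRelation p₁ p₂

end SmallMaps

/-! ### Internal categories and internal presheaves -/

section Internal

attribute [local simp] pullback.lift_fst pullback.lift_snd pullback.lift_fst_assoc
  pullback.lift_snd_assoc

variable {E : Type u} [Category.{v} E] [HasFiniteLimits E]

variable (E) in
/-- Internal categories. The object `pullback dom cod` consists of the pairs `(f, g)` with
`dom f = cod g`, and `comp` sends such a pair to the composite `fg`. -/
structure InternalCategory where
  C₀ : E
  C₁ : E
  dom : C₁ ⟶ C₀
  cod : C₁ ⟶ C₀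
  one : C₀ ⟶ C₁
  comp : pullback dom cod ⟶ C₁
  one_dom : one ≫ dom = 𝟙 C₀
  one_cod : one ≫ cod = 𝟙 C₀
  comp_dom : comp ≫ dom = pullback.snd dom cod ≫ dom
  comp_cod : comp ≫ cod = pullback.fst dom cod ≫ cod
  one_comp : ∀ {T : E} (f : T ⟶ C₁),
    pullback.lift (f ≫ cod ≫ one) f (by simp [one_dom]) ≫ comp = f
  comp_one : ∀ {T : E} (f : T ⟶ C₁),
    pullback.lift f (f ≫ dom ≫ one) (by simp [one_cod]) ≫ comp = f
  assoc : ∀ {T : E} (f g h : T ⟶ C₁) (hfg : f ≫ dom = g ≫ cod) (hgh : g ≫ dom = h ≫ cod),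
    pullback.lift (pullback.lift f g hfg ≫ comp) h (by simp [comp_dom, hgh]) ≫ comp =
      pullback.lift f (pullback.lift g h hgh ≫ comp) (by simp [comp_cod, hfg]) ≫ comp

/-- The composite `fg` of generalized arrows with `dom f = cod g`. -/
def InternalCategory.compose (C : InternalCategory E) {T : E} (f g : T ⟶ C.C₁)
    (h : f ≫ C.dom = g ≫ C.cod) : T ⟶ C.C₁ :=
  pullback.lift f g h ≫ C.comp

@[simp]
lemma InternalCategory.compose_dom (C : InternalCategory E) {T : E} (f g : T ⟶ C.C₁)
    (h : f ≫ C.dom = g ≫ C.cod) : C.compose f g h ≫ C.dom = g ≫ C.dom := by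
  simp [InternalCategory.compose, C.comp_dom]

@[simp]
lemma InternalCategory.compose_cod (C : InternalCategory E) {T : E} (f g : T ⟶ C.C₁)
    (h : f ≫ C.dom = g ≫ C.cod) : C.compose f g h ≫ C.cod = f ≫ C.cod := by
  simp [InternalCategory.compose, C.comp_cod]

/-- Internal presheaves on `C`: an object `obj` over `C₀` with a right action of the arrows of `C`,
which sends `x ∈ X(a)` and `f : b ⟶ a` to `x · f ∈ X(b)`. -/
structure InternalPresheaf (C : InternalCategory E) where
  obj : E
  anchor : obj ⟶ C.C₀
  act : pullback anchor C.cod ⟶ obj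
  act_anchor : act ≫ anchor = pullback.snd anchor C.cod ≫ C.dom
  act_one : ∀ {T : E} (x : T ⟶ obj),
    pullback.lift x (x ≫ anchor ≫ C.one) (by simp [C.one_cod]) ≫ act = x
  act_comp : ∀ {T : E} (x : T ⟶ obj) (f g : T ⟶ C.C₁) (hf : x ≫ anchor = f ≫ C.cod)
    (hg : f ≫ C.dom = g ≫ C.cod),
    pullback.lift (pullback.lift x f hf ≫ act) g (by simp [act_anchor, hg]) ≫ act =
      pullback.lift x (C.compose f g hg) (by simp [hf]) ≫ act

namespace InternalPresheaf

variable {C : InternalCategory E}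

/-- The restriction `x · f` of a generalized element `x` along a generalized arrow `f` with
codomain the anchor of `x`. -/
def restr (X : InternalPresheaf C) {T : E} (x : T ⟶ X.obj) (f : T ⟶ C.C₁)
    (h : x ≫ X.anchor = f ≫ C.cod) : T ⟶ X.obj :=
  pullback.lift x f h ≫ X.act

@[simp]
lemma restr_anchor (X : InternalPresheaf C) {T : E} (x : T ⟶ X.obj) (f : T ⟶ C.C₁)
    (h : x ≫ X.anchor = f ≫ C.cod) : X.restr x f h ≫ X.anchor = f ≫ C.dom := by
  simp [restr, X.act_anchor]

lemma comp_restr (X : InternalPresheaf C) {T U : E} (k : U ⟶ T) (x : T ⟶ X.obj) (f : T ⟶ C.C₁)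
    (h : x ≫ X.anchor = f ≫ C.cod) :
    k ≫ X.restr x f h = X.restr (k ≫ x) (k ≫ f) (by simp [h]) := by
  simp only [restr, ← Category.assoc]
  congr 1
  ext <;> simp

lemma restr_one (X : InternalPresheaf C) {T : E} (x : T ⟶ X.obj) (f : T ⟶ C.C₁)
    (hf : f = x ≫ X.anchor ≫ C.one) :
    X.restr x f (by simp [hf, C.one_cod]) = x := by
  subst hf
  exact X.act_one x

lemma restr_restr (X : InternalPresheaf C) {T : E} (x : T ⟶ X.obj) (f g : T ⟶ C.C₁)
    (hf : x ≫ X.anchor = f ≫ C.cod) (hg : f ≫ C.dom = g ≫ C.cod) :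
    X.restr (X.restr x f hf) g (by simp [hg]) =
      X.restr x (C.compose f g hg) (by simp [hf]) :=
  X.act_comp x f g hf hg

/-- Morphisms of internal presheaves: maps over `C₀` that commute with restriction. -/
@[ext]
structure Hom (X Y : InternalPresheaf C) where
  hom : X.obj ⟶ Y.obj
  anchor : hom ≫ Y.anchor = X.anchor
  restr : ∀ {T : E} (x : T ⟶ X.obj) (f : T ⟶ C.C₁) (h : x ≫ X.anchor = f ≫ C.cod),
    X.restr x f h ≫ hom = Y.restr (x ≫ hom) f (by simp [anchor, h])

instance : Category (InternalPresheaf C) where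
  Hom X Y := Hom X Y
  id X :=
    { hom := 𝟙 X.obj
      anchor := by simp
      restr := by simp }
  comp F G :=
    { hom := F.hom ≫ G.hom
      anchor := by rw [Category.assoc, G.anchor, F.anchor]
      restr := fun x f h => by
        rw [← Category.assoc, F.restr, G.restr]
        simp }
  id_comp F := Hom.ext (Category.id_comp _)
  comp_id F := Hom.ext (Category.comp_id _)
  assoc F G H := Hom.ext (Category.assoc _ _ _)

@[ext]
lemma hom_ext {X Y : InternalPresheaf C} {F G : X ⟶ Y} (h : F.hom = G.hom) : F = G :=
  Hom.ext h

@[simp]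
lemma id_hom (X : InternalPresheaf C) : Hom.hom (𝟙 X) = 𝟙 X.obj := rfl

@[simp]
lemma comp_hom {X Y Z : InternalPresheaf C} (F : X ⟶ Y) (G : Y ⟶ Z) :
    (F ≫ G).hom = F.hom ≫ G.hom := rfl

/-- The terminal presheaf: the object of objects, over itself. -/
def one (C : InternalCategory E) : InternalPresheaf C where
  obj := C.C₀
  anchor := 𝟙 _
  act := pullback.snd _ _ ≫ C.dom
  act_anchor := by simp
  act_one := by simp [C.one_dom]
  act_comp := by simp

instance : HasTerminal (InternalPresheaf C) :=
  IsTerminal.hasTerminal (X := one C) <| IsTerminal.ofUniqueHom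
    (fun X =>
      { hom := X.anchor
        anchor := by simp [one]
        restr := fun x f h =>
          (X.restr_anchor x f h).trans (pullback.lift_snd_assoc _ _ _ _).symm })
    (fun X F => by
      ext
      exact (Category.comp_id F.hom).symm.trans F.anchor)

section Pullback

variable {X Y Z : InternalPresheaf C} (F : X ⟶ Z) (G : Y ⟶ Z)

/-- Pullbacks of internal presheaves are computed in `E`. -/
def pullbackObj : InternalPresheaf C where
  obj := pullback F.hom G.hom
  anchor := pullback.fst _ _ ≫ X.anchor
  act := pullback.lift
    (X.restr (pullback.fst _ _ ≫ pullback.fst _ _) (pullback.snd _ _)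
      (by simpa using pullback.condition))
    (Y.restr (pullback.fst _ _ ≫ pullback.snd _ _) (pullback.snd _ _)
      (by
        rw [← pullback.condition, ← F.anchor, ← G.anchor, Category.assoc,
          pullback.condition_assoc]))
    (by
      rw [F.restr, G.restr]
      congr 1
      simp [pullback.condition])
  act_anchor := by simp
  act_one := fun x => by
    have hY : x ≫ pullback.fst F.hom G.hom ≫ X.anchor =
        x ≫ pullback.snd F.hom G.hom ≫ Y.anchor := by
      rw [← F.anchor, ← G.anchor, pullback.condition_assoc]
    ext
    · rw [Category.assoc, pullback.lift_fst, comp_restr]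
      simp only [pullback.lift_fst_assoc, pullback.lift_snd]
      exact X.restr_one _ _ (by simp)
    · rw [Category.assoc, pullback.lift_snd, comp_restr]
      simp only [pullback.lift_fst_assoc, pullback.lift_snd]
      exact Y.restr_one _ _ (by simpa using congrArg (· ≫ C.one) hY)
  act_comp := fun x f g hf hg => by
    have hX : (x ≫ pullback.fst F.hom G.hom) ≫ X.anchor = f ≫ C.cod := by simpa using hf
    have hY : (x ≫ pullback.snd F.hom G.hom) ≫ Y.anchor = f ≫ C.cod := by
      rw [← hX, ← F.anchor, ← G.anchor, Category.assoc, Category.assoc,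
        pullback.condition_assoc]
    ext
    · simpa [comp_restr] using X.restr_restr (x ≫ pullback.fst _ _) f g hX hg
    · simpa [comp_restr] using Y.restr_restr (x ≫ pullback.snd _ _) f g hY hg

lemma pullbackObj_anchor :
    pullback.snd F.hom G.hom ≫ Y.anchor = (pullbackObj F G).anchor := by
  show _ = pullback.fst F.hom G.hom ≫ X.anchor
  rw [← F.anchor, ← G.anchor, pullback.condition_assoc]

/-- The first projection from the pullback presheaf. -/
def pullbackFst : pullbackObj F G ⟶ X where
  hom := pullback.fst F.hom G.hom
  anchor := rfl
  restr := fun x f h => by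
    have key : (pullbackObj F G).act ≫ pullback.fst F.hom G.hom = X.restr
        (pullback.fst (pullbackObj F G).anchor C.cod ≫ pullback.fst F.hom G.hom)
        (pullback.snd (pullbackObj F G).anchor C.cod)
        ((Category.assoc _ _ _).trans pullback.condition) := pullback.lift_fst _ _ _
    refine (Category.assoc _ _ _).trans ((congrArg _ key).trans ((X.comp_restr _ _ _ _).trans ?_))
    congr 1
    · exact pullback.lift_fst_assoc _ _ _ _
    · exact pullback.lift_snd _ _ _

/-- The second projection from the pullback presheaf. -/
def pullbackSnd : pullbackObj F G ⟶ Y where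
  hom := pullback.snd F.hom G.hom
  anchor := pullbackObj_anchor F G
  restr := fun x f h => by
    have key : (pullbackObj F G).act ≫ pullback.snd F.hom G.hom = Y.restr
        (pullback.fst (pullbackObj F G).anchor C.cod ≫ pullback.snd F.hom G.hom)
        (pullback.snd (pullbackObj F G).anchor C.cod)
        ((Category.assoc _ _ _).trans
          ((congrArg _ (pullbackObj_anchor F G)).trans pullback.condition)) :=
      pullback.lift_snd _ _ _
    refine (Category.assoc _ _ _).trans ((congrArg _ key).trans ((Y.comp_restr _ _ _ _).trans ?_))
    congr 1
    · exact pullback.lift_fst_assoc _ _ _ _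
    · exact pullback.lift_snd _ _ _

variable {F G} in
/-- The map into the pullback presheaf induced by a commutative square. -/
def pullbackLift {T : InternalPresheaf C} (H : T ⟶ X) (K : T ⟶ Y) (w : H ≫ F = K ≫ G) :
    T ⟶ pullbackObj F G where
  hom := pullback.lift H.hom K.hom (congrArg Hom.hom w)
  anchor := (pullback.lift_fst_assoc _ _ _ _).trans H.anchor
  restr := fun x f h => by
    refine pullback.hom_ext ?_ ?_
    · refine (Category.assoc _ _ _).trans ((congrArg _ (pullback.lift_fst _ _ _)).trans
        ((H.restr x f h).trans (Eq.symm (((pullbackFst F G).restr _ f _).trans ?_))))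
      congr 1
      exact (Category.assoc _ _ _).trans (congrArg _ (pullback.lift_fst _ _ _))
    · refine (Category.assoc _ _ _).trans ((congrArg _ (pullback.lift_snd _ _ _)).trans
        ((K.restr x f h).trans (Eq.symm (((pullbackSnd F G).restr _ f _).trans ?_))))
      congr 1
      exact (Category.assoc _ _ _).trans (congrArg _ (pullback.lift_snd _ _ _))

lemma isPullback_pullbackObj : IsPullback (pullbackFst F G) (pullbackSnd F G) F G where
  w := hom_ext pullback.condition
  isLimit' := ⟨PullbackCone.IsLimit.mk _
    (fun s => pullbackLift s.fst s.snd s.condition)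
    (fun _ => hom_ext (pullback.lift_fst _ _ _))
    (fun _ => hom_ext (pullback.lift_snd _ _ _))
    (fun _ _ h₁ h₂ => hom_ext (pullback.hom_ext
      ((congrArg Hom.hom h₁).trans (pullback.lift_fst _ _ _).symm)
      ((congrArg Hom.hom h₂).trans (pullback.lift_snd _ _ _).symm)))⟩

instance : HasPullbacks (InternalPresheaf C) :=
  have (X Y Z : InternalPresheaf C) (F : X ⟶ Z) (G : Y ⟶ Z) : HasLimit (cospan F G) :=
    (isPullback_pullbackObj F G).hasPullback
  hasPullbacks_of_hasLimit_cospan _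

end Pullback

instance : HasFiniteLimits (InternalPresheaf C) :=
  hasFiniteLimits_of_hasTerminal_and_pullbacks

end InternalPresheaf

/-- Pointwise small maps of internal presheaves: those whose underlying map (in `E/C₀`) is in
`S/C₀`, that is, whose underlying map in `E` is in `S`. -/
def pointwiseSmall (S : MorphismProperty E) (C : InternalCategory E) :
    MorphismProperty (InternalPresheaf C) :=
  fun _ _ F => S (InternalPresheaf.Hom.hom F)

/-! ### Hereditarily natural trees -/

section Trees

variable {C : InternalCategory E} {Y X : InternalPresheaf C} (F : Y ⟶ X)

/-- The object of triples `(x, f, y)` with `x ∈ X(a)` and `(f, y) ∈ Y_x^M`, that is, with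
`f : b ⟶ a` in `C` and `y ∈ Y(b)` such that `F(y) = x · f`. -/
abbrev branchObj : E := pullback X.act F.hom

/-- The arrow `f` of a triple `(x, f, y)`. -/
abbrev branchArrow : branchObj F ⟶ C.C₁ :=
  pullback.fst X.act F.hom ≫ pullback.snd X.anchor C.cod

/-- The element `y` of a triple `(x, f, y)`. -/
abbrev branchElt : branchObj F ⟶ Y.obj := pullback.snd X.act F.hom

/-- The map `φ`, sending a triple `(x, f, y)` to `x`; its fibre over `x` is `Y_x^M`. -/
def branchMap : branchObj F ⟶ X.obj :=
  pullback.fst X.act F.hom ≫ pullback.fst X.anchor C.cod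

/-- The generalized element `(x, f, y)` of `branchObj F`. -/
def branchMk {T : E} (x : T ⟶ X.obj) (f : T ⟶ C.C₁) (y : T ⟶ Y.obj)
    (h : x ≫ X.anchor = f ≫ C.cod) (hy : y ≫ F.hom = X.restr x f h) : T ⟶ branchObj F :=
  pullback.lift (pullback.lift x f h) y hy.symm

@[simp]
lemma branchMk_branchMap {T : E} (x : T ⟶ X.obj) (f : T ⟶ C.C₁) (y : T ⟶ Y.obj)
    (h : x ≫ X.anchor = f ≫ C.cod) (hy : y ≫ F.hom = X.restr x f h) :
    branchMk F x f y h hy ≫ branchMap F = x :=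
  (pullback.lift_fst_assoc _ _ _ _).trans (pullback.lift_fst _ _ _)

lemma branchMap_anchor : branchMap F ≫ X.anchor = branchArrow F ≫ C.cod := by
  simp [branchMap, pullback.condition]

lemma branchElt_hom :
    branchElt F ≫ F.hom = X.restr (branchMap F) (branchArrow F) (branchMap_anchor F) := by
  rw [← pullback.condition, InternalPresheaf.restr]
  congr 1
  ext <;> simp [branchMap]

lemma branchElt_anchor : branchElt F ≫ Y.anchor = branchArrow F ≫ C.dom := by
  rw [← F.anchor, ← Category.assoc, branchElt_hom, InternalPresheaf.restr_anchor]

section Pairs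

variable {F} {T U : E} {x : T ⟶ X.obj} (m : U ⟶ pullback x (branchMap F))

/-- A generalized element `m` of `T ×_X branchObj F` is a pair consisting of an element `τ` of `T`
and a pair `(f, y) ∈ Y_{x(τ)}^M`. This is `τ`. -/
abbrev pairBase : U ⟶ T := m ≫ pullback.fst x (branchMap F)

/-- The arrow `f` of a pair `(τ, (f, y))`. -/
abbrev pairArrow : U ⟶ C.C₁ := m ≫ pullback.snd x (branchMap F) ≫ branchArrow F

/-- The element `y` of a pair `(τ, (f, y))`. -/
abbrev pairElt : U ⟶ Y.obj := m ≫ pullback.snd x (branchMap F) ≫ branchElt F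

lemma pair_anchor : (pairBase m ≫ x) ≫ X.anchor = pairArrow m ≫ C.cod := by
  simp only [pairBase, pairArrow, Category.assoc, pullback.condition_assoc, branchMap_anchor]

lemma pair_elt_hom :
    pairElt m ≫ F.hom = X.restr (pairBase m ≫ x) (pairArrow m) (pair_anchor m) := by
  simp only [pairBase, pairArrow, pairElt, Category.assoc, branchElt_hom,
    InternalPresheaf.comp_restr, pullback.condition]

lemma pair_elt_anchor : pairElt m ≫ Y.anchor = pairArrow m ≫ C.dom := by
  simp only [pairElt, pairArrow, Category.assoc, branchElt_anchor]

/-- The pair `(τ, (fg, y · g))` obtained from a pair `(τ, (f, y))` and an arrow `g` with codomain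
`dom f`. -/
def pairRestr (g : U ⟶ C.C₁) (h : pairArrow m ≫ C.dom = g ≫ C.cod) :
    U ⟶ pullback x (branchMap F) :=
  pullback.lift (pairBase m)
    (branchMk F (pairBase m ≫ x) (C.compose (pairArrow m) g h)
      (Y.restr (pairElt m) g ((pair_elt_anchor m).trans h))
      (by rw [pair_anchor, InternalCategory.compose_cod])
      (by
        rw [F.restr, ← X.restr_restr _ _ _ (pair_anchor m)]
        congr 1
        exact pair_elt_hom m))
    (by rw [branchMk_branchMap])

/-- The map sending `(τ, (g, y))`, with `(g, y) ∈ Y_{x(τ) · f(τ)}^M`, to `(τ, (f(τ)g, y))`. -/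
def pairReindex (x : T ⟶ X.obj) (f : T ⟶ C.C₁) (h : x ≫ X.anchor = f ≫ C.cod) :
    pullback (X.restr x f h) (branchMap F) ⟶ pullback x (branchMap F) :=
  have hdom : (pullback.fst (X.restr x f h) (branchMap F) ≫ f) ≫ C.dom =
      (pullback.snd (X.restr x f h) (branchMap F) ≫ branchArrow F) ≫ C.cod := by
    rw [Category.assoc, Category.assoc, ← branchMap_anchor, ← pullback.condition_assoc,
      InternalPresheaf.restr_anchor]
  have hcod : (pullback.fst (X.restr x f h) (branchMap F) ≫ x) ≫ X.anchor =
      (pullback.fst (X.restr x f h) (branchMap F) ≫ f) ≫ C.cod := by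
    rw [Category.assoc, Category.assoc, h]
  pullback.lift (pullback.fst (X.restr x f h) (branchMap F))
    (branchMk F (pullback.fst (X.restr x f h) (branchMap F) ≫ x)
      (C.compose (pullback.fst (X.restr x f h) (branchMap F) ≫ f)
        (pullback.snd (X.restr x f h) (branchMap F) ≫ branchArrow F) hdom)
      (pullback.snd (X.restr x f h) (branchMap F) ≫ branchElt F)
      (hcod.trans (C.compose_cod _ _ _).symm)
      (by
        rw [Category.assoc, branchElt_hom, X.comp_restr, ← X.restr_restr _ _ _ hcod]
        congr 1
        rw [← pullback.condition, X.comp_restr]))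
    (by rw [branchMk_branchMap])

end Pairs

variable [IsExponentiableMap (branchMap F)]
  {V : Endofunctor.Algebra (polynomialFunctor (branchMap F))} (hV : IsInitial V)

variable {F}

/-- The tree `sup_x t` in the W-type `V` of `φ`, for `x : T ⟶ X` and a family `t` of trees indexed
by the pairs `(τ, (f, y))` with `(f, y) ∈ Y_{x(τ)}^M`. -/
def treeSup (V : Endofunctor.Algebra (polynomialFunctor (branchMap F))) {T : E} (x : T ⟶ X.obj)
    (t : pullback x (branchMap F) ⟶ V.a) : T ⟶ V.a :=
  polyMk (branchMap F) x t ≫ V.str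

/-- The label `x` of the root of a tree `v = sup_x t`; here `Endofunctor.Algebra.Initial.strInv` is
the inverse of the structure map `sup` of the initial algebra `V`. -/
def treeLabel {T : E} (v : T ⟶ V.a) : T ⟶ X.obj :=
  polyLabel (branchMap F) (v ≫ Endofunctor.Algebra.Initial.strInv hV)

/-- The family `t` of immediate subtrees of a tree `v = sup_x t`. -/
def treeFun {T : E} (v : T ⟶ V.a) : pullback (treeLabel hV v) (branchMap F) ⟶ V.a :=
  polyFun (branchMap F) (v ≫ Endofunctor.Algebra.Initial.strInv hV)

/-- The root `ρ(v)` of a tree `v = sup_x t` with `x ∈ X(a)` is `a`. -/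
def treeRoot {T : E} (v : T ⟶ V.a) : T ⟶ C.C₀ :=
  treeLabel hV v ≫ X.anchor

/-- The restriction `v · f = sup_{x · f} f^*t` of a tree `v = sup_x t`, with
`(f^*t)(g, y) = t(fg, y)`. -/
def treeRestr {T : E} (v : T ⟶ V.a) (f : T ⟶ C.C₁) (h : treeRoot hV v = f ≫ C.cod) : T ⟶ V.a :=
  treeSup V (X.restr (treeLabel hV v) f h) (pairReindex (treeLabel hV v) f h ≫ treeFun hV v)

lemma comp_treeRoot {T U : E} (m : U ⟶ T) (v : T ⟶ V.a) :
    treeRoot hV (m ≫ v) = m ≫ treeRoot hV v := by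
  rw [treeRoot, treeRoot, treeLabel, treeLabel, Category.assoc, comp_polyLabel, Category.assoc]

/-- A tree `v = sup_x t` is composable if `ρ(t(f, y)) = dom f` for all `(f, y) ∈ Y_x^M`. -/
def IsComposableTree {T : E} (v : T ⟶ V.a) : Prop :=
  treeRoot hV (treeFun hV v) =
    pullback.snd (treeLabel hV v) (branchMap F) ≫ branchArrow F ≫ C.dom

lemma IsComposableTree.root_eq {T U : E} {v : T ⟶ V.a} (hv : IsComposableTree hV v)
    (m : U ⟶ pullback (treeLabel hV v) (branchMap F)) :
    treeRoot hV (m ≫ treeFun hV v) = pairArrow m ≫ C.dom := by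
  rw [comp_treeRoot, hv]
  simp only [pairArrow, Category.assoc]

/-- A tree `v = sup_x t` is natural if it is composable and `t(f, y) · g = t(fg, y · g)` for all
`(f, y) ∈ Y_x^M` and all `g` with codomain `dom f`. -/
def IsNaturalTree {T : E} (v : T ⟶ V.a) : Prop :=
  ∃ hv : IsComposableTree hV v,
    ∀ {U : E} (m : U ⟶ pullback (treeLabel hV v) (branchMap F)) (g : U ⟶ C.C₁)
      (h : pairArrow m ≫ C.dom = g ≫ C.cod),
      treeRestr hV (m ≫ treeFun hV v) g ((hv.root_eq hV m).trans h) =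
        pairRestr m g h ≫ treeFun hV v

/-- The relation "`w` is a subtree of `v` or `w = v`" on generalized elements of `V`: the pair
`(w, v)` belongs to every subobject of `V × V` that contains the diagonal and, with any `(w, v)`,
all `(w', v)` with `w'` an immediate subtree of `w`. -/
def IsSubtreeOrEq {T : E} (w v : T ⟶ V.a) : Prop :=
  ∀ R : Subobject (V.a ⨯ V.a), R.Factors (diag V.a) →
    (∀ {U : E} (w v : U ⟶ V.a) (b : U ⟶ pullback (treeLabel hV w) (branchMap F)),
      pairBase b = 𝟙 U → R.Factors (prod.lift w v) →
        R.Factors (prod.lift (b ≫ treeFun hV w) v)) →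
    R.Factors (prod.lift w v)

/-- A tree `v` is hereditarily natural if all its subtrees (including the tree itself) are
natural. The subtrees are taken at all later stages `U ⟶ T`. -/
def IsHereditarilyNaturalTree {T : E} (v : T ⟶ V.a) : Prop :=
  ∀ {U : E} (k : U ⟶ T) (w : U ⟶ V.a), IsSubtreeOrEq hV w (k ≫ v) → IsNaturalTree hV w

/-- `j` exhibits the presheaf `W` as the subobject of `V` consisting of the hereditarily natural
trees, with the anchor (that is, the root) and the restriction of trees of `V`. -/
structure IsPresheafOfHereditarilyNaturalTrees (W : InternalPresheaf C) (j : W.obj ⟶ V.a) :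
    Prop where
  mono : Mono j
  factors_iff : ∀ {T : E} (v : T ⟶ V.a),
    (∃ w : T ⟶ W.obj, w ≫ j = v) ↔ IsHereditarilyNaturalTree hV v
  root : treeRoot hV j = W.anchor
  restr : ∀ {T : E} (w : T ⟶ W.obj) (f : T ⟶ C.C₁) (h : w ≫ W.anchor = f ≫ C.cod),
    W.restr w f h ≫ j =
      treeRestr hV (w ≫ j) f (by rw [comp_treeRoot, root, h])

/-- The `P_F`-algebra structure of `W` is the restriction of `sup` along `j : W ⟶ V`: for a
morphism of presheaves `x : T ⟶ X` and `t : T ×_X Y ⟶ W`, representing the generalized element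
`(x, t)` of `P_F(W)`, its value in `W ⊆ V` is `sup_x t'` where `t'(τ, (f, y)) = t(τ · f, y)`. -/
def IsAlgebraOfTrees [IsExponentiableMap F] (W : Endofunctor.Algebra (polynomialFunctor F))
    (j : W.a.obj ⟶ V.a) : Prop :=
  ∀ {T : InternalPresheaf C} (x : T ⟶ X) (t : pullback x F ⟶ W.a),
    ∃ t' : pullback x.hom (branchMap F) ⟶ V.a,
      (∀ {U : E} (m : U ⟶ pullback x.hom (branchMap F)) (z : U ⟶ (pullback x F).obj),
        z ≫ (pullback.fst x F).hom =
          T.restr (pairBase m) (pairArrow m) (by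
            rw [← x.anchor, ← Category.assoc, pair_anchor]) →
        z ≫ (pullback.snd x F).hom = pairElt m →
        m ≫ t' = z ≫ t.hom ≫ j) ∧
      (polyMk F x t ≫ W.str).hom ≫ j = treeSup V x.hom t'

end Trees

end Internal

end

/-!
W-types of presheaves as presheaves of hereditarily natural trees.

**Generalized elements.** Everything is phrased with generalized elements `T ⟶ Z`. A generalized
element of `P_f(Z)` is a label together with a family `Fam` of elements of `Z` indexed by the fibre
of `f` over the label, and an initial algebra is characterized by recursion for operations on such
families (`SupAlg`, `w_rec`). Predicates on generalized elements are used when they are `Definable`,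
i.e. given by a subobject; the subobjects in `S` are closed under conjunction, equality and
quantification along maps of `S` (`AdmitsLogic`). Induction over a W-type proves definable
predicates (`wCoalg_wellFounded`).

**Partial recursion.** The main technical tool is recursion along a *partial* operation over a
well-founded coalgebra: there is a largest subobject on which the recursion is possible
(`exists_partial_recursion`). It is cut out, as an equalizer of two maps defined by recursion
(`exists_sorted`), from a W-type whose labels are the possible steps of the recursion. This needs no
images, hence no impredicativity and no bound on the size of `V`. One instance is the subobject of
trees that hereditarily satisfy a definable predicate (`exists_hereditary`). For naturality it is
the subobject `HNTrees`; restriction of trees makes all of `V` a presheaf (`treeOp`), and `HNTrees`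
is closed under restriction. Subtrees are quantified in the statement through all subobjects of
`V × V`; an object of finite paths in trees (`exists_paths`) turns this into a definable condition
and identifies `HNTrees` with the hereditarily natural trees
(`HNTrees.factors_iff_isHereditarilyNaturalTree`).

**The W-type.** A natural family over a label `x` is a family `t` of elements of a presheaf `Z`
indexed by the pairs `(f, y)` with `t(f, y) · g = t(fg, y · g)`. By a Yoneda argument such families
are the elements of the dependent product along `F`: naturality is definable, so that they form a
presheaf `NatFamPresheaf`, and this presheaf proves `F` exponentiable
(`isExponentiableMap_of_branchMap`) and represents `P_F(Z)` (`NatFams.toPoly_isIso`). Under the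
second isomorphism a hereditarily natural tree is a label with a natural family of hereditarily
natural trees, which is the algebra structure. Initiality amounts to recursion
(`HNTrees.exists_recursion`, `HNTrees.recursion_unique`). The recursion for an algebra `Z` is only
partially defined on `V`, because `P_F(Z)` contains natural families only; by induction, every
hereditarily natural tree is in its domain and the values commute with restriction.

**Smallness.** If `X` is small over `C₀`, then so is the presheaf `W` of hereditarily natural trees,
although `V` is not small over `C₀`: the subtree of `v` at a branch `(f, y)` has root `dom f`, so
that `V` is not the W-type of a map in the slice over `C₀`. The inclusion of `W` in `V` is a small
mono, by an induction in which the universal small map makes "this truth value is small" a definable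
predicate (`definable_of_children`). If a tree `w` is tagged by an arrow `f` with domain its root,
and its subtree at `(g, y)` by `fg`, then the codomain of the tag is the same for all subtrees;
hence tagged trees embed over `C₀` in the W-type of a map in `E/C₀` with labels `(f, x)`
(`HNTrees.exists_tagged_embedding`), which is small over `C₀` by (WS). The embedding is a
small map because the inclusion of `W` in `V` is, and `W` itself embeds in the tagged trees by
identity tags, so that it is small over `C₀` (`HNTrees.presheaf_anchor_mem`).

The slice of presheaves over `I` is equivalent to the presheaves on the category of elements of `I`
(`overEquivalence`), and W-types may be transported along equivalences
(`exists_wType_of_equivalence`). So (WS) in all slices reduces to the case of presheaves that are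
small over the object of objects (`axiomWS_pointwiseSmall`).
-/

noncomputable section

attribute [local simp] pullback.lift_fst pullback.lift_snd pullback.lift_fst_assoc
  pullback.lift_snd_assoc prod.lift_fst prod.lift_snd prod.lift_fst_assoc prod.lift_snd_assoc

/-! ### Generalized elements of polynomial functors -/

section Fam

variable {D : Type u} [Category.{v} D]

/-- A family of generalized elements of `Z` indexed by the fibre of `f : B ⟶ A` over a generalized
element `a : T ⟶ A`: an element `app k b` of `Z` for every later stage `k : U ⟶ T` and every
`b : U ⟶ B` over `k ≫ a`, naturally in the stage. If the pullback of `f` along `a` exists, this is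
the same as a map `T ×_A B ⟶ Z`; no choice of a pullback is involved. -/
structure Fam {B A : D} (f : B ⟶ A) {T : D} (a : T ⟶ A) (Z : D) where
  app : ∀ {U : D} (k : U ⟶ T) (b : U ⟶ B), k ≫ a = b ≫ f → (U ⟶ Z)
  nat : ∀ {U U' : D} (l : U' ⟶ U) (k : U ⟶ T) (b : U ⟶ B) (h : k ≫ a = b ≫ f),
    l ≫ app k b h = app (l ≫ k) (l ≫ b) (by rw [Category.assoc, h, Category.assoc])

namespace Fam

variable {B A : D} {f : B ⟶ A} {T : D} {a : T ⟶ A} {Z Z' : D}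

@[ext]
lemma ext {s t : Fam f a Z}
    (h : ∀ {U : D} (k : U ⟶ T) (b : U ⟶ B) (h : k ≫ a = b ≫ f), s.app k b h = t.app k b h) :
    s = t := by
  cases s; cases t
  congr
  funext U k b hb
  exact h k b hb

lemma app_congr (t : Fam f a Z) {U : D} {k k' : U ⟶ T} {b b' : U ⟶ B} (hk : k = k') (hb : b = b')
    (h : k ≫ a = b ≫ f) : t.app k b h = t.app k' b' (by rw [← hk, ← hb, h]) := by
  subst hk hb; rfl

/-- Reindexing of a family along a change of stage. -/
def pull (t : Fam f a Z) {T' : D} (l : T' ⟶ T) : Fam f (l ≫ a) Z where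
  app k b h := t.app (k ≫ l) b (by rw [Category.assoc, h])
  nat m k b h := by
    rw [t.nat]
    exact t.app_congr (Category.assoc _ _ _).symm rfl _

/-- The image of a family under a map. -/
def map (t : Fam f a Z) (g : Z ⟶ Z') : Fam f a Z' where
  app k b h := t.app k b h ≫ g
  nat m k b h := by rw [← Category.assoc, t.nat]

/-- Transport of a family along an equality of labels. -/
def cast (t : Fam f a Z) {a' : T ⟶ A} (h : a' = a) : Fam f a' Z where
  app k b hb := t.app k b (by rw [← h, hb])
  nat m k b hb := t.nat _ _ _ _

/-- The family given by a map out of a pullback. -/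
def ofHom {P : D} {p : P ⟶ T} {q : P ⟶ B} (hP : IsPullback p q a f) (t : P ⟶ Z) : Fam f a Z where
  app k b h := hP.lift k b h ≫ t
  nat m k b h := by
    rw [← Category.assoc]
    congr 1
    apply hP.hom_ext <;> simp

/-- The value of a family at the generic element of a pullback. -/
abbrev toHom {P : D} {p : P ⟶ T} {q : P ⟶ B} (t : Fam f a Z) (hP : IsPullback p q a f) : P ⟶ Z :=
  t.app p q hP.w

lemma toHom_ofHom {P : D} {p : P ⟶ T} {q : P ⟶ B} (hP : IsPullback p q a f) (t : P ⟶ Z) :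
    (ofHom hP t).toHom hP = t := by
  have : hP.lift p q hP.w = 𝟙 P := by apply hP.hom_ext <;> simp
  simp [ofHom, toHom, this]

lemma lift_toHom {P : D} {p : P ⟶ T} {q : P ⟶ B} (t : Fam f a Z) (hP : IsPullback p q a f)
    {U : D} (k : U ⟶ T) (b : U ⟶ B) (h : k ≫ a = b ≫ f) :
    hP.lift k b h ≫ t.toHom hP = t.app k b h := by
  rw [t.nat]
  exact t.app_congr (by simp) (by simp) _

lemma ofHom_toHom {P : D} {p : P ⟶ T} {q : P ⟶ B} (hP : IsPullback p q a f) (t : Fam f a Z) :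
    ofHom hP (t.toHom hP) = t := by
  ext U k b h
  exact t.lift_toHom hP k b h

end Fam

end Fam

section Poly

variable {D : Type u} [Category.{v} D] [HasFiniteLimits D] {B A : D} (f : B ⟶ A)
  [IsExponentiableMap f] {Z Z' T : D}

lemma polyLabel_polyMk (a : T ⟶ A) (t : pullback a f ⟶ Z) : polyLabel f (polyMk f a t) = a :=
  Over.w (((Adjunction.ofIsLeftAdjoint (Over.pullback f)).homEquiv (Over.mk a)
    ((Over.star B).obj Z))
      (((Over.forgetAdjStar B).homEquiv ((Over.pullback f).obj (Over.mk a)) Z) t))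

/-- The transpose of a map over `A`, independently of the way in which its label is presented. -/
lemma lift_polyFun_left {a : T ⟶ A}
    (w : Over.mk a ⟶ (Over.pullback f).rightAdjoint.obj ((Over.star B).obj Z))
    {p : T ⟶ (polynomialFunctor f).obj Z} (hp : p = w.left) {U : D} (k : U ⟶ T) (b : U ⟶ B)
    (h : k ≫ polyLabel f p = b ≫ f) (h' : k ≫ a = b ≫ f) :
    pullback.lift k b h ≫ polyFun f p = pullback.lift k b h' ≫
      ((Over.forgetAdjStar B).homEquiv ((Over.pullback f).obj (Over.mk a)) Z).symm
        (((Adjunction.ofIsLeftAdjoint (Over.pullback f)).homEquiv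
          (Over.mk a) ((Over.star B).obj Z)).symm w) := by
  have ha : polyLabel f p = a := by rw [hp]; exact Over.w w
  subst ha
  obtain rfl : w = Over.homMk p := by ext; exact hp.symm
  rfl

lemma lift_polyFun_polyMk (a : T ⟶ A) (t : pullback a f ⟶ Z) {U : D} (k : U ⟶ T) (b : U ⟶ B)
    (h : k ≫ polyLabel f (polyMk f a t) = b ≫ f) (h' : k ≫ a = b ≫ f) :
    pullback.lift k b h ≫ polyFun f (polyMk f a t) = pullback.lift k b h' ≫ t := by
  refine (lift_polyFun_left f _ rfl k b h h').trans ?_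
  refine congrArg (pullback.lift k b h' ≫ ·) ?_
  exact (congrArg _ (Equiv.symm_apply_apply _ _)).trans (Equiv.symm_apply_apply _ _)

lemma polyMk_polyFun (p : T ⟶ (polynomialFunctor f).obj Z) :
    polyMk f (polyLabel f p) (polyFun f p) = p := by
  rw [polyMk, polyFun, Equiv.apply_symm_apply, Equiv.apply_symm_apply]
  rfl

lemma polyMk_map (a : T ⟶ A) (t : pullback a f ⟶ Z) (g : Z ⟶ Z') :
    polyMk f a (t ≫ g) = polyMk f a t ≫ (polynomialFunctor f).map g := by
  have h1 := (Over.forgetAdjStar B).homEquiv_naturality_right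
    (X := (Over.pullback f).obj (Over.mk a)) t g
  have h2 := (Adjunction.ofIsLeftAdjoint (Over.pullback f)).homEquiv_naturality_right
    (((Over.forgetAdjStar B).homEquiv ((Over.pullback f).obj (Over.mk a)) Z) t)
    ((Over.star B).map g)
  exact congrArg CommaMorphism.left ((congrArg _ h1).trans h2)

lemma comp_polyMk (a : T ⟶ A) (t : pullback a f ⟶ Z) {T' : D} (l : T' ⟶ T) :
    polyMk f (l ≫ a) (pullback.lift (pullback.fst _ _ ≫ l) (pullback.snd _ _)
      (by rw [Category.assoc, pullback.condition]) ≫ t) = l ≫ polyMk f a t := by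
  let m : Over.mk (l ≫ a) ⟶ Over.mk a := Over.homMk l
  have h1 := (Over.forgetAdjStar B).homEquiv_naturality_left ((Over.pullback f).map m) t
  have h2 := (Adjunction.ofIsLeftAdjoint (Over.pullback f)).homEquiv_naturality_left m
    (((Over.forgetAdjStar B).homEquiv ((Over.pullback f).obj (Over.mk a)) Z) t)
  rw [← h1] at h2
  exact congrArg CommaMorphism.left h2

/-- The value of an element `p = (a, t)` of `P_f(Z)` at an element `b` of the fibre over `a`. -/
def polyApp (p : T ⟶ (polynomialFunctor f).obj Z) (b : T ⟶ B) (h : polyLabel f p = b ≫ f) :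
    T ⟶ Z :=
  pullback.lift (𝟙 T) b ((Category.id_comp _).trans h) ≫ polyFun f p

/-- The element `(a, t)` of `P_f(Z)`. -/
def polyOf {a : T ⟶ A} (t : Fam f a Z) : T ⟶ (polynomialFunctor f).obj Z :=
  polyMk f a (t.toHom (IsPullback.of_hasPullback a f))

variable {f}

@[simp]
lemma polyLabel_polyOf {a : T ⟶ A} (t : Fam f a Z) : polyLabel f (polyOf f t) = a :=
  polyLabel_polyMk f _ _

lemma polyMk_eq_polyOf (a : T ⟶ A) (t : pullback a f ⟶ Z) :
    polyMk f a t = polyOf f (Fam.ofHom (IsPullback.of_hasPullback a f) t) := by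
  rw [polyOf, Fam.toHom_ofHom]

lemma comp_polyOf {a : T ⟶ A} (t : Fam f a Z) {T' : D} (l : T' ⟶ T) :
    l ≫ polyOf f t = polyOf f (t.pull l) := by
  rw [polyOf, ← comp_polyMk, t.nat, polyOf]
  congr 1
  exact t.app_congr (pullback.lift_fst _ _ _) (pullback.lift_snd _ _ _) _

lemma polyOf_congr {a a' : T ⟶ A} (ha : a = a') {t : Fam f a Z} {t' : Fam f a' Z}
    (h : ∀ {U : D} (k : U ⟶ T) (b : U ⟶ B) (h : k ≫ a = b ≫ f) (h' : k ≫ a' = b ≫ f),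
      t.app k b h = t'.app k b h') : polyOf f t = polyOf f t' := by
  subst ha
  congr 1
  ext U k b hb
  exact h k b hb hb

@[simp]
lemma polyApp_polyOf {a : T ⟶ A} (t : Fam f a Z) (b : T ⟶ B)
    (h : polyLabel f (polyOf f t) = b ≫ f) :
    polyApp f (polyOf f t) b h = t.app (𝟙 T) b (by simpa using h) := by
  have h' : 𝟙 T ≫ a = b ≫ f := by simpa using h
  refine (lift_polyFun_polyMk f _ _ _ _ _ h').trans ?_
  rw [t.nat]
  exact t.app_congr (by simp) (by simp) _

lemma polyApp_congr {p p' : T ⟶ (polynomialFunctor f).obj Z} (hp : p = p') {b b' : T ⟶ B}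
    (hb : b = b') (h : polyLabel f p = b ≫ f) :
    polyApp f p b h = polyApp f p' b' (by rw [← hp, ← hb, h]) := by
  subst hp hb; rfl

lemma comp_polyLabel' {T' : D} (p : T ⟶ (polynomialFunctor f).obj Z) (l : T' ⟶ T) {b : T ⟶ B}
    (h : polyLabel f p = b ≫ f) : polyLabel f (l ≫ p) = (l ≫ b) ≫ f := by
  rw [comp_polyLabel, h, Category.assoc]

lemma lift_polyFun (p : T ⟶ (polynomialFunctor f).obj Z) {U : D} (k : U ⟶ T) (b : U ⟶ B)
    (h : k ≫ polyLabel f p = b ≫ f) :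
    pullback.lift k b h ≫ polyFun f p =
      polyApp f (k ≫ p) b (by rw [comp_polyLabel, h]) := by
  have e := comp_polyMk f (polyLabel f p) (polyFun f p) k
  rw [polyMk_polyFun] at e
  rw [polyApp_congr e.symm rfl, polyApp, lift_polyFun_polyMk f _ _ _ _ _ (by simpa using h),
    ← Category.assoc]
  congr 1
  ext <;> simp

lemma polyOf_self (p : T ⟶ (polynomialFunctor f).obj Z) :
    polyOf f (Fam.ofHom (IsPullback.of_hasPullback _ f) (polyFun f p)) = p := by
  rw [← polyMk_eq_polyOf, polyMk_polyFun]

/-- Naturality of `polyApp` in the stage. -/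
lemma comp_polyApp {T' : D} (p : T ⟶ (polynomialFunctor f).obj Z) (l : T' ⟶ T) (b : T ⟶ B)
    (h : polyLabel f p = b ≫ f) :
    l ≫ polyApp f p b h = polyApp f (l ≫ p) (l ≫ b) (comp_polyLabel' p l h) := by
  rw [← lift_polyFun p l (l ≫ b) (by rw [h, Category.assoc]), polyApp, ← Category.assoc]
  congr 1
  ext <;> simp

lemma polyOf_map {a : T ⟶ A} (t : Fam f a Z) (g : Z ⟶ Z') :
    polyOf f t ≫ (polynomialFunctor f).map g = polyOf f (t.map g) := by
  rw [polyOf, ← polyMk_map]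
  rfl

lemma poly_ext {p p' : T ⟶ (polynomialFunctor f).obj Z} (hl : polyLabel f p = polyLabel f p')
    (h : ∀ {U : D} (k : U ⟶ T) (b : U ⟶ B) (h : polyLabel f (k ≫ p) = b ≫ f)
      (h' : polyLabel f (k ≫ p') = b ≫ f), polyApp f (k ≫ p) b h = polyApp f (k ≫ p') b h') :
    p = p' := by
  rw [← polyOf_self p, ← polyOf_self p']
  refine polyOf_congr hl fun k b hb hb' => ?_
  have e {a : T ⟶ A} (h : k ≫ a = b ≫ f) :
      (IsPullback.of_hasPullback a f).lift k b h = pullback.lift k b h := by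
    apply pullback.hom_ext <;> simp
  refine (congrArg (· ≫ polyFun f p) (e hb)).trans
    (Eq.trans ?_ (congrArg (· ≫ polyFun f p') (e hb')).symm)
  refine (lift_polyFun p k b hb).trans (Eq.trans ?_ (lift_polyFun p' k b hb').symm)
  exact h k b _ _

/-- The family underlying an element of `P_f(Z)`. -/
def polyFam (p : T ⟶ (polynomialFunctor f).obj Z) : Fam f (polyLabel f p) Z where
  app k b h := polyApp f (k ≫ p) b (by rw [comp_polyLabel, h])
  nat l k b h := by
    rw [comp_polyApp]
    exact polyApp_congr (Category.assoc _ _ _).symm rfl _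

@[simp]
lemma polyOf_polyFam (p : T ⟶ (polynomialFunctor f).obj Z) : polyOf f (polyFam p) = p := by
  refine poly_ext (by simp) fun k b h h' => ?_
  rw [polyApp_congr (comp_polyOf _ _) rfl h, polyApp_polyOf]
  exact polyApp_congr (by rw [Category.id_comp]) rfl (by rw [Category.id_comp]; exact h')

/-- The label of an element of `P_f(Z)`, as a map. -/
abbrev polyLab (f : B ⟶ A) [IsExponentiableMap f] (Z : D) : (polynomialFunctor f).obj Z ⟶ A :=
  polyLabel f (𝟙 _)

lemma comp_polyLab (p : T ⟶ (polynomialFunctor f).obj Z) : p ≫ polyLab f Z = polyLabel f p := by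
  rw [polyLab, ← comp_polyLabel, Category.comp_id]

end Poly

/-! ### W-types through generalized elements -/

section WTypes

open Endofunctor.Algebra.Initial (strInv)

variable {D : Type u} [Category.{v} D] {B A : D} {f : B ⟶ A}

/-- An algebra structure for `P_f` on `Z`, as an operation on generalized elements `(a, t)` that is
natural in the stage. -/
structure SupAlg (f : B ⟶ A) (Z : D) where
  sup : ∀ {T : D} {a : T ⟶ A}, Fam f a Z → (T ⟶ Z)
  nat : ∀ {T T' : D} (l : T' ⟶ T) {a : T ⟶ A} (t : Fam f a Z), l ≫ sup t = sup (t.pull l)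

lemma SupAlg.congr {Z : D} (σ : SupAlg f Z) {T : D} {a a' : T ⟶ A} (ha : a = a') {t : Fam f a Z}
    {t' : Fam f a' Z} (h : ∀ {U : D} (k : U ⟶ T) (b : U ⟶ B) (h : k ≫ a = b ≫ f)
      (h' : k ≫ a' = b ≫ f), t.app k b h = t'.app k b h') : σ.sup t = σ.sup t' := by
  subst ha
  congr 1
  ext U k b hb
  exact h k b hb hb

variable [HasFiniteLimits D] [IsExponentiableMap f]

/-- The `P_f`-algebra given by an operation on generalized elements. -/
def SupAlg.toAlgebra {Z : D} (σ : SupAlg f Z) : Endofunctor.Algebra (polynomialFunctor f) where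
  a := Z
  str := σ.sup (polyFam (𝟙 _))

lemma SupAlg.polyOf_str {Z : D} (σ : SupAlg f Z) {T : D} {a : T ⟶ A} (t : Fam f a Z) :
    polyOf f t ≫ σ.toAlgebra.str = σ.sup t := by
  refine (σ.nat _ _).trans (σ.congr (by rw [comp_polyLab, polyLabel_polyOf])
    fun k b h h' => ?_)
  have e : (k ≫ polyOf f t) ≫ 𝟙 ((polynomialFunctor f).obj Z) = polyOf f (t.pull k) := by
    rw [Category.comp_id, comp_polyOf]
  refine (polyApp_congr e rfl (by rw [e, polyLabel_polyOf, h'])).trans ?_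
  rw [polyApp_polyOf]
  exact t.app_congr (Category.id_comp _) rfl _

variable (V : Endofunctor.Algebra (polynomialFunctor f))

/-- The element `sup_a t` of a `P_f`-algebra. -/
def wSup {T : D} {a : T ⟶ A} (t : Fam f a V.a) : T ⟶ V.a := polyOf f t ≫ V.str

lemma comp_wSup {T T' : D} (l : T' ⟶ T) {a : T ⟶ A} (t : Fam f a V.a) :
    l ≫ wSup V t = wSup V (t.pull l) := by
  rw [wSup, ← Category.assoc, comp_polyOf]; rfl

lemma wSup_congr {T : D} {a a' : T ⟶ A} (ha : a = a') {t : Fam f a V.a}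
    {t' : Fam f a' V.a} (h : ∀ {U : D} (k : U ⟶ T) (b : U ⟶ B) (h : k ≫ a = b ≫ f)
      (h' : k ≫ a' = b ≫ f), t.app k b h = t'.app k b h') : wSup V t = wSup V t' :=
  congrArg (· ≫ V.str) (polyOf_congr ha h)

lemma wSup_hom {V V' : Endofunctor.Algebra (polynomialFunctor f)} (g : V ⟶ V') {T : D}
    {a : T ⟶ A} (t : Fam f a V.a) : wSup V t ≫ g.f = wSup V' (t.map g.f) := by
  rw [wSup, Category.assoc, ← g.h, ← Category.assoc, polyOf_map, wSup]

/-- A map that preserves the operation `sup` on generalized elements is a morphism of algebras. -/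
def homOfWSup {V V' : Endofunctor.Algebra (polynomialFunctor f)} (g : V.a ⟶ V'.a)
    (h : ∀ {T : D} {a : T ⟶ A} (t : Fam f a V.a), wSup V t ≫ g = wSup V' (t.map g)) : V ⟶ V' where
  f := g
  h := by
    have := h (polyFam (𝟙 ((polynomialFunctor f).obj V.a)))
    simp only [wSup, ← polyOf_map, polyOf_polyFam, Category.id_comp] at this
    exact this.symm

variable {V} (hV : IsInitial V)

/-- The label of the root of a tree. -/
def wLabel : V.a ⟶ A := polyLabel f (strInv hV)

lemma polyLabel_strInv {T : D} (v : T ⟶ V.a) : polyLabel f (v ≫ strInv hV) = v ≫ wLabel hV :=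
  comp_polyLabel _ _ _

/-- The immediate subtree of a tree `v` at `b`. -/
def wChild {T : D} (v : T ⟶ V.a) (b : T ⟶ B) (h : v ≫ wLabel hV = b ≫ f) : T ⟶ V.a :=
  polyApp f (v ≫ strInv hV) b ((polyLabel_strInv hV v).trans h)

lemma comp_wChild {T U : D} (l : U ⟶ T) (v : T ⟶ V.a) (b : T ⟶ B) (h : v ≫ wLabel hV = b ≫ f) :
    l ≫ wChild hV v b h =
      wChild hV (l ≫ v) (l ≫ b) (by rw [Category.assoc, h, Category.assoc]) := by
  rw [wChild, comp_polyApp]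
  exact polyApp_congr (Category.assoc _ _ _).symm rfl _

lemma wChild_congr {T : D} {v v' : T ⟶ V.a} (hv : v = v') {b b' : T ⟶ B} (hb : b = b')
    (h : v ≫ wLabel hV = b ≫ f) : wChild hV v b h = wChild hV v' b' (by rw [← hv, ← hb, h]) := by
  subst hv hb; rfl

/-- The family of immediate subtrees of a tree. -/
def wFam {T : D} (v : T ⟶ V.a) : Fam f (v ≫ wLabel hV) V.a where
  app k b h := wChild hV (k ≫ v) b (by rw [Category.assoc, h])
  nat l k b h := by
    rw [comp_wChild]
    exact wChild_congr hV (Category.assoc _ _ _).symm rfl _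

lemma wSup_strInv {T : D} {a : T ⟶ A} (t : Fam f a V.a) : wSup V t ≫ strInv hV = polyOf f t := by
  rw [wSup, Category.assoc, Endofunctor.Algebra.Initial.right_inv, Category.comp_id]

@[simp]
lemma wSup_wLabel {T : D} {a : T ⟶ A} (t : Fam f a V.a) : wSup V t ≫ wLabel hV = a := by
  rw [← polyLabel_strInv, wSup_strInv, polyLabel_polyOf]

lemma wChild_wSup {T U : D} {a : T ⟶ A} (t : Fam f a V.a) (k : U ⟶ T) (b : U ⟶ B)
    (h : (k ≫ wSup V t) ≫ wLabel hV = b ≫ f) :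
    wChild hV (k ≫ wSup V t) b h = t.app k b (by rw [← h, Category.assoc, wSup_wLabel]) := by
  have e : (k ≫ wSup V t) ≫ strInv hV = polyOf f (t.pull k) := by
    rw [Category.assoc, wSup_strInv, comp_polyOf]
  refine (polyApp_congr e rfl _).trans ((polyApp_polyOf _ _ _).trans ?_)
  exact t.app_congr (Category.id_comp _) rfl _

@[simp]
lemma wSup_wFam {T : D} (v : T ⟶ V.a) : wSup V (wFam hV v) = v := by
  have : polyOf f (wFam hV v) = v ≫ strInv hV := by
    refine Eq.trans ?_ (polyOf_polyFam _)
    refine polyOf_congr (polyLabel_strInv hV v).symm fun k b h h' => ?_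
    exact polyApp_congr (Category.assoc _ _ _) rfl (by rw [Category.assoc, comp_polyLabel, h'])
  rw [wSup, this, Category.assoc, Endofunctor.Algebra.Initial.left_inv, Category.comp_id]

lemma w_ext {T : D} {v v' : T ⟶ V.a} (hl : v ≫ wLabel hV = v' ≫ wLabel hV)
    (h : ∀ {U : D} (k : U ⟶ T) (b : U ⟶ B) (h : (k ≫ v) ≫ wLabel hV = b ≫ f)
      (h' : (k ≫ v') ≫ wLabel hV = b ≫ f), wChild hV (k ≫ v) b h = wChild hV (k ≫ v') b h') :
    v = v' := by
  rw [← wSup_wFam hV v, ← wSup_wFam hV v']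
  exact wSup_congr V hl fun k b h₁ h₂ => h k b (by rw [Category.assoc, h₁])
    (by rw [Category.assoc, h₂])

/-- Definition by recursion on trees. -/
lemma w_rec (hV : IsInitial V) {Z : D} (σ : SupAlg f Z) : ∃! g : V.a ⟶ Z,
    ∀ {T : D} {a : T ⟶ A} (t : Fam f a V.a), wSup V t ≫ g = σ.sup (t.map g) := by
  refine ⟨(hV.to σ.toAlgebra).f, fun t => ?_, fun g hg => ?_⟩
  · exact (wSup_hom (hV.to σ.toAlgebra) t).trans (SupAlg.polyOf_str σ _)
  · let g' : V ⟶ σ.toAlgebra := homOfWSup g fun t =>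
      (hg t).trans (SupAlg.polyOf_str σ _).symm
    exact congrArg (fun x => x.f) (hV.hom_ext g' (hV.to σ.toAlgebra))

lemma comp_rec (hV : IsInitial V) {Z : D} (σ : SupAlg f Z) {g : V.a ⟶ Z}
    (hg : ∀ {T : D} {a : T ⟶ A} (t : Fam f a V.a), wSup V t ≫ g = σ.sup (t.map g))
    {T : D} (v : T ⟶ V.a) : v ≫ g = σ.sup ((wFam hV v).map g) := by
  rw [← hg, wSup_wFam]

/-- A subobject of the W-type that is closed under `sup` is everything. -/
lemma w_induction (hV : IsInitial V) {M : D} (m : M ⟶ V.a) [Mono m]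
    (H : ∀ {T : D} (v : T ⟶ V.a),
      (∀ {U : D} (k : U ⟶ T) (b : U ⟶ B) (h : (k ≫ v) ≫ wLabel hV = b ≫ f),
        ∃ l, l ≫ m = wChild hV (k ≫ v) b h) → ∃ l, l ≫ m = v)
    {T : D} (v : T ⟶ V.a) : ∃ l, l ≫ m = v := by
  have key {T : D} {a : T ⟶ A} (t : Fam f a M) : ∃ l, l ≫ m = wSup V (t.map m) :=
    H _ fun k b h => ⟨t.app k b (by rw [← h, Category.assoc, wSup_wLabel]), by
      rw [wChild_wSup]; rfl⟩
  let σ : SupAlg f M :=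
    { sup := fun t => (key t).choose
      nat := fun {T T'} l {a} t => by
        rw [← cancel_mono m, Category.assoc, (key t).choose_spec, (key (t.pull l)).choose_spec,
          comp_wSup]
        rfl }
  obtain ⟨g, hg, -⟩ := w_rec hV σ
  refine ⟨v ≫ g, ?_⟩
  let m' : σ.toAlgebra ⟶ V := homOfWSup m fun t =>
    (congrArg (· ≫ m) (SupAlg.polyOf_str σ t)).trans (key t).choose_spec
  let g' : V ⟶ σ.toAlgebra := homOfWSup g fun t =>
    (hg t).trans (SupAlg.polyOf_str σ _).symm
  have : g ≫ m = 𝟙 _ := congrArg (fun x => x.f) (hV.hom_ext (g' ≫ m') (𝟙 V))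
  rw [Category.assoc, this, Category.comp_id]

end WTypes

/-! ### Labels pulled back along a map -/

section PulledBack

variable {D : Type u} [Category.{v} D] [HasFiniteLimits D] {B A L : D} {f : B ⟶ A} {c : L ⟶ A}

/-- A family over `f` is a family over the base change of `f` along `c`. -/
def Fam.ofBase {T Z : D} {l : T ⟶ L} (t : Fam f (l ≫ c) Z) : Fam (pullback.fst c f) l Z where
  app k b h := t.app k (b ≫ pullback.snd c f) (by
    rw [← Category.assoc, h, Category.assoc, Category.assoc, pullback.condition])
  nat m k b h := by
    rw [t.nat]
    exact t.app_congr rfl (Category.assoc _ _ _).symm _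

variable [IsExponentiableMap (pullback.fst c f)]
  {V : Endofunctor.Algebra (polynomialFunctor (pullback.fst c f))} (hV : IsInitial V)

/-- The immediate subtree at `b` of a tree whose nodes have labels in `L` and branch according to
the images of the labels under `c : L ⟶ A`. -/
def lChild {T : D} (v : T ⟶ V.a) (b : T ⟶ B) (h : v ≫ wLabel hV ≫ c = b ≫ f) : T ⟶ V.a :=
  wChild hV v (pullback.lift (v ≫ wLabel hV) b ((Category.assoc _ _ _).trans h)) (by simp)

lemma comp_lChild {T U : D} (l : U ⟶ T) (v : T ⟶ V.a) (b : T ⟶ B)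
    (h : v ≫ wLabel hV ≫ c = b ≫ f) :
    l ≫ lChild hV v b h =
      lChild hV (l ≫ v) (l ≫ b) (by rw [Category.assoc, h, Category.assoc]) := by
  rw [lChild, comp_wChild]
  exact wChild_congr hV rfl (by ext <;> simp) _

lemma lChild_congr {T : D} {v v' : T ⟶ V.a} (hv : v = v') {b b' : T ⟶ B} (hb : b = b')
    (h : v ≫ wLabel hV ≫ c = b ≫ f) :
    lChild hV v b h = lChild hV v' b' (by rw [← hv, ← hb, h]) := by
  subst hv hb; rfl

lemma wChild_eq_lChild {T : D} (v : T ⟶ V.a) (b : T ⟶ pullback c f)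
    (h : v ≫ wLabel hV = b ≫ pullback.fst c f) :
    wChild hV v b h = lChild hV v (b ≫ pullback.snd c f) (by
      rw [← Category.assoc, h, Category.assoc, Category.assoc, pullback.condition]) :=
  wChild_congr hV rfl (by ext <;> simp [h]) _

lemma lChild_wSup {T U : D} {a : T ⟶ L} (t : Fam f (a ≫ c) V.a) (k : U ⟶ T) (b : U ⟶ B)
    (h : (k ≫ wSup V t.ofBase) ≫ wLabel hV ≫ c = b ≫ f) (h' : k ≫ a ≫ c = b ≫ f) :
    lChild hV (k ≫ wSup V t.ofBase) b h = t.app k b h' := by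
  rw [lChild, wChild_wSup]
  exact t.app_congr rfl (by simp) _

lemma l_ext {T : D} {v v' : T ⟶ V.a} (hl : v ≫ wLabel hV = v' ≫ wLabel hV)
    (h : ∀ {U : D} (k : U ⟶ T) (b : U ⟶ B) (h : (k ≫ v) ≫ wLabel hV ≫ c = b ≫ f)
      (h' : (k ≫ v') ≫ wLabel hV ≫ c = b ≫ f), lChild hV (k ≫ v) b h = lChild hV (k ≫ v') b h') :
    v = v' := by
  refine w_ext hV hl fun k b hb hb' => ?_
  rw [wChild_eq_lChild, wChild_eq_lChild]
  exact h k _ _ _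

/-- The family of immediate subtrees. -/
def lFam {T : D} (v : T ⟶ V.a) : Fam f ((v ≫ wLabel hV) ≫ c) V.a where
  app k b h := lChild hV (k ≫ v) b (by simpa using h)
  nat l k b h := by
    rw [comp_lChild]
    exact lChild_congr hV (Category.assoc _ _ _).symm rfl _

lemma wSup_lFam {T : D} (v : T ⟶ V.a) : wSup V (lFam hV v).ofBase = v :=
  l_ext hV (by simp) fun k b h h' => lChild_wSup hV _ k b _ (by simpa using h')

end PulledBack

/-! ### Trees with sorts -/

section Sorted

variable {D : Type u} [Category.{v} D] [HasFiniteLimits D] {B A M : D} {f : B ⟶ A}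

section Relabel

variable [IsExponentiableMap (pullback.fst (prod.fst : A ⨯ M ⟶ A) f)]
  {U : Endofunctor.Algebra (polynomialFunctor (pullback.fst (prod.fst : A ⨯ M ⟶ A) f))}
  (hU : IsInitial U)

/-- The tree obtained from a tree with labels in `A × M` by replacing the second component of the
label of the root. -/
def relabel {T : D} (e : T ⟶ U.a) (m : T ⟶ M) : T ⟶ U.a :=
  wSup U (Fam.ofBase (l := prod.lift (e ≫ wLabel hU ≫ prod.fst) m)
    ((lFam hU e).cast (by simp)))

lemma comp_relabel {T T' : D} (l : T' ⟶ T) (e : T ⟶ U.a) (m : T ⟶ M) :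
    l ≫ relabel hU e m = relabel hU (l ≫ e) (l ≫ m) := by
  rw [relabel, comp_wSup]
  refine wSup_congr U (by ext <;> simp) fun k b h h' => ?_
  refine lChild_congr hU (Category.assoc _ _ _) rfl ?_
  have := congrArg (· ≫ prod.fst) h
  simpa [pullback.condition] using this

lemma relabel_wLabel {T : D} (e : T ⟶ U.a) (m : T ⟶ M) :
    relabel hU e m ≫ wLabel hU = prod.lift (e ≫ wLabel hU ≫ prod.fst) m :=
  wSup_wLabel hU _

lemma relabel_self {T : D} (e : T ⟶ U.a) (m : T ⟶ M) (h : e ≫ wLabel hU ≫ prod.snd = m) :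
    relabel hU e m = e := by
  refine Eq.trans (wSup_congr U ?_ ?_) (wSup_lFam hU e)
  · ext <;> simp [h]
  · intros; rfl

end Relabel

/-- Suppose that every label `a` has a sort `p(a) ∈ M` and every branch `b` a prescribed sort
`q(b) ∈ M`. Then the trees such that hereditarily the label of the subtree at a branch has the
prescribed sort form an equalizer of maps between W-types. -/
lemma exists_sorted [IsExponentiableMap f] {V : Endofunctor.Algebra (polynomialFunctor f)}
    (hV : IsInitial V) (hM : HasWType (pullback.fst (prod.fst : A ⨯ M ⟶ A) f))
    (p : A ⟶ M) (q : B ⟶ M) :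
    ∃ (U : D) (α β : V.a ⟶ U), ∀ {T : D} (v : T ⟶ V.a),
      v ≫ α = v ≫ β ↔ ∀ {T' : D} (k : T' ⟶ T) (b : T' ⟶ B) (h : (k ≫ v) ≫ wLabel hV = b ≫ f),
        wChild hV (k ≫ v) b h ≫ α = wChild hV (k ≫ v) b h ≫ β ∧
          wChild hV (k ≫ v) b h ≫ wLabel hV ≫ p = b ≫ q := by
  obtain ⟨_, U, ⟨hU⟩⟩ := hM
  -- the trees in `U` carry an additional sort at every node: `σ` attaches to a node the sort of its
  -- label, and `τ` moreover replaces the sorts of its children by the prescribed ones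
  let σ : SupAlg f U.a :=
    { sup := fun {T a} t => wSup U (Fam.ofBase (l := prod.lift a (a ≫ p)) (t.cast (by simp)))
      nat := fun {T T'} l {a} t => by
        rw [comp_wSup]
        refine wSup_congr U (by ext <;> simp) fun k b h h' => rfl }
  let τ : SupAlg f U.a :=
    { sup := fun {T a} t => wSup U (Fam.ofBase (l := prod.lift a (a ≫ p))
        { app := fun k b h => relabel hU (t.app k b (by simpa using h)) (b ≫ q)
          nat := fun l k b h => by
            rw [comp_relabel, t.nat]
            exact congrArg _ (Category.assoc _ _ _).symm })
      nat := fun {T T'} l {a} t => by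
        rw [comp_wSup]
        refine wSup_congr U (by ext <;> simp) fun k b h h' => rfl }
  obtain ⟨α, hα, -⟩ := w_rec hV σ
  obtain ⟨β, hβ, -⟩ := w_rec hV τ
  have lα {T : D} (v : T ⟶ V.a) :
      (v ≫ α) ≫ wLabel hU = prod.lift (v ≫ wLabel hV) (v ≫ wLabel hV ≫ p) := by
    rw [comp_rec hV σ hα]; exact (wSup_wLabel hU _).trans (by simp)
  have lβ {T : D} (v : T ⟶ V.a) :
      (v ≫ β) ≫ wLabel hU = prod.lift (v ≫ wLabel hV) (v ≫ wLabel hV ≫ p) := by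
    rw [comp_rec hV τ hβ]; exact (wSup_wLabel hU _).trans (by simp)
  have cα {T T' : D} (v : T ⟶ V.a) (k : T' ⟶ T) (b : T' ⟶ B)
      (h : (k ≫ v) ≫ wLabel hV = b ≫ f) (h' : (k ≫ v ≫ α) ≫ wLabel hU ≫ prod.fst = b ≫ f) :
      lChild hU (k ≫ v ≫ α) b h' = wChild hV (k ≫ v) b h ≫ α := by
    rw [lChild_congr hU (congrArg (k ≫ ·) (comp_rec hV σ hα v)) rfl h',
      lChild_wSup hU _ k b _ (by simpa using h)]
    rfl
  have cβ {T T' : D} (v : T ⟶ V.a) (k : T' ⟶ T) (b : T' ⟶ B)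
      (h : (k ≫ v) ≫ wLabel hV = b ≫ f) (h' : (k ≫ v ≫ β) ≫ wLabel hU ≫ prod.fst = b ≫ f) :
      lChild hU (k ≫ v ≫ β) b h' = relabel hU (wChild hV (k ≫ v) b h ≫ β) (b ≫ q) := by
    rw [lChild_congr hU (congrArg (k ≫ ·) (comp_rec hV τ hβ v)) rfl h',
      lChild_wSup hU _ k b _ (by simpa using h)]
    rfl
  refine ⟨U.a, α, β, fun {T} v => ⟨fun hv {T'} k b h => ?_, fun H => ?_⟩⟩
  · have hfst : (k ≫ v ≫ α) ≫ wLabel hU ≫ prod.fst = b ≫ f := by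
      rw [← h, ← Category.assoc, ← Category.assoc k, lα]; simp
    have e := (cα v k b h hfst).symm.trans ((lChild_congr hU (by rw [hv]) rfl hfst).trans
      (cβ v k b h (by rw [← hv]; exact hfst)))
    have e' : wChild hV (k ≫ v) b h ≫ wLabel hV ≫ p = b ≫ q := by
      have := congrArg (· ≫ wLabel hU ≫ prod.snd) e
      rw [← Category.assoc, lα, ← Category.assoc (relabel _ _ _), relabel_wLabel] at this
      simpa using this
    refine ⟨?_, e'⟩
    rw [e]
    apply relabel_self
    rw [← Category.assoc, lβ, ← e']
    simp
  · refine l_ext hU ((lα v).trans (lβ v).symm) fun k b h h' => ?_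
    have hb : (k ≫ v) ≫ wLabel hV = b ≫ f := by
      rw [← h, ← Category.assoc _ (wLabel hU), ← Category.assoc k, lα]; simp
    rw [cα v k b hb, cβ v k b hb, (H k b hb).1, relabel_self]
    rw [← (H k b hb).2, ← Category.assoc, lβ]
    simp

end Sorted

/-! ### Definable predicates on generalized elements -/

section Definable

variable {E : Type u} [Category.{v} E]

/-- A predicate on generalized elements of `X` is `S`-definable if it is membership of a subobject
given by a mono in `S`. -/
def Definable (S : MorphismProperty E) {X : E} (Q : ∀ ⦃T : E⦄, (T ⟶ X) → Prop) : Prop :=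
  ∃ (M : E) (m : M ⟶ X), Mono m ∧ S m ∧ ∀ ⦃T : E⦄ (x : T ⟶ X), Q x ↔ ∃ l, l ≫ m = x

namespace Definable

variable {S : MorphismProperty E} {X : E} {Q Q' : ∀ ⦃T : E⦄, (T ⟶ X) → Prop}

lemma congr (h : Definable S Q) (h' : ∀ ⦃T : E⦄ (x : T ⟶ X), Q x ↔ Q' x) : Definable S Q' := by
  obtain ⟨M, m, hm, hS, H⟩ := h
  exact ⟨M, m, hm, hS, fun T x => (h' x).symm.trans (H x)⟩

lemma toTop (h : Definable S Q) : Definable ⊤ Q := by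
  obtain ⟨M, m, hm, hS, H⟩ := h
  exact ⟨M, m, hm, trivial, H⟩

/-- The mono representing an `S`-definable predicate is in `S`. -/
lemma mem (hS : S.IsStableUnderBaseChange) {M : E} {m : M ⟶ X} [Mono m]
    (h : Definable S (fun ⦃T : E⦄ (x : T ⟶ X) => ∃ l, l ≫ m = x)) : S m := by
  obtain ⟨N, n, hn, hSn, H⟩ := h
  obtain ⟨l, hl⟩ := (H m).1 ⟨𝟙 M, Category.id_comp m⟩
  obtain ⟨l', hl'⟩ := (H n).2 ⟨𝟙 N, Category.id_comp n⟩
  have e : l ≫ l' = 𝟙 M := by rw [← cancel_mono m, Category.assoc, hl', hl, Category.id_comp]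
  have e' : l' ≫ l = 𝟙 N := by rw [← cancel_mono n, Category.assoc, hl, hl', Category.id_comp]
  have : IsIso l := ⟨l', e, e'⟩
  rw [← hl]
  exact (S.cancel_left_of_respectsIso _ _).2 hSn

end Definable

variable [PositiveHeytingCategory E]

/-- The closure properties of a class of maps that make the predicates given by its monos closed
under conjunction, equality and quantification along maps in the class. Classes of small maps have
these properties, and so has the class of all maps. -/
structure AdmitsLogic (S : MorphismProperty E) : Prop where
  pullback_stable : S.IsStableUnderBaseChange
  composition : ∀ {X Y Z : E} (f : X ⟶ Y) (g : Y ⟶ Z), S f → S g → S (f ≫ g)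
  heyting : ∀ {Y X : E} (f : Y ⟶ X), S f → ∀ forallAlong : Subobject Y → Subobject X,
    GaloisConnection (Subobject.pullback f).obj forallAlong →
      ∀ A : Subobject Y, S A.arrow → S (forallAlong A).arrow
  diagonals : ∀ X : E, S (diag X)

lemma AdmitsLogic.top : AdmitsLogic (⊤ : MorphismProperty E) :=
  ⟨inferInstance, fun _ _ _ _ => trivial, fun _ _ _ _ _ _ => trivial, fun _ => trivial⟩

lemma IsClassOfSmallMaps.admitsLogic {S : MorphismProperty E} (h : IsClassOfSmallMaps S) :
    AdmitsLogic S :=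
  ⟨h.pullback_stable, h.composition, h.heyting, h.diagonals⟩

lemma exists_image {X T : E} (x : T ⟶ X) :
    ∃ (I : E) (e : T ⟶ I) (i : I ⟶ X), IsRegularEpi e ∧ Mono i ∧ e ≫ i = x :=
  let F := Regular.strongEpiMonoFactorisation x
  ⟨F.I, F.e, F.m, inferInstance, F.m_mono, F.fac⟩

/-- Factoring through a mono is a local property. -/
lemma factors_of_cover {X M T T' : E} (m : M ⟶ X) [Mono m] (k : T' ⟶ T) [ExtremalEpi k]
    (x : T ⟶ X) (h : ∃ l, l ≫ m = k ≫ x) : ∃ l, l ≫ m = x := by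
  obtain ⟨l, hl⟩ := h
  have := ExtremalEpi.isIso k (pullback.lift l k hl) (pullback.snd m x) (by simp)
  refine ⟨inv (pullback.snd m x) ≫ pullback.fst m x, ?_⟩
  rw [Category.assoc, pullback.condition, IsIso.inv_hom_id_assoc]

namespace Definable

variable {S : MorphismProperty E} {X Y : E} {Q Q' : ∀ ⦃T : E⦄, (T ⟶ X) → Prop}

lemma of_cover (h : Definable S Q) {T T' : E} (k : T' ⟶ T) [ExtremalEpi k] (x : T ⟶ X)
    (hx : Q (k ≫ x)) : Q x := by
  obtain ⟨M, m, hm, hS, H⟩ := h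
  exact (H x).2 (factors_of_cover m k x ((H _).1 hx))

lemma comap (hS : AdmitsLogic S) (h : Definable S Q) (g : Y ⟶ X) :
    Definable S (fun ⦃T : E⦄ (y : T ⟶ Y) => Q (y ≫ g)) := by
  obtain ⟨M, m, hm, hSm, H⟩ := h
  refine ⟨pullback m g, pullback.snd m g, inferInstance,
    hS.pullback_stable.of_isPullback (IsPullback.of_hasPullback m g) hSm, fun T y => ?_⟩
  refine (H _).trans ?_
  constructor
  · rintro ⟨l, hl⟩
    exact ⟨pullback.lift l y hl, by simp⟩
  · rintro ⟨l, rfl⟩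
    exact ⟨l ≫ pullback.fst m g, by simp [pullback.condition]⟩

lemma and (hS : AdmitsLogic S) (h : Definable S Q) (h' : Definable S Q') :
    Definable S (fun ⦃T : E⦄ (x : T ⟶ X) => Q x ∧ Q' x) := by
  obtain ⟨M, m, hm, hSm, H⟩ := h
  obtain ⟨N, n, hn, hSn, K⟩ := h'.comap hS m
  refine ⟨N, n ≫ m, mono_comp _ _, hS.composition _ _ hSn hSm, fun T x => ?_⟩
  constructor
  · rintro ⟨h₁, h₂⟩
    obtain ⟨l, rfl⟩ := (H x).1 h₁
    obtain ⟨l', rfl⟩ := (K l).1 h₂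
    exact ⟨l', (Category.assoc _ _ _).symm⟩
  · rintro ⟨l, rfl⟩
    exact ⟨(H _).2 ⟨l ≫ n, Category.assoc _ _ _⟩,
      by rw [← Category.assoc]; exact (K (l ≫ n)).2 ⟨l, rfl⟩⟩

lemma eq (hS : AdmitsLogic S) (g h : X ⟶ Y) :
    Definable S (fun ⦃T : E⦄ (x : T ⟶ X) => x ≫ g = x ≫ h) := by
  have hd : Definable S (fun ⦃T : E⦄ (y : T ⟶ Y ⨯ Y) => y ≫ prod.fst = y ≫ prod.snd) := by
    refine ⟨Y, diag Y, inferInstance, hS.diagonals Y, fun T y => ⟨fun e => ⟨y ≫ prod.fst, ?_⟩, ?_⟩⟩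
    · ext <;> simp [e]
    · rintro ⟨l, rfl⟩
      simp
  exact (hd.comap hS (prod.lift g h)).congr fun T x => by simp

lemma all (hS : AdmitsLogic S) {g : Y ⟶ X} (hg : S g) {R : ∀ ⦃T : E⦄, (T ⟶ Y) → Prop}
    (h : Definable S R) :
    Definable S (fun ⦃T : E⦄ (x : T ⟶ X) => ∀ ⦃U : E⦄ (k : U ⟶ T) (y : U ⟶ Y),
      k ≫ x = y ≫ g → R y) := by
  obtain ⟨M, m, hm, hSm, H⟩ := h
  obtain ⟨φ, hφ⟩ := PositiveHeytingCategory.heyting g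
  have := hS.pullback_stable
  refine ⟨_, (φ (Subobject.mk m)).arrow, inferInstance, hS.heyting g hg φ hφ _ ?_,
    fun T x => ⟨fun hx => ?_, ?_⟩⟩
  · rw [← Subobject.underlyingIso_hom_comp_eq_mk]
    exact (S.cancel_left_of_respectsIso _ _).2 hSm
  · obtain ⟨I, e, i, _, _, hei⟩ := exists_image x
    have hle : Subobject.mk i ≤ φ (Subobject.mk m) := by
      refine (hφ _ _).1 ?_
      rw [Subobject.pullback_obj_mk (IsPullback.of_hasPullback i g)]
      obtain ⟨l, hl⟩ := factors_of_cover m (pullback.fst (pullback.fst i g) e) (pullback.snd i g)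
        ((H _).1 (hx (pullback.snd (pullback.fst i g) e)
          (pullback.fst (pullback.fst i g) e ≫ pullback.snd i g) (by
            rw [← hei, ← Category.assoc, ← pullback.condition, Category.assoc, Category.assoc,
              pullback.condition])))
      exact Subobject.mk_le_mk_of_comm l hl
    exact ⟨e ≫ Subobject.ofMkLE i _ hle, by rw [Category.assoc, Subobject.ofMkLE_arrow, hei]⟩
  · rintro ⟨l, rfl⟩ U k y hy
    rw [H]
    have hle := (hφ _ _).2 (le_refl (φ (Subobject.mk m)))
    have hp := Subobject.isPullback g (φ (Subobject.mk m))
    refine ⟨hp.lift (k ≫ l) y (by rw [Category.assoc, hy]) ≫ Subobject.ofLEMk _ m hle, ?_⟩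
    rw [Category.assoc, Subobject.ofLEMk_comp, hp.lift_snd]

lemma imp (hS : AdmitsLogic S) (h : Definable S Q) (h' : Definable S Q') :
    Definable S (fun ⦃T : E⦄ (x : T ⟶ X) => ∀ ⦃U : E⦄ (k : U ⟶ T), Q (k ≫ x) → Q' (k ≫ x)) := by
  obtain ⟨M, m, hm, hSm, H⟩ := h
  refine ((h'.comap hS m).all hS hSm).congr fun T x => ?_
  constructor
  · intro hx U k hk
    obtain ⟨l, hl⟩ := (H _).1 hk
    rw [← hl]
    exact hx k l hl.symm
  · intro hx U k y e
    rw [← e]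
    exact hx k ((H _).2 ⟨y, e.symm⟩)

lemma ex (h : Definable ⊤ Q) (g : X ⟶ Y) :
    Definable ⊤ (fun ⦃T : E⦄ (y : T ⟶ Y) => ∃ (U : E) (k : U ⟶ T) (x : U ⟶ X),
      ExtremalEpi k ∧ k ≫ y = x ≫ g ∧ Q x) := by
  obtain ⟨M, m, hm, -, H⟩ := h
  obtain ⟨I, e, i, _, hi, hei⟩ := exists_image (m ≫ g)
  refine ⟨_, i, hi, trivial, fun T y => ⟨?_, ?_⟩⟩
  · rintro ⟨U, k, x, hk, hy, hx⟩
    obtain ⟨l, rfl⟩ := (H x).1 hx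
    exact factors_of_cover i k y ⟨l ≫ e, by rw [hy, Category.assoc, hei, Category.assoc]⟩
  · rintro ⟨l, rfl⟩
    refine ⟨pullback l e, pullback.fst l e, pullback.snd l e ≫ m, inferInstance, ?_,
      (H _).2 ⟨_, rfl⟩⟩
    rw [← Category.assoc, pullback.condition, Category.assoc, Category.assoc, hei]

end Definable

end Definable

/-! ### Well-founded coalgebras and partial recursion -/

section Coalgebras

variable {E : Type u} [Category.{v} E] {B A : E}

/-- A coalgebra for the polynomial functor of `f : B ⟶ A`, through generalized elements: every
element of `J` has a label in `A`, and a child for every element of the fibre over its label. -/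
structure FibCoalg (f : B ⟶ A) (J : E) where
  label : J ⟶ A
  child : ∀ {T : E} (j : T ⟶ J) (b : T ⟶ B), j ≫ label = b ≫ f → (T ⟶ J)
  nat : ∀ {T U : E} (l : U ⟶ T) (j : T ⟶ J) (b : T ⟶ B) (h : j ≫ label = b ≫ f),
    l ≫ child j b h = child (l ≫ j) (l ≫ b) (by rw [Category.assoc, h, Category.assoc])

namespace FibCoalg

variable {f : B ⟶ A} {J J' : E}

lemma child_congr (γ : FibCoalg f J) {T : E} {j j' : T ⟶ J} (hj : j = j') {b b' : T ⟶ B}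
    (hb : b = b') (h : j ≫ γ.label = b ≫ f) :
    γ.child j b h = γ.child j' b' (by rw [← hj, ← hb, h]) := by
  subst hj hb; rfl

/-- Well-foundedness: definable predicates may be proved by induction. -/
def WellFounded (γ : FibCoalg f J) : Prop :=
  ∀ Q : ∀ ⦃T : E⦄, (T ⟶ J) → Prop, Definable ⊤ Q →
    (∀ ⦃T : E⦄ (j : T ⟶ J), (∀ {U : E} (k : U ⟶ T) (b : U ⟶ B) (h : (k ≫ j) ≫ γ.label = b ≫ f),
      Q (γ.child (k ≫ j) b h)) → Q j) → ∀ ⦃T : E⦄ (j : T ⟶ J), Q j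

variable [PositiveHeytingCategory E]

/-- A coalgebra with a morphism to a well-founded coalgebra is well-founded. -/
lemma WellFounded.of_hom {γ : FibCoalg f J} {γ' : FibCoalg f J'} (hwf : γ'.WellFounded)
    (c : J ⟶ J') (hl : c ≫ γ'.label = γ.label)
    (hc : ∀ {T : E} (j : T ⟶ J) (b : T ⟶ B) (h : j ≫ γ.label = b ≫ f),
      γ.child j b h ≫ c = γ'.child (j ≫ c) b (by rw [Category.assoc, hl, h])) :
    γ.WellFounded := by
  intro Q hQ H
  have hQ' := hQ.all AdmitsLogic.top (g := c) trivial
  suffices h : ∀ ⦃T : E⦄ (v : T ⟶ J') ⦃U : E⦄ (k : U ⟶ T) (j : U ⟶ J), k ≫ v = j ≫ c → Q j from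
    fun T j => h (j ≫ c) (𝟙 T) j (Category.id_comp _)
  refine hwf _ hQ' fun T v hv U k j hj => H j fun {U'} l b h => ?_
  have e : (l ≫ k) ≫ v = (l ≫ j) ≫ c := by rw [Category.assoc, hj, Category.assoc]
  refine hv (l ≫ k) b (by rw [e, Category.assoc, hl, h]) (𝟙 U') _ ?_
  rw [Category.id_comp, hc]
  exact γ'.child_congr e rfl _

end FibCoalg

variable {f : B ⟶ A} [PositiveHeytingCategory E] [IsExponentiableMap f]

/-- The W-type as a coalgebra. -/
def wCoalg {V : Endofunctor.Algebra (polynomialFunctor f)} (hV : IsInitial V) :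
    FibCoalg f V.a where
  label := wLabel hV
  child := wChild hV
  nat := comp_wChild hV

lemma wCoalg_wellFounded {V : Endofunctor.Algebra (polynomialFunctor f)} (hV : IsInitial V) :
    (wCoalg hV).WellFounded := by
  rintro Q ⟨M, m, hm, -, H⟩ ih T v
  rw [H]
  refine w_induction hV m (fun v hv => ?_) v
  rw [← H]
  exact ih v fun k b h => (H _).2 (hv k b h)

/-- A tree with labels in `Λ`, in which the label at any branch has the element of `J` and the value
that the label below prescribes, is determined by the element of `J` in the label of its root: the
induction step. -/
lemma eq_of_children_eq {J Z Λ : E} (γ : FibCoalg f J)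
    (dj : Λ ⟶ J) (dt : Λ ⟶ (polynomialFunctor f).obj Z) (dz : Λ ⟶ Z)
    (hlab : ∀ {T : E} (d : T ⟶ Λ), polyLabel f (d ≫ dt) = (d ≫ dj) ≫ γ.label)
    (hmono : ∀ {T : E} (x y : T ⟶ Λ), x ≫ dj = y ≫ dj → x ≫ dt = y ≫ dt → x = y)
    [IsExponentiableMap (pullback.fst (dj ≫ γ.label) f)]
    {V : Endofunctor.Algebra (polynomialFunctor (pullback.fst (dj ≫ γ.label) f))}
    (hV : IsInitial V) {G : E} (ι : G ⟶ V.a) [Mono ι] (g : G ⟶ Λ) (hg : g = ι ≫ wLabel hV)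
    (hchild : ∀ {T : E} (x : T ⟶ G) (b : T ⟶ B) (h : (x ≫ g ≫ dj) ≫ γ.label = b ≫ f),
      ∃ y : T ⟶ G, y ≫ ι = lChild hV (x ≫ ι) b (by simpa [hg] using h) ∧
        y ≫ g ≫ dj = γ.child (x ≫ g ≫ dj) b h ∧
        y ≫ g ≫ dz = polyApp f (x ≫ g ≫ dt) b (by
          rw [← Category.assoc, hlab]; simpa using h))
    {T : E} (x₁ x₂ : T ⟶ G) (hx : x₁ ≫ g ≫ dj = x₂ ≫ g ≫ dj)
    (ih : ∀ {U : E} (l : U ⟶ T) (b : U ⟶ B) (h : ((l ≫ x₁) ≫ g ≫ dj) ≫ γ.label = b ≫ f)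
      (y₁ y₂ : U ⟶ G), y₁ ≫ g ≫ dj = γ.child ((l ≫ x₁) ≫ g ≫ dj) b h →
        y₂ ≫ g ≫ dj = γ.child ((l ≫ x₁) ≫ g ≫ dj) b h → y₁ = y₂) : x₁ = x₂ := by
  have hc {U : E} (l : U ⟶ T) (b : U ⟶ B) (h : ((l ≫ x₁) ≫ g ≫ dj) ≫ γ.label = b ≫ f)
      (h' : ((l ≫ x₂) ≫ g ≫ dj) ≫ γ.label = b ≫ f) :
      lChild hV ((l ≫ x₁) ≫ ι) b (by simpa [hg] using h) =
        lChild hV ((l ≫ x₂) ≫ ι) b (by simpa [hg] using h') ∧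
      polyApp f ((l ≫ x₁) ≫ g ≫ dt) b (by rw [← Category.assoc, hlab]; simpa using h) =
        polyApp f ((l ≫ x₂) ≫ g ≫ dt) b (by rw [← Category.assoc, hlab]; simpa using h') := by
    obtain ⟨y₁, e₁, j₁, z₁⟩ := hchild (l ≫ x₁) b h
    obtain ⟨y₂, e₂, j₂, z₂⟩ := hchild (l ≫ x₂) b h'
    have := ih l b h y₁ y₂ j₁ (j₂.trans (γ.child_congr (by
      rw [Category.assoc, ← hx, Category.assoc]) rfl _))
    exact ⟨by rw [← e₁, this, e₂], by rw [← z₁, this, z₂]⟩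
  have hlabel : x₁ ≫ g = x₂ ≫ g := by
    refine hmono _ _ (by simpa using hx) (poly_ext ?_ fun {U} l b h h' => ?_)
    · rw [hlab, hlab]
      exact congrArg (· ≫ γ.label) (by simpa using hx)
    · refine (polyApp_congr (by simp) rfl h).trans ((hc l b ?_ ?_).2.trans
        (polyApp_congr (by simp) rfl _))
      · rw [← h, ← Category.assoc l, hlab]; simp
      · rw [← h', ← Category.assoc l, hlab]; simp
  rw [← cancel_mono ι]
  refine l_ext hV (by simpa [hg] using hlabel) fun {U} l b h h' => ?_
  exact (lChild_congr hV (Category.assoc _ _ _).symm rfl h).trans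
    ((hc l b (by simpa [hg] using h) (by simpa [hg] using h')).1.trans
      (lChild_congr hV (Category.assoc _ _ _) rfl _))

/-- **Partial recursion.** Let `J` be a well-founded coalgebra, and consider a partial operation
that sends a pair `(j, t)`, of an element `j` of `J` and a family `t` of values in `Z` for the
children of `j`, to a value in `Z`; its domain `Λ` is a subobject of the object of all pairs. There
is a largest subobject `G` of `J` on which recursion along the operation is possible; `g` sends
an element of `G` to the pair to which the operation was applied. It is found among the trees with
labels in `Λ`, as the subobject of those in which the label at any branch has the element of `J`
and the value that the label below prescribes. -/
theorem exists_partial_recursion {S : MorphismProperty E} (hS : S.IsStableUnderBaseChange)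
    (hW : AxiomWE S) (hf : S f) {J Z Λ : E} (γ : FibCoalg f J) (hwf : γ.WellFounded)
    (dj : Λ ⟶ J) (dt : Λ ⟶ (polynomialFunctor f).obj Z) (dz : Λ ⟶ Z)
    (hl : dj ≫ γ.label = polyLabel f dt)
    (hmono : ∀ {T : E} (x y : T ⟶ Λ), x ≫ dj = y ≫ dj → x ≫ dt = y ≫ dt → x = y) :
    ∃ (G : E) (g : G ⟶ Λ), Mono (g ≫ dj) ∧
      (∀ {T : E} (x : T ⟶ G) (b : T ⟶ B) (h : (x ≫ g ≫ dj) ≫ γ.label = b ≫ f)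
        (h' : polyLabel f (x ≫ g ≫ dt) = b ≫ f), ∃ y : T ⟶ G,
          y ≫ g ≫ dj = γ.child (x ≫ g ≫ dj) b h ∧ y ≫ g ≫ dz = polyApp f (x ≫ g ≫ dt) b h') ∧
      (∀ {T : E} (d : T ⟶ Λ), (∀ {U : E} (k : U ⟶ T) (b : U ⟶ B)
        (h : (k ≫ d ≫ dj) ≫ γ.label = b ≫ f) (h' : polyLabel f (k ≫ d ≫ dt) = b ≫ f),
        ∃ y : U ⟶ G, y ≫ g ≫ dj = γ.child (k ≫ d ≫ dj) b h ∧
          y ≫ g ≫ dz = polyApp f (k ≫ d ≫ dt) b h') → ∃ x : T ⟶ G, x ≫ g = d) := by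
  have hlab {T : E} (d : T ⟶ Λ) : polyLabel f (d ≫ dt) = (d ≫ dj) ≫ γ.label := by
    rw [comp_polyLabel, ← hl, Category.assoc]
  have hq : pullback.fst (dj ≫ γ.label) f ≫ dj ≫ γ.label = pullback.snd (dj ≫ γ.label) f ≫ f :=
    pullback.condition
  -- the element of `J` and the value that a label prescribes for the label at a branch
  let q₁ : pullback (dj ≫ γ.label) f ⟶ J :=
    γ.child (pullback.fst _ _ ≫ dj) (pullback.snd _ _) (by rw [Category.assoc, hq])
  let q₂ : pullback (dj ≫ γ.label) f ⟶ Z :=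
    polyApp f (pullback.fst _ _ ≫ dt) (pullback.snd _ _) (by rw [hlab, Category.assoc, hq])
  have hfc : S (pullback.fst (dj ≫ γ.label) f) :=
    hS.of_isPullback (IsPullback.of_hasPullback (dj ≫ γ.label) f).flip hf
  obtain ⟨_, V, ⟨hV⟩⟩ := hW _ hfc
  obtain ⟨U, α, β, hαβ⟩ := exists_sorted (M := J ⨯ Z) hV
    (hW _ (hS.of_isPullback (IsPullback.of_hasPullback _ _).flip hfc))
    (prod.lift dj dz) (prod.lift q₁ q₂)
  let G := equalizer α β
  let ι : G ⟶ V.a := equalizer.ι α β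
  let g : G ⟶ Λ := ι ≫ wLabel hV
  -- the children of a well-sorted tree
  have hchild {T : E} (x : T ⟶ G) (b : T ⟶ B) (h : (x ≫ g ≫ dj) ≫ γ.label = b ≫ f) :
      ∃ y : T ⟶ G, y ≫ ι = lChild hV (x ≫ ι) b (by simpa [g] using h) ∧
        y ≫ g ≫ dj = γ.child (x ≫ g ≫ dj) b h ∧
        y ≫ g ≫ dz = polyApp f (x ≫ g ≫ dt) b (by
          rw [← Category.assoc, hlab]; simpa using h) := by
    have hb : ((x ≫ ι) ≫ wLabel hV) ≫ dj ≫ γ.label = b ≫ f := by simpa [g] using h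
    have := (hαβ (x ≫ ι)).1 (by rw [Category.assoc, equalizer.condition, Category.assoc]) (𝟙 T)
      (pullback.lift ((x ≫ ι) ≫ wLabel hV) b hb) (by simp)
    have e : wChild hV (𝟙 T ≫ x ≫ ι) (pullback.lift ((x ≫ ι) ≫ wLabel hV) b hb) (by simp) =
        lChild hV (x ≫ ι) b (by simpa using hb) :=
      wChild_congr hV (Category.id_comp _) rfl _
    rw [e] at this
    obtain ⟨y, hy⟩ : ∃ y : T ⟶ G, y ≫ ι = lChild hV (x ≫ ι) b (by simpa using hb) :=
      ⟨equalizer.lift _ this.1, equalizer.lift_ι _ _⟩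
    refine ⟨y, hy, ?_, ?_⟩
    · have e₁ := congrArg (· ≫ prod.fst) this.2
      simp only [Category.assoc, prod.lift_fst] at e₁
      have : y ≫ g ≫ dj = lChild hV (x ≫ ι) b (by simpa using hb) ≫ wLabel hV ≫ dj := by
        rw [← hy]; simp [g]
      rw [this, e₁, γ.nat]
      exact γ.child_congr (by simp [g]) (by simp) _
    · have e₂ := congrArg (· ≫ prod.snd) this.2
      simp only [Category.assoc, prod.lift_snd] at e₂
      have : y ≫ g ≫ dz = lChild hV (x ≫ ι) b (by simpa using hb) ≫ wLabel hV ≫ dz := by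
        rw [← hy]; simp [g]
      rw [this, e₂, comp_polyApp]
      exact polyApp_congr (by simp [g]) (by simp) _
  -- a well-sorted tree is determined by the element of `J` at its root, by induction on that
  -- element
  have hmonoG : Mono (g ≫ dj) := by
    have hdef : Definable ⊤ (fun ⦃T : E⦄ (j : T ⟶ J) => ∀ ⦃U : E⦄ (k : U ⟶ T)
        (y : U ⟶ pullback (g ≫ dj) (g ≫ dj)), k ≫ j = y ≫ pullback.fst _ _ ≫ g ≫ dj →
        y ≫ pullback.fst _ _ = y ≫ pullback.snd _ _) :=
      (Definable.eq AdmitsLogic.top _ _).all AdmitsLogic.top trivial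
    have key := hwf _ hdef fun T j ih U k y hy => by
      refine eq_of_children_eq γ dj dt dz hlab hmono hV ι g rfl hchild _ _
        (by simp [pullback.condition]) fun {U'} l b h y₁ y₂ h₁ h₂ => ?_
      have e : (l ≫ y ≫ pullback.fst _ _) ≫ g ≫ dj = (l ≫ k) ≫ j := by simp [hy]
      have := ih (l ≫ k) b (by rw [← e, h]) (𝟙 U') (pullback.lift y₁ y₂ (h₁.trans h₂.symm)) (by
          rw [Category.id_comp, pullback.lift_fst_assoc, h₁]
          exact γ.child_congr e.symm rfl _)
      simpa using this
    refine ⟨fun {T} x y hxy => ?_⟩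
    have := key (x ≫ g ≫ dj) (𝟙 T) (pullback.lift x y hxy) (by simp)
    simpa using this
  refine ⟨G, g, hmonoG, fun {T} x b h h' => ?_, fun {T} d H => ?_⟩
  · obtain ⟨y, -, h₁, h₂⟩ := hchild x b h
    exact ⟨y, h₁, h₂⟩
  · have H' {U : E} (k : U ⟶ T) (b : U ⟶ B) (h : k ≫ d ≫ dj ≫ γ.label = b ≫ f) :=
      H k b (by simpa using h) (by rw [← Category.assoc, hlab]; simpa using h)
    choose y hyj hyz using @H'
    let t : Fam f (d ≫ dj ≫ γ.label) V.a :=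
      { app := fun k b h => y k b h ≫ ι
        nat := fun l k b h => by
          rw [← Category.assoc]
          congr 1
          rw [← cancel_mono (g ≫ dj), Category.assoc, hyj k b h,
            hyj (l ≫ k) (l ≫ b) (by rw [Category.assoc, h, Category.assoc]), γ.nat]
          exact γ.child_congr (Category.assoc _ _ _).symm rfl _ }
    have hs : wSup V t.ofBase ≫ α = wSup V t.ofBase ≫ β := by
      refine (hαβ _).2 fun {T'} k b h => ?_
      have hkb : k ≫ d = b ≫ pullback.fst _ _ := by simpa using h
      have hb : k ≫ d ≫ dj ≫ γ.label = (b ≫ pullback.snd _ _) ≫ f := by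
        rw [← Category.assoc, hkb, Category.assoc, hq, Category.assoc]
      have e : wChild hV (k ≫ wSup V t.ofBase) b h = y k (b ≫ pullback.snd _ _) hb ≫ ι :=
        wChild_wSup hV _ k b h
      have s₁ := hyj k (b ≫ pullback.snd _ _) hb
      have s₂ := hyz k (b ≫ pullback.snd _ _) hb
      rw [e]
      refine ⟨by rw [Category.assoc, Category.assoc, equalizer.condition], ?_⟩
      apply Limits.prod.hom_ext
      · simp only [g, Category.assoc] at s₁
        simp only [Category.assoc, prod.lift_fst, q₁, γ.nat]
        rw [s₁]
        exact γ.child_congr (by rw [← Category.assoc, hkb, Category.assoc]) rfl _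
      · simp only [g, Category.assoc] at s₂
        simp only [Category.assoc, prod.lift_snd, q₂, comp_polyApp]
        rw [s₂]
        exact polyApp_congr (by rw [← Category.assoc, hkb, Category.assoc]) rfl _
    have : wSup V t.ofBase ≫ wLabel hV = d := wSup_wLabel hV _
    exact ⟨equalizer.lift _ hs, ((Category.assoc _ _ _).symm.trans
      (congrArg (· ≫ wLabel hV) (equalizer.lift_ι _ hs))).trans this⟩

end Coalgebras

/-! ### Finite paths in a tree -/

section Paths

variable {E : Type u} [Category.{v} E] [PositiveHeytingCategory E]

/-- Factoring through a mono may be checked on the two parts of a binary sum decomposition. -/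
lemma factors_of_coprod {X Y T Z M : E} (a : T ⟶ X ⨿ Y) (m : M ⟶ Z) [Mono m] (x : T ⟶ Z)
    (h₁ : ∀ {U : E} (k : U ⟶ T) (y : U ⟶ X), k ≫ a = y ≫ coprod.inl → ∃ l, l ≫ m = k ≫ x)
    (h₂ : ∀ {U : E} (k : U ⟶ T) (y : U ⟶ Y), k ≫ a = y ≫ coprod.inr → ∃ l, l ≫ m = k ≫ x) :
    ∃ l, l ≫ m = x := by
  let c' : BinaryCofan (pullback a (coprod.inl : X ⟶ X ⨿ Y))
      (pullback a (coprod.inr : Y ⟶ X ⨿ Y)) :=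
    BinaryCofan.mk (pullback.fst _ _) (pullback.fst _ _)
  obtain ⟨hc⟩ := ((BinaryCofan.isVanKampen_iff _).1
    (FinitaryExtensive.van_kampen' _ (coprodIsCoprod X Y)) c' (pullback.snd _ _)
    (pullback.snd _ _) a pullback.condition.symm
    pullback.condition.symm).2 ⟨IsPullback.of_hasPullback _ _, IsPullback.of_hasPullback _ _⟩
  obtain ⟨l₁, e₁⟩ := h₁ (pullback.fst a coprod.inl) _ pullback.condition
  obtain ⟨l₂, e₂⟩ := h₂ (pullback.fst a coprod.inr) _ pullback.condition
  obtain ⟨l, hl₁, hl₂⟩ := BinaryCofan.IsColimit.desc' hc l₁ l₂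
  refine ⟨l, BinaryCofan.IsColimit.hom_ext hc ?_ ?_⟩
  · exact (Category.assoc _ _ _).symm.trans ((congrArg (· ≫ m) hl₁).trans e₁)
  · exact (Category.assoc _ _ _).symm.trans ((congrArg (· ≫ m) hl₂).trans e₂)

/-- Binary sums are disjoint. -/
lemma unique_of_inl_eq_inr {X Y U : E} (x : U ⟶ X) (y : U ⟶ Y)
    (h : x ≫ (coprod.inl : X ⟶ X ⨿ Y) = y ≫ coprod.inr) (Z : E) : Nonempty (Unique (U ⟶ Z)) := by
  have hp := FinitaryExtensive.isPullback_initial_to_binaryCofan (coprodIsCoprod X Y)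
  have hU : IsInitial U := initialIsInitial.ofStrict (hp.lift x y h)
  exact ⟨⟨⟨hU.to Z⟩, fun _ => hU.hom_ext _ _⟩⟩

lemma eq_of_inl_eq_inr {X Y U Z : E} (x : U ⟶ X) (y : U ⟶ Y)
    (h : x ≫ (coprod.inl : X ⟶ X ⨿ Y) = y ≫ coprod.inr) (z z' : U ⟶ Z) : z = z' :=
  have := (unique_of_inl_eq_inr x y h Z).some
  Subsingleton.elim z z'

lemma IsClassOfSmallMaps.id {S : MorphismProperty E} (hS : IsClassOfSmallMaps S) (X : E) :
    S (𝟙 X) := by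
  have h : S (𝟙 (⊤_ E)) := by
    rw [Subsingleton.elim (𝟙 (⊤_ E)) (terminal.from _)]
    exact hS.one_one
  exact hS.pullback_stable.of_isPullback (IsPullback.of_id_snd (f := terminal.from X)) h

lemma IsClassOfSmallMaps.inr {S : MorphismProperty E} (hS : IsClassOfSmallMaps S) (X Y : E) :
    S (coprod.inr : Y ⟶ X ⨿ Y) := by
  have := hS.pullback_stable
  have hp : IsPullback (𝟙 (⊥_ E)) (initial.to X) (terminal.from _) (terminal.from X) :=
    ⟨⟨Subsingleton.elim _ _⟩, ⟨PullbackCone.IsLimit.mk _ (fun s => s.fst) (by simp)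
      (fun s => (initialIsInitial.ofStrict s.fst).hom_ext _ _) (fun s m h _ => by simpa using h)⟩⟩
  have h := hS.sums _ _ (hS.pullback_stable.of_isPullback hp hS.zero_one) (hS.id Y)
  have e : (coprod.inr : Y ⟶ X ⨿ Y) =
      (coprod.leftUnitor Y).inv ≫ coprod.map (initial.to X) (𝟙 Y) := by simp
  rw [e]
  exact (S.cancel_left_of_respectsIso _ _).2 h

/-- Every W-type `V` has an object of finite paths: a path leads from its start `st` to its end
`en`, there are paths of length zero, a path may be extended from its end to an immediate subtree,
and every path is built in this way. Paths are lists, which are obtained as the unary trees with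
labels `V ⨿ N`: the label `v` in `V` is the empty path at `v`, and has no branch; a label in `N`
extends the path that is its only child. -/
lemma exists_paths {S : MorphismProperty E} (hS : IsClassOfSmallMaps S) (hW : AxiomWE S)
    {B A : E} {f : B ⟶ A} [IsExponentiableMap f] {V : Endofunctor.Algebra (polynomialFunctor f)}
    (hV : IsInitial V) : ∃ (P : E) (st en : P ⟶ V.a),
      (∀ {T : E} (v : T ⟶ V.a), ∃ π : T ⟶ P, π ≫ st = v ∧ π ≫ en = v) ∧
      (∀ {T : E} (π : T ⟶ P) (b : T ⟶ B) (h : (π ≫ en) ≫ wLabel hV = b ≫ f),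
        ∃ π' : T ⟶ P, π' ≫ st = π ≫ st ∧ π' ≫ en = wChild hV (π ≫ en) b h) ∧
      (∀ {M : E} (m : M ⟶ V.a ⨯ V.a) [Mono m], (∃ l, l ≫ m = diag V.a) →
        (∀ {T : E} (w v : T ⟶ V.a) (b : T ⟶ B) (h : w ≫ wLabel hV = b ≫ f),
          (∃ l, l ≫ m = prod.lift w v) → ∃ l, l ≫ m = prod.lift (wChild hV w b h) v) →
        ∀ {T : E} (π : T ⟶ P), ∃ l, l ≫ m = prod.lift (π ≫ en) (π ≫ st)) := by
  -- an element of `N` is a tree `w`, the end of the path to be extended, with the start `v` of that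
  -- path and a branch of `w`
  let N : E := pullback ((prod.fst : V.a ⨯ V.a ⟶ V.a) ≫ wLabel hV) f
  let q : N ⟶ V.a ⨯ V.a := pullback.fst _ _
  have hN : (q ≫ prod.fst) ≫ wLabel hV = pullback.snd _ _ ≫ f := by
    rw [Category.assoc]; exact pullback.condition
  -- the end and the start of the path given by a label
  obtain ⟨p, hp₁, hp₂⟩ : ∃ p : V.a ⨿ N ⟶ V.a ⨯ V.a, coprod.inl ≫ p = diag V.a ∧
      coprod.inr ≫ p =
        prod.lift (wChild hV (q ≫ prod.fst) (pullback.snd _ _) hN) (q ≫ prod.snd) :=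
    ⟨coprod.desc _ _, coprod.inl_desc _ _, coprod.inr_desc _ _⟩
  let φ : N ⟶ V.a ⨿ N := coprod.inr
  have hφ : S φ := hS.inr _ _
  obtain ⟨_, W, ⟨hWi⟩⟩ := hW φ hφ
  obtain ⟨U, α, β, hαβ⟩ := exists_sorted (M := V.a ⨯ V.a) hWi
    (hW _ (hS.pullback_stable.of_isPullback (IsPullback.of_hasPullback _ _).flip hφ)) p q
  let ι := equalizer.ι α β
  refine ⟨equalizer α β, ι ≫ wLabel hWi ≫ p ≫ prod.snd, ι ≫ wLabel hWi ≫ p ≫ prod.fst,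
    fun {T} v => ?_, fun {T} π b h => ?_, fun {M} m _ hd hc {T} π => ?_⟩
  · have hv {U : E} (k : U ⟶ T) (b : U ⟶ N) (h : k ≫ v ≫ coprod.inl = b ≫ φ) :
        (k ≫ v) ≫ coprod.inl = b ≫ φ := (Category.assoc _ _ _).trans h
    let t : Fam φ (v ≫ coprod.inl) W.a :=
      { app := fun k b h => (unique_of_inl_eq_inr _ _ (hv k b h) W.a).some.default
        nat := fun l k b h => eq_of_inl_eq_inr ((l ≫ k) ≫ v) (l ≫ b) (by
          rw [Category.assoc, Category.assoc, h, Category.assoc]) _ _ }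
    have hs : wSup W t ≫ α = wSup W t ≫ β := by
      refine (hαβ _).2 fun {T'} k b h => ?_
      have h' : (k ≫ v) ≫ coprod.inl = b ≫ φ := by rw [← h]; simp
      exact ⟨eq_of_inl_eq_inr _ _ h' _ _, eq_of_inl_eq_inr _ _ h' _ _⟩
    have e : (equalizer.lift _ hs ≫ ι) ≫ wLabel hWi = v ≫ coprod.inl := by
      rw [equalizer.lift_ι, wSup_wLabel]
    refine ⟨equalizer.lift _ hs, ?_, ?_⟩
    · rw [← Category.assoc, ← Category.assoc, e, Category.assoc, reassoc_of% hp₁]; simp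
    · rw [← Category.assoc, ← Category.assoc, e, Category.assoc, reassoc_of% hp₁]; simp
  · have hb : (π ≫ ι ≫ wLabel hWi ≫ p) ≫ prod.fst ≫ wLabel hV = b ≫ f := by simpa using h
    let n : T ⟶ N := pullback.lift (π ≫ ι ≫ wLabel hWi ≫ p) b hb
    let t : Fam φ (n ≫ φ) W.a :=
      { app := fun k _ _ => k ≫ π ≫ ι
        nat := fun l k b h => (Category.assoc _ _ _).symm }
    have hs : wSup W t ≫ α = wSup W t ≫ β := by
      refine (hαβ _).2 fun {T'} k b' h => ?_
      rw [wChild_wSup]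
      have e : b' = k ≫ n := by
        rw [← cancel_mono φ, ← h]; simp
      refine ⟨by simp only [t, Category.assoc]; rw [equalizer.condition], ?_⟩
      simp [t, e, n, q]
    have e : (equalizer.lift _ hs ≫ ι) ≫ wLabel hWi = n ≫ φ := by
      rw [equalizer.lift_ι, wSup_wLabel]
    refine ⟨equalizer.lift _ hs, ?_, ?_⟩
    · rw [← Category.assoc, ← Category.assoc, e, Category.assoc, reassoc_of% hp₂]
      simp [n, q]
    · refine (Category.assoc _ _ _).symm.trans ((Category.assoc _ _ _).symm.trans ?_)
      rw [e, Category.assoc, reassoc_of% hp₂, prod.lift_fst, comp_wChild]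
      exact wChild_congr hV (by simp [n, q]) (by simp [n]) _
  · have hdef : Definable ⊤ (fun ⦃T : E⦄ (e : T ⟶ W.a) => ∀ ⦃U : E⦄ (k : U ⟶ T),
        (k ≫ e) ≫ α = (k ≫ e) ≫ β → ∃ l, l ≫ m = ((k ≫ e) ≫ wLabel hWi ≫ p)) := by
      have hm : Definable ⊤ (fun ⦃T : E⦄ (x : T ⟶ V.a ⨯ V.a) => ∃ l, l ≫ m = x) :=
        ⟨M, m, ‹_›, trivial, fun _ _ => Iff.rfl⟩
      exact (Definable.eq AdmitsLogic.top α β).imp AdmitsLogic.top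
        (Q' := fun ⦃T : E⦄ (e : T ⟶ W.a) => ∃ l, l ≫ m = e ≫ wLabel hWi ≫ p)
        (hm.comap AdmitsLogic.top (wLabel hWi ≫ p))
    have key := wCoalg_wellFounded hWi _ hdef fun {T} e ih {U} k hk => by
      refine factors_of_coprod ((k ≫ e) ≫ wLabel hWi) m _ (fun {U'} l y hy => ?_)
        fun {U'} l n hn => ?_
      · obtain ⟨d, hd⟩ := hd
        refine ⟨y ≫ d, ?_⟩
        rw [← Category.assoc _ _ p, ← Category.assoc l, hy]
        rw [Category.assoc, hd, Category.assoc, hp₁]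
      · have h' : ((l ≫ k) ≫ e) ≫ wLabel hWi = n ≫ φ := by simpa using hn
        obtain ⟨h₁, h₂⟩ := (hαβ (k ≫ e)).1 hk l n (by simpa using hn)
        have ec : wChild hWi (l ≫ k ≫ e) n (by simpa using hn) =
            wChild hWi ((l ≫ k) ≫ e) n h' := wChild_congr hWi (Category.assoc _ _ _).symm rfl _
        rw [ec] at h₁ h₂
        obtain ⟨d, hd⟩ := ih (l ≫ k) n h' (𝟙 _) (by
          rw [Category.id_comp]; exact h₁)
        rw [Category.id_comp] at hd
        have := hc (n ≫ q ≫ prod.fst) (n ≫ q ≫ prod.snd) (n ≫ pullback.snd _ _) (by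
          simpa using congrArg (n ≫ ·) hN) ⟨d, by
            rw [hd]
            refine h₂.trans ?_
            ext <;> simp⟩
        obtain ⟨d', hd'⟩ := this
        refine ⟨d', hd'.trans ?_⟩
        rw [← Category.assoc _ _ p, ← Category.assoc l, hn]
        refine Eq.trans ?_ ((Category.assoc _ _ _).trans (congrArg (n ≫ ·) hp₂)).symm
        ext
        · simp only [Category.assoc, prod.lift_fst, comp_wChild]
        · simp
    obtain ⟨l, hl⟩ := key (π ≫ ι) (𝟙 T) (by
      simp only [Category.assoc, ι]
      rw [equalizer.condition])
    refine ⟨l, hl.trans ?_⟩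
    ext <;> simp

end Paths

/-! ### Smallness by induction -/

section SmallInduction

variable {E : Type u} [Category.{v} E] [PositiveHeytingCategory E]

/-- In a regular category covers are stable under pullback. -/
lemma exists_lift_of_extremalEpi {B A T : E} (x : B ⟶ A) [ExtremalEpi x] (u : T ⟶ A) :
    ∃ (U : E) (c : U ⟶ T) (z : U ⟶ B), ExtremalEpi c ∧ c ≫ u = z ≫ x := by
  obtain ⟨I, e, i, _, _, rfl⟩ := exists_image x
  have := ExtremalEpi.isIso (e ≫ i) e i rfl
  refine ⟨pullback (u ≫ inv i) e, pullback.fst _ _, pullback.snd _ _, inferInstance, ?_⟩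
  rw [← Category.assoc (pullback.snd _ _), ← pullback.condition]
  simp

variable {S : MorphismProperty E}

/-- Smallness of a definable predicate is a local property. -/
lemma Definable.of_extremalEpi (hS : IsClassOfSmallMaps S) {T T' X : E} (k : T' ⟶ T)
    [ExtremalEpi k] {Q : ∀ ⦃T : E⦄, (T ⟶ X) → Prop} (hQ : Definable ⊤ Q) (j : T ⟶ X)
    (h : Definable S (fun ⦃U : E⦄ (u : U ⟶ T') => Q (u ≫ k ≫ j))) :
    Definable S (fun ⦃U : E⦄ (u : U ⟶ T) => Q (u ≫ j)) := by
  obtain ⟨M, m, hm, -, H⟩ := hQ.comap AdmitsLogic.top j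
  refine ⟨M, m, hm, hS.descent (IsPullback.of_hasPullback m k) inferInstance ?_, H⟩
  refine Definable.mem hS.pullback_stable (h.congr fun U u => ?_)
  rw [← Category.assoc]
  refine (H (u ≫ k)).trans ⟨?_, ?_⟩
  · rintro ⟨l, hl⟩
    exact ⟨pullback.lift l u hl, by simp⟩
  · rintro ⟨l, rfl⟩
    exact ⟨l ≫ pullback.fst m k, by simp [pullback.condition]⟩

/-- Let `Q` be a predicate on a well-founded coalgebra that holds at `j` if and only if `Q` holds at
all children of `j` and `j` satisfies an `S`-definable predicate. Then `Q` is `S`-definable: the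
universal small map makes "the truth value of `Q` at `j` is small" a predicate on `j`, which is
proved by induction. -/
lemma IsPredicativeCategoryWithSmallMaps.definable_of_children
    (hS : IsPredicativeCategoryWithSmallMaps S) {B A J : E} {f : B ⟶ A} (hf : S f)
    (γ : FibCoalg f J) (hwf : γ.WellFounded) {Q₀ Q : ∀ ⦃T : E⦄, (T ⟶ J) → Prop}
    (hQ₀ : Definable S Q₀) (hQ : Definable ⊤ Q)
    (h : ∀ ⦃T : E⦄ (j : T ⟶ J), Q j ↔ Q₀ j ∧ ∀ {U : E} (k : U ⟶ T) (b : U ⟶ B)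
      (h : (k ≫ j) ≫ γ.label = b ≫ f), Q (γ.child (k ≫ j) b h)) : Definable S Q := by
  have hL := hS.admitsLogic
  obtain ⟨U', Un, π, hπ, huniv⟩ := hS.representability
  obtain ⟨I, e, i, _, _, rfl⟩ := exists_image π
  have hi : Definable S (fun ⦃T : E⦄ (x : T ⟶ Un) => ∃ l, l ≫ i = x) :=
    ⟨I, i, ‹_›, hS.quotients e i inferInstance hπ, fun _ _ => Iff.rfl⟩
  -- `P j` says that, locally, the truth value of `Q j` is that of membership in `i` of some element
  -- of the base `Un` of the universal small map
  let P : ∀ ⦃T : E⦄, (T ⟶ J) → Prop := fun T j => ∃ (U : E) (k : U ⟶ T) (x : U ⟶ Un ⨯ J),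
    ExtremalEpi k ∧ k ≫ j = x ≫ prod.snd ∧
      ((∀ ⦃V : E⦄ (l : V ⟶ U), (∃ d, d ≫ i = (l ≫ x) ≫ prod.fst) → Q ((l ≫ x) ≫ prod.snd)) ∧
        (∀ ⦃V : E⦄ (l : V ⟶ U), Q ((l ≫ x) ≫ prod.snd) → ∃ d, d ≫ i = (l ≫ x) ≫ prod.fst))
  have hi' : Definable ⊤ (fun ⦃T : E⦄ (x : T ⟶ Un ⨯ J) => ∃ d, d ≫ i = x ≫ prod.fst) :=
    hi.toTop.comap AdmitsLogic.top prod.fst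
  have hQ' : Definable ⊤ (fun ⦃T : E⦄ (x : T ⟶ Un ⨯ J) => Q (x ≫ prod.snd)) :=
    hQ.comap AdmitsLogic.top prod.snd
  have hP : Definable ⊤ P := Definable.ex ((hi'.imp AdmitsLogic.top hQ').and AdmitsLogic.top
    (hQ'.imp AdmitsLogic.top hi')) prod.snd
  -- `P j` means that the truth value of `Q j` is small
  have good_of {T : E} (j : T ⟶ J) (hj : P j) :
      Definable S (fun ⦃U : E⦄ (u : U ⟶ T) => Q (u ≫ j)) := by
    obtain ⟨U, k, x, hk, hx, h₁, h₂⟩ := hj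
    refine Definable.of_extremalEpi hS.toIsClassOfSmallMaps k hQ j
      ((hi.comap hL (x ≫ prod.fst)).congr fun V l => ?_)
    rw [hx, ← Category.assoc, ← Category.assoc]
    exact ⟨h₁ l, h₂ l⟩
  have of_good {T : E} (j : T ⟶ J) (hj : Definable S (fun ⦃U : E⦄ (u : U ⟶ T) => Q (u ≫ j))) :
      P j := by
    obtain ⟨N, n, hn, hSn, H⟩ := hj
    obtain ⟨B', A', b, t, p, t', p', hc, hp⟩ := huniv n hSn
    have := hc.cover_base
    have := hc.cover_lift
    refine ⟨A', p, prod.lift p' (p ≫ j), inferInstance, by simp, fun V l hl => ?_,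
      fun V l hl => ?_⟩
    · obtain ⟨d, hd⟩ := hl
      obtain ⟨V', c, z, _, hz⟩ := exists_lift_of_extremalEpi e d
      refine hQ.of_cover c _ ?_
      have hw : z ≫ e ≫ i = (c ≫ l) ≫ p' := by
        rw [← Category.assoc, ← hz, Category.assoc, hd]; simp
      have := (H (c ≫ l ≫ p)).2 ⟨hp.lift _ _ hw ≫ t, by
        rw [Category.assoc, ← hc.w, hp.lift_snd_assoc, Category.assoc]⟩
      simpa using this
    · obtain ⟨d, hd⟩ := (H (l ≫ p)).1 (by simpa using hl)
      obtain ⟨V', c, z, _, hz⟩ := exists_lift_of_extremalEpi (pullback.lift b t hc.w)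
        (pullback.lift l d hd.symm)
      refine factors_of_cover i c _ ⟨z ≫ t' ≫ e, ?_⟩
      have hz' : c ≫ l = z ≫ b := by simpa using congrArg (· ≫ pullback.fst _ _) hz
      simp only [Category.assoc, prod.lift_fst, hp.w]
      rw [← Category.assoc, ← hz', Category.assoc]
  have key := hwf P hP fun T j ih => of_good j <| by
    have hfc : S (pullback.fst (j ≫ γ.label) f) :=
      hS.pullback_stable.of_isPullback (IsPullback.of_hasPullback _ _).flip hf
    have hj : (pullback.fst (j ≫ γ.label) f ≫ j) ≫ γ.label =
        pullback.snd (j ≫ γ.label) f ≫ f := by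
      rw [Category.assoc, pullback.condition]
    refine (((hQ₀.comap hL j)).and hL
      ((good_of _ (ih (pullback.fst _ _) (pullback.snd _ _) hj)).all hL hfc)).congr
        fun U u => (Iff.trans ?_ (h (u ≫ j)).symm)
    refine and_congr Iff.rfl ⟨fun H V k b hb => ?_, fun H V k y hy => ?_⟩
    · have := H k (pullback.lift (k ≫ u) b (by simpa using hb)) (by simp)
      rw [γ.nat] at this
      rwa [γ.child_congr (j' := k ≫ u ≫ j) (b' := b) (by simp) (by simp)] at this
    · rw [γ.nat]
      have := H k (y ≫ pullback.snd _ _) (by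
        rw [← Category.assoc k, hy]; simpa using congrArg (y ≫ ·) hj)
      rwa [γ.child_congr (j' := y ≫ pullback.fst _ _ ≫ j)
        (by rw [← Category.assoc, hy, Category.assoc]) rfl] at this
  exact (good_of (𝟙 J) (key (𝟙 J))).congr fun T x => by rw [Category.comp_id]

end SmallInduction

/-! ### Presheaves given by restriction operations -/

section RestrOp

variable {E : Type u} [Category.{v} E] [HasFiniteLimits E] {C : InternalCategory E}

lemma InternalCategory.comp_compose (C : InternalCategory E) {T U : E} (k : U ⟶ T)
    (f g : T ⟶ C.C₁) (h : f ≫ C.dom = g ≫ C.cod) :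
    k ≫ C.compose f g h =
      C.compose (k ≫ f) (k ≫ g) (by rw [Category.assoc, h, Category.assoc]) := by
  rw [compose, ← Category.assoc, compose]
  congr 1
  ext <;> simp

lemma InternalCategory.compose_congr (C : InternalCategory E) {T : E} {f f' g g' : T ⟶ C.C₁}
    (hf : f = f') (hg : g = g') (h : f ≫ C.dom = g ≫ C.cod) :
    C.compose f g h = C.compose f' g' (by rw [← hf, ← hg, h]) := by
  subst hf hg; rfl

lemma InternalCategory.compose_assoc (C : InternalCategory E) {T : E} (f g h : T ⟶ C.C₁)
    (hfg : f ≫ C.dom = g ≫ C.cod) (hgh : g ≫ C.dom = h ≫ C.cod) :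
    C.compose (C.compose f g hfg) h (by simp [hgh]) =
      C.compose f (C.compose g h hgh) (by simp [hfg]) :=
  C.assoc f g h hfg hgh

lemma InternalCategory.one_compose (C : InternalCategory E) {T : E} (e f : T ⟶ C.C₁)
    (he : e = f ≫ C.cod ≫ C.one) :
    C.compose e f (by rw [he]; simp [C.one_dom]) = f := by
  subst he
  exact C.one_comp f

lemma InternalCategory.compose_one (C : InternalCategory E) {T : E} (f e : T ⟶ C.C₁)
    (he : e = f ≫ C.dom ≫ C.one) :
    C.compose f e (by rw [he]; simp [C.one_cod]) = f := by
  subst he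
  exact C.comp_one f

lemma InternalPresheaf.restr_congr (X : InternalPresheaf C) {T : E} {x x' : T ⟶ X.obj}
    {f f' : T ⟶ C.C₁} (hx : x = x') (hf : f = f') (h : x ≫ X.anchor = f ≫ C.cod) :
    X.restr x f h = X.restr x' f' (by rw [← hx, ← hf, h]) := by
  subst hx hf; rfl

variable (C) in
/-- A right action of `C` on an object `Z`, as an operation on generalized elements that is natural
in the stage. -/
structure RestrOp (Z : E) where
  anchor : Z ⟶ C.C₀
  op : ∀ {T : E} (z : T ⟶ Z) (f : T ⟶ C.C₁), z ≫ anchor = f ≫ C.cod → (T ⟶ Z)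
  nat : ∀ {T U : E} (l : U ⟶ T) (z : T ⟶ Z) (f : T ⟶ C.C₁) (h : z ≫ anchor = f ≫ C.cod),
    l ≫ op z f h = op (l ≫ z) (l ≫ f) (by rw [Category.assoc, h, Category.assoc])
  op_anchor : ∀ {T : E} (z : T ⟶ Z) (f : T ⟶ C.C₁) (h : z ≫ anchor = f ≫ C.cod),
    op z f h ≫ anchor = f ≫ C.dom
  op_one : ∀ {T : E} (z : T ⟶ Z), op z (z ≫ anchor ≫ C.one) (by simp [C.one_cod]) = z
  op_op : ∀ {T : E} (z : T ⟶ Z) (f g : T ⟶ C.C₁) (h : z ≫ anchor = f ≫ C.cod)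
    (hg : f ≫ C.dom = g ≫ C.cod), op (op z f h) g (by rw [op_anchor, hg]) =
      op z (C.compose f g hg) (by rw [C.compose_cod, h])

namespace RestrOp

variable {Z : E} (ρ : RestrOp C Z)

lemma congr {T : E} {x x' : T ⟶ Z} {f f' : T ⟶ C.C₁} (hx : x = x') (hf : f = f')
    (h : x ≫ ρ.anchor = f ≫ C.cod) : ρ.op x f h = ρ.op x' f' (by rw [← hx, ← hf, h]) := by
  subst hx hf; rfl

lemma lift_op {T : E} (z : T ⟶ Z) (f : T ⟶ C.C₁) (h : z ≫ ρ.anchor = f ≫ C.cod) :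
    pullback.lift z f h ≫ ρ.op (pullback.fst ρ.anchor C.cod) (pullback.snd ρ.anchor C.cod)
      pullback.condition = ρ.op z f h := by
  rw [ρ.nat]
  exact ρ.congr (by simp) (by simp) _

/-- The presheaf given by an action on generalized elements. -/
def toPresheaf : InternalPresheaf C where
  obj := Z
  anchor := ρ.anchor
  act := ρ.op (pullback.fst ρ.anchor C.cod) (pullback.snd ρ.anchor C.cod) pullback.condition
  act_anchor := ρ.op_anchor _ _ _
  act_one x := by rw [ρ.lift_op, ρ.op_one]
  act_comp x f g hf hg := by
    refine (ρ.lift_op _ g _).trans (Eq.trans ?_ (ρ.lift_op _ _ _).symm)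
    exact (ρ.congr (ρ.lift_op x f hf) rfl _).trans (ρ.op_op _ _ _ hf hg)

lemma toPresheaf_restr {T : E} (z : T ⟶ Z) (f : T ⟶ C.C₁) (h : z ≫ ρ.anchor = f ≫ C.cod) :
    ρ.toPresheaf.restr z f h = ρ.op z f h :=
  ρ.lift_op z f h

/-- The restriction of an action to a subobject that is closed under it. -/
def sub {M : E} (m : M ⟶ Z) [Mono m]
    (hm : ∀ {T : E} (x : T ⟶ M) (f : T ⟶ C.C₁) (h : (x ≫ m) ≫ ρ.anchor = f ≫ C.cod),
      ∃ y, y ≫ m = ρ.op (x ≫ m) f h) : RestrOp C M where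
  anchor := m ≫ ρ.anchor
  op x f h := (hm x f ((Category.assoc _ _ _).trans h)).choose
  nat l x f h := by
    rw [← cancel_mono m, Category.assoc,
      (hm x f ((Category.assoc _ _ _).trans h)).choose_spec, ρ.nat, Exists.choose_spec (hm _ _ _)]
    exact ρ.congr (Category.assoc _ _ _).symm rfl _
  op_anchor x f h := by
    rw [← Category.assoc, Exists.choose_spec (hm _ _ _), ρ.op_anchor]
  op_one x := by
    rw [← cancel_mono m, Exists.choose_spec (hm _ _ _)]
    exact (ρ.congr rfl (by simp) _).trans (ρ.op_one _)
  op_op x f g h hg := by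
    rw [← cancel_mono m]
    refine (Exists.choose_spec (hm _ g _)).trans (Eq.trans ?_ (Exists.choose_spec (hm x _ _)).symm)
    exact (ρ.congr (Exists.choose_spec (hm x f _)) rfl _).trans
      (ρ.op_op _ f g ((Category.assoc _ _ _).trans h) hg)

lemma sub_op {M : E} (m : M ⟶ Z) [Mono m]
    (hm : ∀ {T : E} (x : T ⟶ M) (f : T ⟶ C.C₁) (h : (x ≫ m) ≫ ρ.anchor = f ≫ C.cod),
      ∃ y, y ≫ m = ρ.op (x ≫ m) f h) {T : E} (x : T ⟶ M) (f : T ⟶ C.C₁)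
    (h : x ≫ (ρ.sub m hm).anchor = f ≫ C.cod) :
    (ρ.sub m hm).op x f h ≫ m = ρ.op (x ≫ m) f ((Category.assoc _ _ _).trans h) :=
  Exists.choose_spec (hm _ _ _)

end RestrOp

end RestrOp

/-! ### Branches -/

section Branches

variable {E : Type u} [Category.{v} E] [HasFiniteLimits E] {C : InternalCategory E}
  {Y X : InternalPresheaf C} {F : Y ⟶ X}

@[simp]
lemma branchMk_branchArrow {T : E} (x : T ⟶ X.obj) (f : T ⟶ C.C₁) (y : T ⟶ Y.obj)
    (h : x ≫ X.anchor = f ≫ C.cod) (hy : y ≫ F.hom = X.restr x f h) :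
    branchMk F x f y h hy ≫ branchArrow F = f :=
  (pullback.lift_fst_assoc _ _ _ _).trans (pullback.lift_snd _ _ _)

@[simp]
lemma branchMk_branchElt {T : E} (x : T ⟶ X.obj) (f : T ⟶ C.C₁) (y : T ⟶ Y.obj)
    (h : x ≫ X.anchor = f ≫ C.cod) (hy : y ≫ F.hom = X.restr x f h) :
    branchMk F x f y h hy ≫ branchElt F = y :=
  pullback.lift_snd _ _ _

lemma branch_ext {T : E} {b b' : T ⟶ branchObj F} (hx : b ≫ branchMap F = b' ≫ branchMap F)
    (hf : b ≫ branchArrow F = b' ≫ branchArrow F) (hy : b ≫ branchElt F = b' ≫ branchElt F) :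
    b = b' := by
  refine pullback.hom_ext (pullback.hom_ext ?_ ?_) hy
  · simpa [branchMap] using hx
  · simpa [branchArrow] using hf

lemma branch_anchor {T : E} {b : T ⟶ branchObj F} {x : T ⟶ X.obj} (h : x = b ≫ branchMap F) :
    x ≫ X.anchor = (b ≫ branchArrow F) ≫ C.cod := by
  rw [h, Category.assoc, branchMap_anchor, Category.assoc b (branchArrow F)]

lemma branch_hom {T : E} (b : T ⟶ branchObj F) : (b ≫ branchElt F) ≫ F.hom =
    X.restr (b ≫ branchMap F) (b ≫ branchArrow F) (branch_anchor rfl) := by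
  rw [Category.assoc, branchElt_hom, X.comp_restr]

lemma branch_elt_anchor {T : E} (b : T ⟶ branchObj F) :
    (b ≫ branchElt F) ≫ Y.anchor = (b ≫ branchArrow F) ≫ C.dom := by
  rw [Category.assoc, branchElt_anchor, Category.assoc b (branchArrow F)]

/-- The branch `(x, (fg, y · g))` obtained from a branch `(x, (f, y))` and an arrow `g`. -/
def branchRestr {T : E} (b : T ⟶ branchObj F) (g : T ⟶ C.C₁)
    (h : (b ≫ branchArrow F) ≫ C.dom = g ≫ C.cod) : T ⟶ branchObj F :=
  branchMk F (b ≫ branchMap F) (C.compose (b ≫ branchArrow F) g h)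
    (Y.restr (b ≫ branchElt F) g ((branch_elt_anchor b).trans h))
    (by rw [branch_anchor rfl, C.compose_cod])
    (by
      rw [F.restr, ← X.restr_restr _ _ _ (branch_anchor rfl)]
      exact X.restr_congr (branch_hom b) rfl _)

@[simp]
lemma branchRestr_branchMap {T : E} (b : T ⟶ branchObj F) (g : T ⟶ C.C₁)
    (h : (b ≫ branchArrow F) ≫ C.dom = g ≫ C.cod) :
    branchRestr b g h ≫ branchMap F = b ≫ branchMap F :=
  branchMk_branchMap _ _ _ _ _ _

@[simp]
lemma branchRestr_branchArrow {T : E} (b : T ⟶ branchObj F) (g : T ⟶ C.C₁)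
    (h : (b ≫ branchArrow F) ≫ C.dom = g ≫ C.cod) :
    branchRestr b g h ≫ branchArrow F = C.compose (b ≫ branchArrow F) g h :=
  branchMk_branchArrow _ _ _ _ _

@[simp]
lemma branchRestr_branchElt {T : E} (b : T ⟶ branchObj F) (g : T ⟶ C.C₁)
    (h : (b ≫ branchArrow F) ≫ C.dom = g ≫ C.cod) :
    branchRestr b g h ≫ branchElt F =
      Y.restr (b ≫ branchElt F) g ((branch_elt_anchor b).trans h) :=
  branchMk_branchElt _ _ _ _ _

lemma comp_branchRestr {T U : E} (k : U ⟶ T) (b : T ⟶ branchObj F) (g : T ⟶ C.C₁)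
    (h : (b ≫ branchArrow F) ≫ C.dom = g ≫ C.cod) :
    k ≫ branchRestr b g h =
      branchRestr (k ≫ b) (k ≫ g) (by simpa using congrArg (k ≫ ·) h) := by
  refine branch_ext ?_ ?_ ?_
  · rw [Category.assoc, branchRestr_branchMap, branchRestr_branchMap, Category.assoc]
  · rw [Category.assoc, branchRestr_branchArrow, branchRestr_branchArrow, C.comp_compose]
    exact C.compose_congr (Category.assoc _ _ _).symm rfl _
  · rw [Category.assoc, branchRestr_branchElt, branchRestr_branchElt, Y.comp_restr]
    exact Y.restr_congr (Category.assoc _ _ _).symm rfl _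

lemma branchRestr_congr {T : E} {b b' : T ⟶ branchObj F} {g g' : T ⟶ C.C₁} (hb : b = b')
    (hg : g = g') (h : (b ≫ branchArrow F) ≫ C.dom = g ≫ C.cod) :
    branchRestr b g h = branchRestr b' g' (by rw [← hb, ← hg, h]) := by
  subst hb hg; rfl

lemma branch_comp_cod {T : E} {x : T ⟶ X.obj} {f : T ⟶ C.C₁} {h : x ≫ X.anchor = f ≫ C.cod}
    {b : T ⟶ branchObj F} (hb : X.restr x f h = b ≫ branchMap F) :
    f ≫ C.dom = (b ≫ branchArrow F) ≫ C.cod := by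
  rw [← branch_anchor hb, X.restr_anchor]

/-- The branch `(x, (fg, y))` obtained from a branch `(x · f, (g, y))`. -/
def branchReindex {T : E} (x : T ⟶ X.obj) (f : T ⟶ C.C₁) (h : x ≫ X.anchor = f ≫ C.cod)
    (b : T ⟶ branchObj F) (hb : X.restr x f h = b ≫ branchMap F) : T ⟶ branchObj F :=
  branchMk F x (C.compose f (b ≫ branchArrow F) (branch_comp_cod hb)) (b ≫ branchElt F)
    (by rw [h, C.compose_cod])
    (by
      rw [branch_hom, ← X.restr_restr _ _ _ h]
      exact X.restr_congr hb.symm rfl _)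

section Reindex

variable {T : E} (x : T ⟶ X.obj) (f : T ⟶ C.C₁) (h : x ≫ X.anchor = f ≫ C.cod)
  (b : T ⟶ branchObj F) (hb : X.restr x f h = b ≫ branchMap F)

@[simp]
lemma branchReindex_branchMap : branchReindex x f h b hb ≫ branchMap F = x :=
  branchMk_branchMap _ _ _ _ _ _

@[simp]
lemma branchReindex_branchArrow : branchReindex x f h b hb ≫ branchArrow F =
    C.compose f (b ≫ branchArrow F) (branch_comp_cod hb) :=
  branchMk_branchArrow _ _ _ _ _

@[simp]
lemma branchReindex_branchElt : branchReindex x f h b hb ≫ branchElt F = b ≫ branchElt F :=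
  branchMk_branchElt _ _ _ _ _

lemma branchReindex_dom :
    (branchReindex x f h b hb ≫ branchArrow F) ≫ C.dom = (b ≫ branchArrow F) ≫ C.dom :=
  (congrArg (· ≫ C.dom) (branchReindex_branchArrow x f h b hb)).trans (C.compose_dom _ _ _)

end Reindex

lemma branchReindex_congr {T : E} {x x' : T ⟶ X.obj} {f f' : T ⟶ C.C₁} {b b' : T ⟶ branchObj F}
    (hx : x = x') (hf : f = f') (hb : b = b') (h : x ≫ X.anchor = f ≫ C.cod)
    (hb' : X.restr x f h = b ≫ branchMap F) :
    branchReindex x f h b hb' = branchReindex x' f' (by rw [← hx, ← hf, h]) b' (by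
      subst hx hf hb; exact hb') := by
  subst hx hf hb; rfl

lemma comp_branchReindex {T U : E} (k : U ⟶ T) (x : T ⟶ X.obj) (f : T ⟶ C.C₁)
    (h : x ≫ X.anchor = f ≫ C.cod) (b : T ⟶ branchObj F)
    (hb : X.restr x f h = b ≫ branchMap F) :
    k ≫ branchReindex x f h b hb = branchReindex (k ≫ x) (k ≫ f)
      (by rw [Category.assoc, h, Category.assoc]) (k ≫ b)
      ((X.comp_restr _ _ _ h).symm.trans (by rw [hb, Category.assoc])) := by
  refine branch_ext ?_ ?_ ?_
  · refine (Category.assoc _ _ _).trans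
      ((congrArg (k ≫ ·) (branchReindex_branchMap x f h b hb)).trans
      (branchReindex_branchMap _ _ _ _ _).symm)
  · refine (Category.assoc _ _ _).trans
      ((congrArg (k ≫ ·) (branchReindex_branchArrow x f h b hb)).trans
      (((C.comp_compose _ _ _ _).trans ?_).trans (branchReindex_branchArrow _ _ _ _ _).symm))
    exact C.compose_congr rfl (Category.assoc _ _ _).symm _
  · refine (Category.assoc _ _ _).trans
      ((congrArg (k ≫ ·) (branchReindex_branchElt x f h b hb)).trans
      ((Category.assoc _ _ _).symm.trans (branchReindex_branchElt _ _ _ _ _).symm))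

lemma branchReindex_one {T : E} (x : T ⟶ X.obj) (f : T ⟶ C.C₁) (h : x ≫ X.anchor = f ≫ C.cod)
    (b : T ⟶ branchObj F) (hb : X.restr x f h = b ≫ branchMap F)
    (hf : f = x ≫ X.anchor ≫ C.one) : branchReindex x f h b hb = b := by
  have hx : X.restr x f h = x := X.restr_one _ _ hf
  refine branch_ext ?_ ?_ (branchReindex_branchElt _ _ _ _ _)
  · exact (branchReindex_branchMap _ _ _ _ _).trans (hx.symm.trans hb)
  · refine (branchReindex_branchArrow _ _ _ _ _).trans (C.one_compose _ _ ?_)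
    rw [← Category.assoc (b ≫ branchArrow F), ← branch_anchor (hx.symm.trans hb), hf,
      Category.assoc]

lemma branchReindex_reindex {T : E} (x : T ⟶ X.obj) (f g : T ⟶ C.C₁)
    (h : x ≫ X.anchor = f ≫ C.cod) (hg : f ≫ C.dom = g ≫ C.cod) (b : T ⟶ branchObj F)
    (hb : X.restr x (C.compose f g hg) (by rw [h, C.compose_cod]) = b ≫ branchMap F) :
    branchReindex x f h (branchReindex (X.restr x f h) g (by rw [X.restr_anchor, hg]) b
      ((X.restr_restr x f g h hg).trans hb)) (branchReindex_branchMap _ _ _ _ _).symm =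
        branchReindex x (C.compose f g hg) (by rw [h, C.compose_cod]) b hb := by
  have hgb := branch_comp_cod hb
  rw [C.compose_dom] at hgb
  refine branch_ext ?_ ?_ ?_
  · exact (branchReindex_branchMap _ _ _ _ _).trans (branchReindex_branchMap _ _ _ _ _).symm
  · refine (branchReindex_branchArrow _ _ _ _ _).trans (Eq.trans ?_
      ((C.compose_assoc f g _ hg hgb).symm.trans (branchReindex_branchArrow _ _ _ _ _).symm))
    exact C.compose_congr rfl (branchReindex_branchArrow _ _ _ _ _) _
  · exact (branchReindex_branchElt _ _ _ _ _).trans ((branchReindex_branchElt _ _ _ _ _).trans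
      (branchReindex_branchElt _ _ _ _ _).symm)

/-- Reindexing is compatible with the restriction of branches. -/
lemma branchReindex_branchRestr {T : E} (x : T ⟶ X.obj) (f : T ⟶ C.C₁)
    (h : x ≫ X.anchor = f ≫ C.cod) (b : T ⟶ branchObj F)
    (hb : X.restr x f h = b ≫ branchMap F) (g : T ⟶ C.C₁)
    (hg : (b ≫ branchArrow F) ≫ C.dom = g ≫ C.cod) :
    branchReindex x f h (branchRestr b g hg) (hb.trans (branchRestr_branchMap _ _ _).symm) =
      branchRestr (branchReindex x f h b hb) g ((branchReindex_dom x f h b hb).trans hg) := by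
  refine branch_ext ?_ ?_ ?_
  · exact (branchReindex_branchMap _ _ _ _ _).trans
      ((branchReindex_branchMap x f h b hb).symm.trans (branchRestr_branchMap _ _ _).symm)
  · refine (branchReindex_branchArrow _ _ _ _ _).trans (Eq.trans ?_
      (branchRestr_branchArrow _ _ _).symm)
    exact (C.compose_congr rfl (branchRestr_branchArrow _ _ _) _).trans
      ((C.compose_assoc f _ g (branch_comp_cod hb) hg).symm.trans
        (C.compose_congr (branchReindex_branchArrow x f h b hb).symm rfl _))
  · refine (branchReindex_branchElt _ _ _ _ _).trans ((branchRestr_branchElt _ _ _).trans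
      (Eq.trans ?_ (branchRestr_branchElt _ _ _).symm))
    exact Y.restr_congr (branchReindex_branchElt x f h b hb).symm rfl _

/-- `φ` is a base change of the codomain map, composed with a base change of `F`. -/
lemma branchMap_mem {S : MorphismProperty E} (hS : S.IsStableUnderBaseChange)
    (hc : ∀ {X Y Z : E} (f : X ⟶ Y) (g : Y ⟶ Z), S f → S g → S (f ≫ g)) (hcod : S C.cod)
    (hF : S F.hom) : S (branchMap F) :=
  hc _ _ (hS.of_isPullback (IsPullback.of_hasPullback X.act F.hom).flip hF)
    (hS.of_isPullback (IsPullback.of_hasPullback X.anchor C.cod).flip hcod)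

end Branches

/-! ### Restriction and naturality of families -/

section NaturalFamilies

variable {E : Type u} [Category.{v} E] [HasFiniteLimits E] {C : InternalCategory E}
  {Y X : InternalPresheaf C} {F : Y ⟶ X}

/-- The restriction `f^*t` of a family `t` with label `x` along an arrow `f`, with
`(f^*t)(g, y) = t(fg, y)`. -/
def Fam.restr {T Z : E} {x : T ⟶ X.obj} (t : Fam (branchMap F) x Z) (f : T ⟶ C.C₁)
    (h : x ≫ X.anchor = f ≫ C.cod) : Fam (branchMap F) (X.restr x f h) Z where
  app k b hb := t.app k (branchReindex (k ≫ x) (k ≫ f)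
    (by rw [Category.assoc, h, Category.assoc]) b ((X.comp_restr _ _ _ _).symm.trans hb))
      (branchReindex_branchMap _ _ _ _ _).symm
  nat l k b hb := by
    rw [t.nat]
    refine t.app_congr rfl ((comp_branchReindex _ _ _ _ _ _).trans ?_) _
    exact branchReindex_congr (Category.assoc _ _ _).symm (Category.assoc _ _ _).symm rfl _ _

/-- A family `t` in a presheaf `Z` with label `x` is natural if `t(f, y)` has anchor `dom f` and
`t(f, y) · g = t(fg, y · g)`. -/
structure IsNatFam (Z : InternalPresheaf C) {T : E} {x : T ⟶ X.obj}
    (t : Fam (branchMap F) x Z.obj) : Prop where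
  anchor : ∀ {U : E} (k : U ⟶ T) (b : U ⟶ branchObj F) (h : k ≫ x = b ≫ branchMap F),
    t.app k b h ≫ Z.anchor = (b ≫ branchArrow F) ≫ C.dom
  restr : ∀ {U : E} (k : U ⟶ T) (b : U ⟶ branchObj F) (h : k ≫ x = b ≫ branchMap F)
    (g : U ⟶ C.C₁) (hg : (b ≫ branchArrow F) ≫ C.dom = g ≫ C.cod),
    Z.restr (t.app k b h) g ((anchor k b h).trans hg) =
      t.app k (branchRestr b g hg) (by rw [h, branchRestr_branchMap])

variable {Z Z' : InternalPresheaf C} {T : E} {x : T ⟶ X.obj} {t : Fam (branchMap F) x Z.obj}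

lemma IsNatFam.pull (ht : IsNatFam Z t) {U : E} (l : U ⟶ T) : IsNatFam Z (t.pull l) where
  anchor _ _ _ := ht.anchor _ _ _
  restr _ _ _ _ _ := ht.restr _ _ _ _ _

lemma IsNatFam.map (ht : IsNatFam Z t) (G : Z ⟶ Z') : IsNatFam Z' (t.map G.hom) where
  anchor k b h := by
    refine (Category.assoc _ _ _).trans ?_
    rw [G.anchor]
    exact ht.anchor k b h
  restr k b h g hg := (G.restr _ _ _).symm.trans (congrArg (· ≫ G.hom) (ht.restr k b h g hg))

lemma IsNatFam.congr (ht : IsNatFam Z t) {x' : T ⟶ X.obj} {t' : Fam (branchMap F) x' Z.obj}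
    (hx : x = x') (h : ∀ {U : E} (k : U ⟶ T) (b : U ⟶ branchObj F) (h : k ≫ x = b ≫ branchMap F)
      (h' : k ≫ x' = b ≫ branchMap F), t.app k b h = t'.app k b h') : IsNatFam Z t' := by
  subst hx
  obtain rfl : t = t' := Fam.ext fun k b hb => h k b hb hb
  exact ht

lemma IsNatFam.restrict (ht : IsNatFam Z t) (f : T ⟶ C.C₁) (h : x ≫ X.anchor = f ≫ C.cod) :
    IsNatFam Z (t.restr f h) where
  anchor k b hb := (ht.anchor _ _ _).trans (branchReindex_dom _ _ _ _ _)
  restr k b hb g hg := by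
    refine (ht.restr k _ _ g ((branchReindex_dom _ _ _ _ _).trans hg)).trans ?_
    exact t.app_congr rfl (branchReindex_branchRestr _ _ _ _ _ _ _).symm _

lemma Fam.restr_one {T Z : E} {x : T ⟶ X.obj} (t : Fam (branchMap F) x Z) (f : T ⟶ C.C₁)
    (h : x ≫ X.anchor = f ≫ C.cod) (hf : f = x ≫ X.anchor ≫ C.one) {U : E} (k : U ⟶ T)
    (b : U ⟶ branchObj F) (hb : k ≫ X.restr x f h = b ≫ branchMap F)
    (hb' : k ≫ x = b ≫ branchMap F) : (t.restr f h).app k b hb = t.app k b hb' :=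
  t.app_congr rfl (branchReindex_one _ _ _ _ _ (by rw [hf]; simp)) _

lemma Fam.restr_restr {T Z : E} {x : T ⟶ X.obj} (t : Fam (branchMap F) x Z) (f g : T ⟶ C.C₁)
    (h : x ≫ X.anchor = f ≫ C.cod) (hg : f ≫ C.dom = g ≫ C.cod)
    {U : E} (k : U ⟶ T) (b : U ⟶ branchObj F) (hb hb') :
    ((t.restr f h).restr g (by rw [X.restr_anchor, hg])).app k b hb =
      (t.restr (C.compose f g hg) (by rw [h, C.compose_cod])).app k b hb' := by
  refine t.app_congr rfl ?_ _
  have e : (k ≫ f) ≫ C.dom = (k ≫ g) ≫ C.cod := by rw [Category.assoc, hg, Category.assoc]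
  have e' : (k ≫ x) ≫ X.anchor = (k ≫ f) ≫ C.cod := by rw [Category.assoc, h, Category.assoc]
  have eb : X.restr (k ≫ x) (C.compose (k ≫ f) (k ≫ g) e) (by rw [e', C.compose_cod]) =
      b ≫ branchMap F := by
    rw [← hb', X.comp_restr]
    exact X.restr_congr rfl (C.comp_compose _ _ _ _).symm _
  refine Eq.trans (branchReindex_congr rfl rfl ?_ _ _)
    ((branchReindex_reindex (k ≫ x) (k ≫ f) (k ≫ g) e' e b eb).trans ?_)
  · exact branchReindex_congr (X.comp_restr _ _ _ _) rfl rfl _ _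
  · exact branchReindex_congr rfl (C.comp_compose _ _ _ _).symm rfl _ _

end NaturalFamilies

/-! ### Trees as a presheaf -/

section TreePresheaf

variable {E : Type u} [Category.{v} E] [HasFiniteLimits E] {C : InternalCategory E}
  {Y X : InternalPresheaf C} {F : Y ⟶ X} [IsExponentiableMap (branchMap F)]
  {V : Endofunctor.Algebra (polynomialFunctor (branchMap F))} (hV : IsInitial V)

/-- Restriction of trees is an action on the W-type of `φ`; naturality of the trees plays no role
here. -/
def treeOp : RestrOp C V.a where
  anchor := wLabel hV ≫ X.anchor
  op v f h := wSup V ((wFam hV v).restr f ((Category.assoc _ _ _).trans h))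
  nat l v f h := by
    rw [comp_wSup]
    refine wSup_congr V (by rw [X.comp_restr]; exact X.restr_congr (by simp) rfl _)
      fun k b hb hb' => ?_
    exact wChild_congr hV (Category.assoc _ _ _)
      (branchReindex_congr (by simp) (by simp) rfl _ _)
      ((Category.assoc _ _ _).trans (branchReindex_branchMap _ _ _ _ _).symm)
  op_anchor v f h := by
    rw [← Category.assoc, wSup_wLabel, X.restr_anchor]
  op_one v := by
    refine Eq.trans (wSup_congr V (X.restr_one _ _ (by simp)) fun k b hb hb' => ?_) (wSup_wFam hV v)
    exact (wFam hV v).restr_one _ _ (by simp) k b hb hb'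
  op_op v f g h hg := by
    refine wSup_congr V ((X.restr_congr (wSup_wLabel hV _) rfl _).trans
      (X.restr_restr _ _ _ _ hg)) fun k b hb hb' => ?_
    refine Eq.trans ?_ ((wFam hV v).restr_restr f g ((Category.assoc _ _ _).trans h) hg k b
      ((X.restr_restr _ _ _ _ hg).symm ▸ hb') hb')
    exact (wChild_wSup hV ((wFam hV v).restr f ((Category.assoc _ _ _).trans h)) k _
      ((Category.assoc _ _ _).trans (branchReindex_branchMap _ _ _ _ _).symm)).trans
      (Fam.app_congr ((wFam hV v).restr f ((Category.assoc _ _ _).trans h)) rfl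
      (branchReindex_congr (by rw [wSup_wLabel]) rfl rfl _ _)
      (by rw [branchReindex_branchMap, wSup_wLabel]))

lemma treeOp_wLabel {T : E} (v : T ⟶ V.a) (f : T ⟶ C.C₁)
    (h : v ≫ (treeOp hV).anchor = f ≫ C.cod) : (treeOp hV).op v f h ≫ wLabel hV =
      X.restr (v ≫ wLabel hV) f ((Category.assoc _ _ _).trans h) :=
  wSup_wLabel hV _

/-- The children of `v · f` are children of `v`. -/
lemma wChild_treeOp {T U : E} (v : T ⟶ V.a) (f : T ⟶ C.C₁)
    (h : v ≫ (treeOp hV).anchor = f ≫ C.cod) (k : U ⟶ T) (b : U ⟶ branchObj F)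
    (hb : (k ≫ (treeOp hV).op v f h) ≫ wLabel hV = b ≫ branchMap F) :
    wChild hV (k ≫ (treeOp hV).op v f h) b hb =
      ((wFam hV v).restr f ((Category.assoc _ _ _).trans h)).app k b
        ((congrArg (k ≫ ·) (treeOp_wLabel hV v f h).symm).trans
          ((Category.assoc _ _ _).symm.trans hb)) :=
  wChild_wSup hV _ _ _ _

lemma treeLabel_eq {T : E} (v : T ⟶ V.a) : treeLabel hV v = v ≫ wLabel hV :=
  polyLabel_strInv hV v

lemma treeRoot_eq {T : E} (v : T ⟶ V.a) : treeRoot hV v = v ≫ (treeOp hV).anchor := by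
  rw [treeRoot, treeLabel_eq, Category.assoc]; rfl

lemma comp_treeFun {T U : E} (v : T ⟶ V.a)
    (m : U ⟶ pullback (treeLabel hV v) (branchMap F)) (k : U ⟶ T) (b : U ⟶ branchObj F)
    (hk : m ≫ pullback.fst _ _ = k) (hb : m ≫ pullback.snd _ _ = b) :
    m ≫ treeFun hV v = wChild hV (k ≫ v) b (by
      rw [Category.assoc, ← treeLabel_eq, ← hk, ← hb, Category.assoc, pullback.condition,
        Category.assoc]) := by
  subst hk hb
  have e : m = pullback.lift (m ≫ pullback.fst _ _) (m ≫ pullback.snd _ _) (by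
      rw [Category.assoc, pullback.condition, Category.assoc]) := by ext <;> simp
  refine (congrArg (· ≫ treeFun hV v) e).trans ((lift_polyFun _ _ _ _).trans ?_)
  exact polyApp_congr (Category.assoc _ _ _).symm rfl _

lemma treeSup_eq {T : E} (x : T ⟶ X.obj) (t : pullback x (branchMap F) ⟶ V.a) :
    treeSup V x t = wSup V (Fam.ofHom (IsPullback.of_hasPullback x (branchMap F)) t) :=
  congrArg (· ≫ V.str) (polyMk_eq_polyOf _ _)

lemma treeRestr_eq {T : E} (v : T ⟶ V.a) (f : T ⟶ C.C₁) (h : treeRoot hV v = f ≫ C.cod) :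
    treeRestr hV v f h = (treeOp hV).op v f ((treeRoot_eq hV v).symm.trans h) := by
  refine (treeSup_eq _ _).trans
    (wSup_congr V (X.restr_congr (treeLabel_eq hV v) rfl _) fun {U} k b hb hb' => ?_)
  refine (Category.assoc _ _ _).symm.trans ((comp_treeFun hV v _ k _ ?_ rfl).trans
    (wChild_congr hV rfl ?_ _))
  · change (_ ≫ pullback.lift _ (branchMk F _ _ _ _ _) _) ≫ pullback.fst _ _ = _
    rw [Category.assoc, pullback.lift_fst, IsPullback.lift_fst]
  · have e₁ := (IsPullback.of_hasPullback (X.restr (treeLabel hV v) f h) (branchMap F)).lift_fst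
      k b hb
    have e₂ := (IsPullback.of_hasPullback (X.restr (treeLabel hV v) f h) (branchMap F)).lift_snd
      k b hb
    change (_ ≫ pullback.lift _ (branchMk F _ _ _ _ _) _) ≫ pullback.snd _ _ = _
    rw [Category.assoc, pullback.lift_snd]
    refine branch_ext ?_ ?_ ?_
    · rw [Category.assoc, branchMk_branchMap, branchReindex_branchMap, ← treeLabel_eq,
        ← Category.assoc, e₁]
    · refine (Category.assoc _ _ _).trans ((congrArg _ (branchMk_branchArrow _ _ _ _ _)).trans
        (Eq.trans ?_ (branchReindex_branchArrow _ _ _ _ _).symm))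
      rw [C.comp_compose]
      exact C.compose_congr (by rw [← Category.assoc, e₁]) (by rw [← Category.assoc, e₂]) _
    · refine (Category.assoc _ _ _).trans ((congrArg _ (branchMk_branchElt _ _ _ _ _)).trans
        (Eq.trans ?_ (branchReindex_branchElt _ _ _ _ _).symm))
      rw [← Category.assoc, e₂]

/-- A tree is natural if its family of immediate subtrees is natural, in the presheaf of all
trees. -/
lemma isNaturalTree_iff {T : E} (v : T ⟶ V.a) :
    IsNaturalTree hV v ↔ IsNatFam (treeOp hV).toPresheaf (wFam hV v) := by
  have hl {U : E} {k : U ⟶ T} {b : U ⟶ branchObj F} (h : k ≫ v ≫ wLabel hV = b ≫ branchMap F) :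
      k ≫ treeLabel hV v = b ≫ branchMap F := by rw [treeLabel_eq, h]
  have hf {U : E} (k : U ⟶ T) (b : U ⟶ branchObj F) (h : k ≫ v ≫ wLabel hV = b ≫ branchMap F) :
      pullback.lift k b (hl h) ≫ treeFun hV v = (wFam hV v).app k b h :=
    comp_treeFun hV v _ k b (by simp) (by simp)
  have hpair {U : E} (m : U ⟶ pullback (treeLabel hV v) (branchMap F)) :
      (m ≫ pullback.fst _ _) ≫ v ≫ wLabel hV = (m ≫ pullback.snd _ _) ≫ branchMap F := by
    rw [← treeLabel_eq, Category.assoc, pullback.condition, Category.assoc]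
  have hpr {U : E} (m : U ⟶ pullback (treeLabel hV v) (branchMap F)) (g : U ⟶ C.C₁)
      (h : pairArrow m ≫ C.dom = g ≫ C.cod)
      (h' : ((m ≫ pullback.snd _ _) ≫ branchArrow F) ≫ C.dom = g ≫ C.cod) :
      pairRestr m g h ≫ pullback.snd _ _ = branchRestr (m ≫ pullback.snd _ _) g h' := by
    rw [pairRestr, pullback.lift_snd]
    refine branch_ext ?_ ?_ ?_
    · refine (branchMk_branchMap _ _ _ _ _ _).trans (Eq.trans ?_ (branchRestr_branchMap _ _ _).symm)
      rw [Category.assoc, Category.assoc, pullback.condition]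
    · refine (branchMk_branchArrow _ _ _ _ _).trans
        (Eq.trans ?_ (branchRestr_branchArrow _ _ _).symm)
      exact C.compose_congr (Category.assoc _ _ _).symm rfl _
    · refine (branchMk_branchElt _ _ _ _ _).trans
        (Eq.trans ?_ (branchRestr_branchElt _ _ _).symm)
      exact Y.restr_congr (Category.assoc _ _ _).symm rfl _
  constructor
  · rintro ⟨hv, H⟩
    have anc {U : E} (k : U ⟶ T) (b : U ⟶ branchObj F)
        (h : k ≫ v ≫ wLabel hV = b ≫ branchMap F) :
        (wFam hV v).app k b h ≫ (treeOp hV).anchor = (b ≫ branchArrow F) ≫ C.dom := by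
      rw [← hf k b h, ← treeRoot_eq, hv.root_eq hV]
      simp [pairArrow]
    refine ⟨anc, fun k b h g hg => ?_⟩
    have hg' : pairArrow (pullback.lift k b (hl h)) ≫ C.dom = g ≫ C.cod := by
      rw [← hg]; simp [pairArrow]
    have := H (pullback.lift k b (hl h)) g hg'
    rw [treeRestr_eq] at this
    refine (RestrOp.toPresheaf_restr _ _ _ _).trans (((treeOp hV).congr (hf k b h).symm rfl _).trans
      (this.trans ((comp_treeFun hV v _ k _ (by simp [pairRestr]) rfl).trans ?_)))
    refine wChild_congr hV rfl ((hpr _ g hg' (by rw [← hg, pullback.lift_snd])).trans ?_) _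
    exact branchRestr_congr (by simp) rfl _
  · rintro ⟨anc, H⟩
    have hv : IsComposableTree hV v := by
      have := anc (pullback.fst (treeLabel hV v) (branchMap F)) (pullback.snd _ _)
        (by simpa using hpair (𝟙 _))
      rw [IsComposableTree, treeRoot_eq, ← Category.id_comp (treeFun hV v),
        comp_treeFun hV v (𝟙 _) (pullback.fst _ _) (pullback.snd _ _) (by simp) (by simp)]
      exact this.trans (Category.assoc _ _ _)
    refine ⟨hv, fun {U} m g h => ?_⟩
    have h' : ((m ≫ pullback.snd _ _) ≫ branchArrow F) ≫ C.dom = g ≫ C.cod := by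
      rw [← h, Category.assoc m]
    rw [treeRestr_eq, comp_treeFun hV v (pairRestr m g h) (m ≫ pullback.fst _ _)
      (branchRestr (m ≫ pullback.snd _ _) g h') (by simp [pairRestr]) (hpr m g h h')]
    refine Eq.trans ?_ (((RestrOp.toPresheaf_restr _ _ _ _).symm).trans (H (m ≫ pullback.fst _ _)
      (m ≫ pullback.snd _ _) (hpair m) g h'))
    exact (treeOp hV).congr (comp_treeFun hV v m _ _ rfl rfl) rfl _

end TreePresheaf

/-! ### Naturality is a definable predicate -/

section DefinableNaturality

variable {E : Type u} [Category.{v} E] [PositiveHeytingCategory E] {S : MorphismProperty E}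

/-- A definable predicate on a definable subobject is definable. -/
lemma Definable.onSub (hS : AdmitsLogic S) {M X : E} {m : M ⟶ X} [Mono m] (hm : S m)
    {R : ∀ ⦃T : E⦄, (T ⟶ M) → Prop} (hR : Definable S R) :
    Definable S (fun ⦃T : E⦄ (x : T ⟶ X) => ∃ l, l ≫ m = x ∧ R l) := by
  obtain ⟨N, n, hn, hSn, H⟩ := hR
  refine ⟨N, n ≫ m, mono_comp _ _, hS.composition _ _ hSn hm, fun T x => ⟨?_, ?_⟩⟩
  · rintro ⟨l, rfl, hl⟩
    obtain ⟨d, rfl⟩ := (H l).1 hl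
    exact ⟨d, (Category.assoc _ _ _).symm⟩
  · rintro ⟨d, rfl⟩
    exact ⟨d ≫ n, Category.assoc _ _ _, (H _).2 ⟨d, rfl⟩⟩

variable {C : InternalCategory E}

lemma Definable.restr_eq (hS : AdmitsLogic S) (Z : InternalPresheaf C) {J : E} (z : J ⟶ Z.obj)
    (g : J ⟶ C.C₁) (z' : J ⟶ Z.obj) : Definable S (fun ⦃T : E⦄ (j : T ⟶ J) =>
      ∃ h : (j ≫ z) ≫ Z.anchor = (j ≫ g) ≫ C.cod, Z.restr (j ≫ z) (j ≫ g) h = j ≫ z') := by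
  obtain ⟨M, m, hm, hSm, H⟩ := Definable.eq hS (z ≫ Z.anchor) (g ≫ C.cod)
  have hc : (m ≫ z) ≫ Z.anchor = (m ≫ g) ≫ C.cod := by
    simpa using (H m).2 ⟨𝟙 M, Category.id_comp m⟩
  refine ((Definable.eq hS (Z.restr (m ≫ z) (m ≫ g) hc) (m ≫ z')).onSub hS hSm).congr
    fun T j => ⟨?_, ?_⟩
  · rintro ⟨l, rfl, hl⟩
    refine ⟨by simpa using congrArg (l ≫ ·) hc, ?_⟩
    exact (Z.restr_congr (Category.assoc _ _ _) (Category.assoc _ _ _) _).trans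
      ((Z.comp_restr l (m ≫ z) (m ≫ g) hc).symm.trans (hl.trans (Category.assoc _ _ _).symm))
  · rintro ⟨h, e⟩
    obtain ⟨l, rfl⟩ := (H j).1 (by simpa using h)
    refine ⟨l, rfl, ?_⟩
    rw [← Category.assoc, ← e, Z.comp_restr]
    exact Z.restr_congr (Category.assoc _ _ _).symm (Category.assoc _ _ _).symm _

/-- Naturality of families is definable, since it is expressed by quantification along `φ` and along
the codomain map, and by equations. -/
lemma Definable.isNatFam (hS : AdmitsLogic S) {Y X : InternalPresheaf C} {F : Y ⟶ X}
    (hφ : S (branchMap F)) (hcod : S C.cod) (Z : InternalPresheaf C) {J : E} {x : J ⟶ X.obj}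
    (t : Fam (branchMap F) x Z.obj) :
    Definable S (fun ⦃T : E⦄ (j : T ⟶ J) => IsNatFam Z (t.pull j)) := by
  -- `N` consists of the `(j, (f, y))` with `(f, y)` a branch at `x(j)`, and `K` of these with an
  -- arrow whose codomain is `dom f`; naturality is quantification along `K ⟶ N ⟶ J`
  let N := pullback x (branchMap F)
  let n₁ : N ⟶ J := pullback.fst _ _
  let n₂ : N ⟶ branchObj F := pullback.snd _ _
  have hN : n₁ ≫ x = n₂ ≫ branchMap F := pullback.condition
  have hn₁ : S n₁ := hS.pullback_stable.of_isPullback (IsPullback.of_hasPullback _ _).flip hφ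
  let K := pullback ((n₂ ≫ branchArrow F) ≫ C.dom) C.cod
  let k₁ : K ⟶ N := pullback.fst _ _
  let k₂ : K ⟶ C.C₁ := pullback.snd _ _
  have hK : k₁ ≫ (n₂ ≫ branchArrow F) ≫ C.dom = k₂ ≫ C.cod := pullback.condition
  have hK' : ((k₁ ≫ n₂) ≫ branchArrow F) ≫ C.dom = k₂ ≫ C.cod := by
    rw [← hK]; simp only [Category.assoc]
  have hk₁ : S k₁ := hS.pullback_stable.of_isPullback (IsPullback.of_hasPullback _ _).flip hcod
  have h₁ : Definable S (fun ⦃T : E⦄ (j : T ⟶ J) => ∀ ⦃U : E⦄ (k : U ⟶ T) (n : U ⟶ N),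
      k ≫ j = n ≫ n₁ → n ≫ t.app n₁ n₂ hN ≫ Z.anchor = n ≫ (n₂ ≫ branchArrow F) ≫ C.dom) :=
    (Definable.eq hS _ _).all hS hn₁
  have h₂ := ((Definable.restr_eq hS Z (k₁ ≫ t.app n₁ n₂ hN) k₂
    (t.app (k₁ ≫ n₁) (branchRestr (k₁ ≫ n₂) k₂ hK') (by
      rw [branchRestr_branchMap, Category.assoc, hN, Category.assoc]))).all hS hk₁).all hS hn₁
  have ht {U T : E} (j : T ⟶ J) (k : U ⟶ T) (b : U ⟶ branchObj F)
      (h : k ≫ j ≫ x = b ≫ branchMap F) (n : U ⟶ N) (hn : n ≫ n₁ = k ≫ j) (hb : n ≫ n₂ = b) :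
      n ≫ t.app n₁ n₂ hN = (t.pull j).app k b h := by
    rw [t.nat]
    exact t.app_congr hn hb _
  have ht' {U T : E} (j : T ⟶ J) (k : U ⟶ T) (b : U ⟶ branchObj F) (g : U ⟶ C.C₁)
      (h : k ≫ j ≫ x = b ≫ branchMap F) (hg : (b ≫ branchArrow F) ≫ C.dom = g ≫ C.cod)
      (l : U ⟶ K) (hn : l ≫ k₁ ≫ n₁ = k ≫ j) (hb : l ≫ k₁ ≫ n₂ = b) (hl : l ≫ k₂ = g) :
      l ≫ t.app (k₁ ≫ n₁) (branchRestr (k₁ ≫ n₂) k₂ hK') (by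
        rw [branchRestr_branchMap, Category.assoc, hN, Category.assoc]) =
        (t.pull j).app k (branchRestr b g hg) (by rw [h, branchRestr_branchMap]) := by
    rw [t.nat]
    refine t.app_congr hn ?_ _
    rw [comp_branchRestr]
    exact branchRestr_congr hb hl _
  refine (h₁.and hS h₂).congr fun T j => ⟨?_, fun H => ⟨fun U k n hn => ?_,
    fun U k n hn U' k' l hl => ?_⟩⟩
  · rintro ⟨H₁, H₂⟩
    have anc {U : E} (k : U ⟶ T) (b : U ⟶ branchObj F) (h : k ≫ j ≫ x = b ≫ branchMap F) :
        (t.pull j).app k b h ≫ Z.anchor = (b ≫ branchArrow F) ≫ C.dom := by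
      have e : n₁ = pullback.fst x (branchMap F) := rfl
      have := H₁ k (pullback.lift (k ≫ j) b ((Category.assoc _ _ _).trans h)) (by simp [n₁])
      rw [← Category.assoc, ht j k b h _ (by simp [n₁]) (by simp [n₂])] at this
      rw [this]
      simp [n₂]
    refine ⟨anc, fun {U} k b h g hg => ?_⟩
    let n : U ⟶ N := pullback.lift (k ≫ j) b ((Category.assoc _ _ _).trans h)
    have hn₁' : n ≫ n₁ = k ≫ j := pullback.lift_fst _ _ _
    have hn₂' : n ≫ n₂ = b := pullback.lift_snd _ _ _
    have hg' : n ≫ (n₂ ≫ branchArrow F) ≫ C.dom = g ≫ C.cod := by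
      rw [← hg, ← hn₂']; simp only [Category.assoc]
    let l : U ⟶ K := pullback.lift n g hg'
    have hl₁ : l ≫ k₁ = n := pullback.lift_fst _ _ _
    have hl₂ : l ≫ k₂ = g := pullback.lift_snd _ _ _
    obtain ⟨h', e⟩ := H₂ k n hn₁'.symm (𝟙 U) l (by rw [hl₁, Category.id_comp])
    rw [ht' j k b g h hg l (by rw [← Category.assoc, hl₁, hn₁'])
      (by rw [← Category.assoc, hl₁, hn₂']) hl₂] at e
    rw [← e]
    refine Z.restr_congr ?_ hl₂.symm _
    rw [← Category.assoc, hl₁, ht j k b h n hn₁' hn₂']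
  · have hkn : k ≫ j ≫ x = (n ≫ n₂) ≫ branchMap F := by
      rw [← Category.assoc, hn, Category.assoc, hN, Category.assoc]
    have := H.anchor k (n ≫ n₂) hkn
    rw [← ht j k _ hkn n hn.symm rfl] at this
    simpa using this
  · have hkn : (k' ≫ k) ≫ j ≫ x = (l ≫ k₁ ≫ n₂) ≫ branchMap F := by
      simp only [Category.assoc]
      rw [← hN, ← Category.assoc l, ← hl, ← Category.assoc k j, hn]
      simp only [Category.assoc]
    have hlg : ((l ≫ k₁ ≫ n₂) ≫ branchArrow F) ≫ C.dom = (l ≫ k₂) ≫ C.cod := by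
      simpa using congrArg (l ≫ ·) hK'
    have hlj : l ≫ k₁ ≫ n₁ = (k' ≫ k) ≫ j := by
      rw [← Category.assoc, ← hl, Category.assoc, ← hn, Category.assoc]
    have e₁ := ht j (k' ≫ k) _ hkn (l ≫ k₁) (by rw [Category.assoc, hlj]) (Category.assoc _ _ _)
    have e₂ := H.restr (k' ≫ k) _ hkn (l ≫ k₂) hlg
    have e₁' : l ≫ k₁ ≫ t.app n₁ n₂ hN = (t.pull j).app (k' ≫ k) (l ≫ k₁ ≫ n₂) hkn := by
      rw [← e₁, Category.assoc]
    refine ⟨by rw [e₁']; exact (H.anchor _ _ _).trans hlg, ?_⟩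
    rw [ht' j (k' ≫ k) _ (l ≫ k₂) hkn hlg l hlj rfl rfl, ← e₂]
    exact Z.restr_congr e₁' rfl _

end DefinableNaturality

/-! ### The presheaf of natural families -/

section PresheafFam

variable {E : Type u} [Category.{v} E] [HasFiniteLimits E] {C : InternalCategory E}

namespace InternalPresheaf

variable (C) in
/-- The functor that sends a presheaf to its underlying object. -/
def forget : InternalPresheaf C ⥤ E where
  obj X := X.obj
  map F := F.hom

lemma isPullback_hom {P T Y X : InternalPresheaf C} {p : P ⟶ T} {q : P ⟶ Y} {x : T ⟶ X}
    {F : Y ⟶ X} (h : IsPullback p q x F) : IsPullback p.hom q.hom x.hom F.hom := by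
  let e := h.isoIsPullback _ _ (isPullback_pullbackObj x F)
  refine IsPullback.of_iso (IsPullback.of_hasPullback x.hom F.hom) ((forget C).mapIso e).symm
    (Iso.refl _) (Iso.refl _) (Iso.refl _) ?_ ?_ (by simp) (by simp)
  · exact (Category.comp_id _).trans (congrArg Hom.hom
      (h.isoIsPullback_inv_fst _ _ (isPullback_pullbackObj x F))).symm
  · exact (Category.comp_id _).trans (congrArg Hom.hom
      (h.isoIsPullback_inv_snd _ _ (isPullback_pullbackObj x F))).symm

end InternalPresheaf

variable {Y X T Z P : InternalPresheaf C} {F : Y ⟶ X} {x : T ⟶ X} {p : P ⟶ T} {q : P ⟶ Y}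

lemma restr_hom_eq {U : E} (k : U ⟶ T.obj) (b : U ⟶ branchObj F)
    (h : k ≫ x.hom = b ≫ branchMap F) (h' : k ≫ T.anchor = (b ≫ branchArrow F) ≫ C.cod) :
    T.restr k (b ≫ branchArrow F) h' ≫ x.hom = (b ≫ branchElt F) ≫ F.hom := by
  rw [x.restr, branch_hom]
  exact X.restr_congr h rfl _

lemma base_anchor {U : E} (k : U ⟶ T.obj) (b : U ⟶ branchObj F)
    (h : k ≫ x.hom = b ≫ branchMap F) : k ≫ T.anchor = (b ≫ branchArrow F) ≫ C.cod := by
  rw [← branch_anchor h, Category.assoc, x.anchor]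

/-- The family of elements of `Z` given by a map of presheaves `t : T ×_X Y ⟶ Z`: its value at
`(τ, (f, y))` is `t(τ · f, y)`. -/
def presheafFam (hP : IsPullback p q x F) (t : P ⟶ Z) : Fam (branchMap F) x.hom Z.obj where
  app k b h := (InternalPresheaf.isPullback_hom hP).lift
    (T.restr k (b ≫ branchArrow F) (base_anchor k b h)) (b ≫ branchElt F)
    (restr_hom_eq k b h _) ≫ t.hom
  nat l k b h := by
    rw [← Category.assoc]
    congr 1
    apply (InternalPresheaf.isPullback_hom hP).hom_ext
    · rw [Category.assoc, IsPullback.lift_fst, IsPullback.lift_fst, T.comp_restr]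
      exact T.restr_congr rfl (Category.assoc _ _ _).symm _
    · rw [Category.assoc, IsPullback.lift_snd, IsPullback.lift_snd, Category.assoc]

lemma presheafFam_app (hP : IsPullback p q x F) (t : P ⟶ Z) {U : E} (k : U ⟶ T.obj)
    (b : U ⟶ branchObj F) (h : k ≫ x.hom = b ≫ branchMap F) (z : U ⟶ P.obj)
    (h₁ : z ≫ p.hom = T.restr k (b ≫ branchArrow F) (base_anchor k b h))
    (h₂ : z ≫ q.hom = b ≫ branchElt F) : (presheafFam hP t).app k b h = z ≫ t.hom := by
  refine congrArg (· ≫ t.hom) ((InternalPresheaf.isPullback_hom hP).hom_ext ?_ ?_)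
  · rw [IsPullback.lift_fst, h₁]
  · rw [IsPullback.lift_snd, h₂]

lemma presheafFam_isNatFam (hP : IsPullback p q x F) (t : P ⟶ Z) :
    IsNatFam Z (presheafFam hP t) where
  anchor k b h := by
    refine (Category.assoc _ _ _).trans ?_
    rw [t.anchor, ← q.anchor, ← Category.assoc, IsPullback.lift_snd, branch_elt_anchor]
  restr k b h g hg := by
    have hP' := InternalPresheaf.isPullback_hom hP
    have ha := hP'.lift_fst _ _ (restr_hom_eq k b h (base_anchor k b h))
    have hb := hP'.lift_snd _ _ (restr_hom_eq k b h (base_anchor k b h))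
    have hz : hP'.lift _ _ (restr_hom_eq k b h (base_anchor k b h)) ≫ P.anchor = g ≫ C.cod := by
      rw [← q.anchor, ← Category.assoc, hb, branch_elt_anchor, hg]
    refine (t.restr _ g hz).symm.trans (Eq.symm ?_)
    refine presheafFam_app hP t k _ _ _ ?_ ?_
    · rw [p.restr]
      refine (T.restr_congr ha rfl _).trans ((T.restr_restr _ _ _ (base_anchor k b h) hg).trans ?_)
      exact T.restr_congr rfl (branchRestr_branchArrow _ _ _).symm _
    · rw [q.restr, branchRestr_branchElt]
      exact Y.restr_congr hb rfl _

lemma presheafFam_over (hP : IsPullback p q x F) {Q : InternalPresheaf C} {G : Z ⟶ Q} {H : Y ⟶ Q}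
    (t : P ⟶ Z) (ht : t ≫ G = q ≫ H) {U : E} (k : U ⟶ T.obj)
    (b : U ⟶ branchObj F) (h : k ≫ x.hom = b ≫ branchMap F) :
    (presheafFam hP t).app k b h ≫ G.hom = b ≫ branchElt F ≫ H.hom := by
  have e : t.hom ≫ G.hom = q.hom ≫ H.hom := congrArg InternalPresheaf.Hom.hom ht
  refine (Category.assoc _ _ _).trans ?_
  rw [e, ← Category.assoc, IsPullback.lift_snd, Category.assoc]

/-- The family given by a map of presheaves is equivariant. -/
lemma presheafFam_restr (hP : IsPullback p q x F) (t : P ⟶ Z) {U : E} (k : U ⟶ T.obj)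
    (f : U ⟶ C.C₁) (h : k ≫ T.anchor = f ≫ C.cod) (b : U ⟶ branchObj F)
    (hb : T.restr k f h ≫ x.hom = b ≫ branchMap F)
    (hx : (k ≫ x.hom) ≫ X.anchor = f ≫ C.cod)
    (hb' : X.restr (k ≫ x.hom) f hx = b ≫ branchMap F) :
    (presheafFam hP t).app (T.restr k f h) b hb =
      (presheafFam hP t).app k (branchReindex (k ≫ x.hom) f hx b hb')
        (branchReindex_branchMap _ _ _ _ _).symm := by
  have hP' := InternalPresheaf.isPullback_hom hP
  symm
  refine presheafFam_app hP t _ _ _ _ ?_ ?_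
  · rw [hP'.lift_fst]
    refine (T.restr_restr k f _ h (branch_comp_cod hb')).trans ?_
    exact T.restr_congr rfl (branchReindex_branchArrow _ _ _ _ _).symm _
  · rw [hP'.lift_snd, branchReindex_branchElt]

/-- The branch `(x, (1, y))` over `x = F(y)`. -/
def unitBranch (F : Y ⟶ X) {U : E} (y : U ⟶ Y.obj) : U ⟶ branchObj F :=
  branchMk F (y ≫ F.hom) ((y ≫ F.hom) ≫ X.anchor ≫ C.one) y (by simp [C.one_cod])
    (X.restr_one _ _ rfl).symm

@[simp]
lemma unitBranch_branchMap {U : E} (y : U ⟶ Y.obj) : unitBranch F y ≫ branchMap F = y ≫ F.hom :=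
  branchMk_branchMap _ _ _ _ _ _

@[simp]
lemma unitBranch_branchArrow {U : E} (y : U ⟶ Y.obj) :
    unitBranch F y ≫ branchArrow F = y ≫ Y.anchor ≫ C.one :=
  (branchMk_branchArrow _ _ _ _ _).trans (by rw [Category.assoc, ← Category.assoc F.hom, F.anchor])

@[simp]
lemma unitBranch_branchElt {U : E} (y : U ⟶ Y.obj) : unitBranch F y ≫ branchElt F = y :=
  branchMk_branchElt _ _ _ _ _

lemma comp_unitBranch {U U' : E} (l : U' ⟶ U) (y : U ⟶ Y.obj) :
    l ≫ unitBranch F y = unitBranch F (l ≫ y) := by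
  refine branch_ext ?_ ?_ ?_
  · rw [Category.assoc, unitBranch_branchMap, unitBranch_branchMap, Category.assoc]
  · rw [Category.assoc, unitBranch_branchArrow, unitBranch_branchArrow, Category.assoc]
  · rw [Category.assoc, unitBranch_branchElt, unitBranch_branchElt]

/-- Every branch `(x, (f, y))` is the reindexing of the unit branch `(x · f, (1, y))`. -/
lemma branchReindex_unitBranch {U : E} (b : U ⟶ branchObj F)
    (h : X.restr (b ≫ branchMap F) (b ≫ branchArrow F) (branch_anchor rfl) =
      unitBranch F (b ≫ branchElt F) ≫ branchMap F) :
    branchReindex (b ≫ branchMap F) (b ≫ branchArrow F) (branch_anchor rfl)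
      (unitBranch F (b ≫ branchElt F)) h = b := by
  refine branch_ext (branchReindex_branchMap _ _ _ _ _) ?_ ?_
  · refine (branchReindex_branchArrow _ _ _ _ _).trans (C.compose_one _ _ ?_)
    rw [unitBranch_branchArrow, ← Category.assoc _ Y.anchor, branch_elt_anchor, Category.assoc]
  · exact (branchReindex_branchElt _ _ _ _ _).trans (unitBranch_branchElt _)

lemma branchRestr_unitBranch {U : E} (y : U ⟶ Y.obj) (g : U ⟶ C.C₁)
    (hg : y ≫ Y.anchor = g ≫ C.cod)
    (hg' : (unitBranch F y ≫ branchArrow F) ≫ C.dom = g ≫ C.cod)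
    (hx : (y ≫ F.hom) ≫ X.anchor = g ≫ C.cod)
    (h : X.restr (y ≫ F.hom) g hx = unitBranch F (Y.restr y g hg) ≫ branchMap F) :
    branchRestr (unitBranch F y) g hg' =
      branchReindex (y ≫ F.hom) g hx (unitBranch F (Y.restr y g hg)) h := by
  refine branch_ext ?_ ?_ ?_
  · rw [branchRestr_branchMap, unitBranch_branchMap, branchReindex_branchMap]
  · refine (branchRestr_branchArrow _ _ _).trans (Eq.trans ?_
      (branchReindex_branchArrow _ _ _ _ _).symm)
    refine (C.one_compose _ _ ?_).trans (C.compose_one _ _ ?_).symm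
    · rw [unitBranch_branchArrow, ← Category.assoc, hg, Category.assoc]
    · rw [unitBranch_branchArrow, ← Category.assoc, Y.restr_anchor, Category.assoc]
  · refine (branchRestr_branchElt _ _ _).trans (Eq.trans ?_
      (branchReindex_branchElt _ _ _ _ _).symm)
    exact (Y.restr_congr (unitBranch_branchElt _) rfl _).trans (unitBranch_branchElt _).symm

end PresheafFam

section NatFamPresheaf

variable {E : Type u} [Category.{v} E] [PositiveHeytingCategory E] {C : InternalCategory E}
  {Y X : InternalPresheaf C}

/-- The action of `C` on the object of all families in `Z`. -/
def famOp (F : Y ⟶ X) [IsExponentiableMap (branchMap F)] (Z : E) :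
    RestrOp C ((polynomialFunctor (branchMap F)).obj Z) where
  anchor := polyLab _ Z ≫ X.anchor
  op p f h := polyOf _ ((polyFam p).restr f (by rw [← comp_polyLab, Category.assoc, h]))
  nat l p f h := by
    rw [comp_polyOf]
    refine polyOf_congr
      (by rw [X.comp_restr]; exact X.restr_congr (comp_polyLabel _ _ _).symm rfl _)
      fun k b hb hb' => ?_
    exact polyApp_congr (Category.assoc _ _ _)
      (branchReindex_congr (by rw [comp_polyLabel, Category.assoc]) (Category.assoc _ _ _) rfl _ _)
      (by rw [branchReindex_branchMap, comp_polyLabel])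
  op_anchor p f h := by
    rw [← Category.assoc, comp_polyLab, polyLabel_polyOf, X.restr_anchor]
  op_one p := by
    refine Eq.trans (polyOf_congr
      (X.restr_one _ _ (by rw [← comp_polyLab]; simp only [Category.assoc]))
      fun k b hb hb' => ?_) (polyOf_polyFam p)
    exact (polyFam p).restr_one _ _ (by rw [← comp_polyLab]; simp only [Category.assoc]) k b hb hb'
  op_op p f g h hg := by
    have h' : polyLabel _ p ≫ X.anchor = f ≫ C.cod := by rw [← comp_polyLab, Category.assoc, h]
    refine polyOf_congr ((X.restr_congr (polyLabel_polyOf _) rfl _).trans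
      (X.restr_restr _ _ _ h' hg)) fun k b hb hb' => ?_
    refine Eq.trans ?_ ((polyFam p).restr_restr f g h' hg k b
      ((X.restr_restr _ _ _ h' hg).symm ▸ hb') hb')
    have e : k ≫ polyOf _ ((polyFam p).restr f h') =
      polyOf _ (((polyFam p).restr f h').pull k) := comp_polyOf _ _
    refine (polyApp_congr e rfl (by rw [branchReindex_branchMap, comp_polyLabel])).trans
      ((polyApp_polyOf _ _ _).trans (Fam.app_congr ((polyFam p).restr f h') (Category.id_comp _)
        (branchReindex_congr (by rw [polyLabel_polyOf]) rfl rfl _ _) ?_))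
    rw [branchReindex_branchMap, polyLabel_polyOf, Category.id_comp]

lemma famOp_polyOf {F : Y ⟶ X} [IsExponentiableMap (branchMap F)] {Z T : E} {x : T ⟶ X.obj}
    (t : Fam (branchMap F) x Z) (f : T ⟶ C.C₁) (h : x ≫ X.anchor = f ≫ C.cod)
    (h' : polyOf _ t ≫ (famOp F Z).anchor = f ≫ C.cod) :
    (famOp F Z).op (polyOf _ t) f h' = polyOf _ (t.restr f h) := by
  refine polyOf_congr (X.restr_congr (polyLabel_polyOf _) rfl _) fun k b hb hb' => ?_
  have e : k ≫ polyOf _ t = polyOf _ (t.pull k) := comp_polyOf _ _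
  refine (polyApp_congr e rfl (by rw [branchReindex_branchMap, comp_polyLabel])).trans
    ((polyApp_polyOf _ _ _).trans (Fam.app_congr t (Category.id_comp _)
      (branchReindex_congr (by rw [polyLabel_polyOf]) rfl rfl _ _) ?_))
  rw [branchReindex_branchMap, polyLabel_polyOf, Category.id_comp]

variable {Z Q : InternalPresheaf C}

/-- The presheaf of natural families `t` in `Z` such that `G(t(f, y)) = H(y)`. For `Q = Y` and
`H = 𝟙` this is the dependent product of `G` along `F`, and if `Q` is terminal this is `P_F(Z)`. -/
structure NatFamPresheaf (F : Y ⟶ X) [IsExponentiableMap (branchMap F)] (G : Z ⟶ Q) (H : Y ⟶ Q)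
    where
  R : InternalPresheaf C
  r : R.obj ⟶ (polynomialFunctor (branchMap F)).obj Z.obj
  mono : Mono r
  factors_iff : ∀ {T : E} {x : T ⟶ X.obj} (t : Fam (branchMap F) x Z.obj),
    (∃ l, l ≫ r = polyOf _ t) ↔ IsNatFam Z t ∧
      ∀ {U : E} (k : U ⟶ T) (b : U ⟶ branchObj F) (h : k ≫ x = b ≫ branchMap F),
        t.app k b h ≫ G.hom = b ≫ branchElt F ≫ H.hom
  anchor : R.anchor = r ≫ (famOp F Z.obj).anchor
  restr : ∀ {T : E} (n : T ⟶ R.obj) (f : T ⟶ C.C₁) (h : n ≫ R.anchor = f ≫ C.cod),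
    R.restr n f h ≫ r = (famOp F Z.obj).op (n ≫ r) f (by rw [Category.assoc, ← anchor, h])

/-- The natural families form a subobject of `P_φ(Z)`, since naturality is definable, and it is
closed under the restriction of families. -/
lemma nonempty_natFamPresheaf (F : Y ⟶ X) [IsExponentiableMap (branchMap F)] (G : Z ⟶ Q)
    (H : Y ⟶ Q) : Nonempty (NatFamPresheaf F G H) := by
  let P := (polynomialFunctor (branchMap F)).obj Z.obj
  let t₀ : Fam (branchMap F) (polyLab (branchMap F) Z.obj) Z.obj := polyFam (𝟙 P)
  let N := pullback (polyLab (branchMap F) Z.obj) (branchMap F)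
  have hN : pullback.fst (polyLab (branchMap F) Z.obj) (branchMap F) ≫ polyLab (branchMap F) Z.obj =
    pullback.snd _ _ ≫ branchMap F := pullback.condition
  obtain ⟨M, m, hm, -, hM⟩ := (Definable.isNatFam AdmitsLogic.top (S := ⊤) trivial trivial Z t₀).and
    AdmitsLogic.top (Definable.all AdmitsLogic.top (g := pullback.fst _ _) trivial
      (Definable.eq AdmitsLogic.top (t₀.app _ _ hN ≫ G.hom)
        (pullback.snd _ _ ≫ branchElt F ≫ H.hom)))
  have happ {T : E} {x : T ⟶ X.obj} (t : Fam (branchMap F) x Z.obj) {U : E} (k : U ⟶ T)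
      (b : U ⟶ branchObj F)
      (h : k ≫ polyOf (branchMap F) t ≫ polyLab (branchMap F) Z.obj = b ≫ branchMap F)
      (h' : k ≫ x = b ≫ branchMap F) :
      (t₀.pull (polyOf (branchMap F) t)).app k b h = t.app k b h' := by
    have e : (k ≫ polyOf (branchMap F) t) ≫ 𝟙 P = polyOf (branchMap F) (t.pull k) :=
      (Category.comp_id _).trans (comp_polyOf _ _)
    exact (polyApp_congr e rfl (by rw [comp_polyLabel, Category.assoc]; exact h)).trans
      ((polyApp_polyOf _ _ _).trans (t.app_congr (Category.id_comp _) rfl _))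
  have key {T : E} {x : T ⟶ X.obj} (t : Fam (branchMap F) x Z.obj) :
      (∃ l, l ≫ m = polyOf (branchMap F) t) ↔ IsNatFam Z t ∧
      ∀ {U : E} (k : U ⟶ T) (b : U ⟶ branchObj F) (h : k ≫ x = b ≫ branchMap F),
        t.app k b h ≫ G.hom = b ≫ branchElt F ≫ H.hom := by
    have hl : polyOf (branchMap F) t ≫ polyLab (branchMap F) Z.obj = x := by
      rw [comp_polyLab, polyLabel_polyOf]
    rw [← hM]
    refine and_congr ⟨fun h => h.congr hl fun k b h h' => happ t k b h h',
      fun h => h.congr hl.symm fun k b h h' => (happ t k b h' h).symm⟩ ⟨fun h => ?_, fun h => ?_⟩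
    · intro U k b hb
      have hb' : k ≫ polyOf (branchMap F) t ≫ polyLab (branchMap F) Z.obj = b ≫ branchMap F := by
        rw [hl, hb]
      have := h k (pullback.lift (k ≫ polyOf (branchMap F) t) b
        ((Category.assoc _ _ _).trans hb')) (by simp)
      rw [← Category.assoc, t₀.nat] at this
      rw [← happ t k b hb' hb]
      exact (congrArg (· ≫ G.hom) (t₀.app_congr (by simp) (by simp)
        ((Category.assoc _ _ _).trans hb'))).trans (this.trans (pullback.lift_snd_assoc _ _ _ _))
    · intro U k n hn
      have hb : k ≫ polyOf (branchMap F) t ≫ polyLab (branchMap F) Z.obj =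
          (n ≫ pullback.snd _ _) ≫ branchMap F := by
        rw [← Category.assoc, hn, Category.assoc, hN, Category.assoc]
      have := h k (n ≫ pullback.snd _ _) (by rw [← hb, hl])
      rw [← happ t k _ hb, Category.assoc] at this
      rw [← this, ← Category.assoc, t₀.nat]
      exact congrArg (· ≫ G.hom) (t₀.app_congr hn.symm rfl _)
  have hcl {T : E} (n : T ⟶ M) (f : T ⟶ C.C₁) (h : (n ≫ m) ≫ (famOp F Z.obj).anchor = f ≫ C.cod) :
      ∃ y, y ≫ m = (famOp F Z.obj).op (n ≫ m) f h := by
    have := (key (polyFam (n ≫ m))).1 ⟨n, (polyOf_polyFam _).symm⟩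
    exact (key _).2 ⟨this.1.restrict f _, fun k b hb => (this.2 _ _
      (branchReindex_branchMap _ _ _ _ _).symm).trans (by
      rw [← Category.assoc, branchReindex_branchElt, Category.assoc])⟩
  exact ⟨{
    R := ((famOp F Z.obj).sub m hcl).toPresheaf
    r := m
    mono := hm
    factors_iff := key
    anchor := rfl
    restr := fun n f h => (congrArg (· ≫ m) (RestrOp.toPresheaf_restr _ n f h)).trans
      ((famOp F Z.obj).sub_op m hcl n f h) }⟩

end NatFamPresheaf

/-! ### Exponentiability of pointwise small maps of presheaves -/

section NatFam

variable {E : Type u} [Category.{v} E] [PositiveHeytingCategory E] {C : InternalCategory E}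
  {Y X Z Q : InternalPresheaf C} {F : Y ⟶ X} [IsExponentiableMap (branchMap F)] {G : Z ⟶ Q}
  {H : Y ⟶ Q}

namespace NatFamPresheaf

variable (K : NatFamPresheaf F G H)

/-- The generalized element of the presheaf of natural families given by a natural family. -/
def ofFam {T : E} {x : T ⟶ X.obj} (t : Fam (branchMap F) x Z.obj) (ht : IsNatFam Z t)
    (hG : ∀ {U : E} (k : U ⟶ T) (b : U ⟶ branchObj F) (h : k ≫ x = b ≫ branchMap F),
      t.app k b h ≫ G.hom = b ≫ branchElt F ≫ H.hom) : T ⟶ K.R.obj :=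
  ((K.factors_iff t).2 ⟨ht, hG⟩).choose

lemma ofFam_r {T : E} {x : T ⟶ X.obj} (t : Fam (branchMap F) x Z.obj) (ht : IsNatFam Z t)
    (hG : ∀ {U : E} (k : U ⟶ T) (b : U ⟶ branchObj F) (h : k ≫ x = b ≫ branchMap F),
      t.app k b h ≫ G.hom = b ≫ branchElt F ≫ H.hom) : K.ofFam t ht hG ≫ K.r = polyOf _ t :=
  ((K.factors_iff t).2 ⟨ht, hG⟩).choose_spec

/-- The label of a natural family. -/
def label : K.R ⟶ X where
  hom := K.r ≫ polyLab _ Z.obj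
  anchor := by rw [Category.assoc, K.anchor]; rfl
  restr n f h := by
    rw [← Category.assoc, K.restr]
    refine (comp_polyLab _).trans ((polyLabel_polyOf _).trans (X.restr_congr ?_ rfl _))
    rw [← comp_polyLab, Category.assoc]

lemma polyLabel_r {T : E} (n : T ⟶ K.R.obj) : n ≫ K.label.hom = polyLabel _ (n ≫ K.r) := by
  rw [← comp_polyLab, Category.assoc]; rfl

lemma polyLabel_comp_r {T U : E} (k : U ⟶ T) (n : T ⟶ K.R.obj) :
    k ≫ n ≫ K.label.hom = polyLabel _ (k ≫ n ≫ K.r) := by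
  rw [← Category.assoc, polyLabel_r, Category.assoc]

/-- The natural family that is a generalized element of the presheaf of natural families. -/
def fam {T : E} (n : T ⟶ K.R.obj) : Fam (branchMap F) (n ≫ K.label.hom) Z.obj :=
  (polyFam (n ≫ K.r)).cast (K.polyLabel_r n)

lemma polyOf_fam {T : E} (n : T ⟶ K.R.obj) : polyOf _ (K.fam n) = n ≫ K.r :=
  (polyOf_congr (K.polyLabel_r n) fun _ _ _ _ => rfl).trans (polyOf_polyFam _)

lemma fam_isNatFam {T : E} (n : T ⟶ K.R.obj) : IsNatFam Z (K.fam n) :=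
  ((K.factors_iff _).1 ⟨n, (K.polyOf_fam n).symm⟩).1

lemma fam_over {T U : E} (n : T ⟶ K.R.obj) (k : U ⟶ T) (b : U ⟶ branchObj F)
    (h : k ≫ n ≫ K.label.hom = b ≫ branchMap F) :
    (K.fam n).app k b h ≫ G.hom = b ≫ branchElt F ≫ H.hom :=
  ((K.factors_iff _).1 ⟨n, (K.polyOf_fam n).symm⟩).2 k b h

lemma fam_congr {T U : E} {n n' : T ⟶ K.R.obj} (hn : n = n') {k k' : U ⟶ T} (hk : k = k')
    {b b' : U ⟶ branchObj F} (hb : b = b') (h : k ≫ n ≫ K.label.hom = b ≫ branchMap F) :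
    (K.fam n).app k b h = (K.fam n').app k' b' (by rw [← hn, ← hk, ← hb, h]) := by
  subst hn hk hb; rfl

lemma fam_comp {T T' U : E} (n : T ⟶ K.R.obj) (l : T' ⟶ T) (k : U ⟶ T') (b : U ⟶ branchObj F)
    (h : k ≫ (l ≫ n) ≫ K.label.hom = b ≫ branchMap F)
    (h' : (k ≫ l) ≫ n ≫ K.label.hom = b ≫ branchMap F) :
    (K.fam (l ≫ n)).app k b h = (K.fam n).app (k ≫ l) b h' :=
  polyApp_congr (by simp) rfl ((K.polyLabel_comp_r k (l ≫ n)).symm.trans h)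

lemma ext {T : E} {n n' : T ⟶ K.R.obj} (hl : n ≫ K.label.hom = n' ≫ K.label.hom)
    (h : ∀ {U : E} (k : U ⟶ T) (b : U ⟶ branchObj F) (h : k ≫ n ≫ K.label.hom = b ≫ branchMap F)
      (h' : k ≫ n' ≫ K.label.hom = b ≫ branchMap F),
      (K.fam n).app k b h = (K.fam n').app k b h') : n = n' := by
  have := K.mono
  rw [← cancel_mono K.r, ← polyOf_fam, ← polyOf_fam]
  exact polyOf_congr hl h

lemma ofFam_label {T : E} {x : T ⟶ X.obj} (t : Fam (branchMap F) x Z.obj) (ht hG) :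
    K.ofFam t ht hG ≫ K.label.hom = x :=
  (K.polyLabel_r _).trans ((congrArg (polyLabel _) (K.ofFam_r t ht hG)).trans (polyLabel_polyOf _))

lemma fam_ofFam {T U : E} {x : T ⟶ X.obj} (t : Fam (branchMap F) x Z.obj) (ht hG)
    (k : U ⟶ T) (b : U ⟶ branchObj F) (h : k ≫ K.ofFam t ht hG ≫ K.label.hom = b ≫ branchMap F)
    (h' : k ≫ x = b ≫ branchMap F) : (K.fam (K.ofFam t ht hG)).app k b h = t.app k b h' := by
  have e : k ≫ K.ofFam t ht hG ≫ K.r = polyOf _ (t.pull k) := by rw [ofFam_r, comp_polyOf]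
  exact (polyApp_congr e rfl ((K.polyLabel_comp_r _ _).symm.trans h)).trans
    ((polyApp_polyOf _ _ _).trans (t.app_congr (Category.id_comp _) rfl _))

lemma fam_restr {T U : E} (n : T ⟶ K.R.obj) (f : T ⟶ C.C₁) (h : n ≫ K.R.anchor = f ≫ C.cod)
    (h' : (n ≫ K.label.hom) ≫ X.anchor = f ≫ C.cod) (k : U ⟶ T) (b : U ⟶ branchObj F)
    (hb : k ≫ K.R.restr n f h ≫ K.label.hom = b ≫ branchMap F)
    (hb' : k ≫ X.restr (n ≫ K.label.hom) f h' = b ≫ branchMap F) :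
    (K.fam (K.R.restr n f h)).app k b hb = ((K.fam n).restr f h').app k b hb' := by
  have e : k ≫ K.R.restr n f h ≫ K.r = polyOf _ (((K.fam n).restr f h').pull k) := by
    rw [K.restr, ← comp_polyOf, ← famOp_polyOf _ _ _ (by
      rw [polyOf_fam, Category.assoc, ← K.anchor, h])]
    exact congrArg (k ≫ ·) ((famOp F Z.obj).congr (K.polyOf_fam n).symm rfl _)
  exact (polyApp_congr e rfl ((K.polyLabel_comp_r _ _).symm.trans hb)).trans
    ((polyApp_polyOf _ _ _).trans (Fam.app_congr ((K.fam n).restr f h') (Category.id_comp k) rfl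
      ((congrArg (· ≫ _) (Category.id_comp k)).trans hb')))

lemma label_anchor {T : E} (n : T ⟶ K.R.obj) {f : T ⟶ C.C₁} (h : n ≫ K.R.anchor = f ≫ C.cod) :
    (n ≫ K.label.hom) ≫ X.anchor = f ≫ C.cod := by
  rw [Category.assoc, K.label.anchor, h]

section Eval

lemma comp_unitBranch_branchMap {U : E} (n : U ⟶ K.R.obj) (y : U ⟶ Y.obj)
    (h : n ≫ K.label.hom = y ≫ F.hom) :
    𝟙 U ≫ n ≫ K.label.hom = unitBranch F y ≫ branchMap F := by
  rw [Category.id_comp, unitBranch_branchMap, h]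

/-- Evaluation of a natural family `t` with label `x` at an element `y` with `F(y) = x`, as
`t(1, y)`. -/
def evalAt {U : E} (n : U ⟶ K.R.obj) (y : U ⟶ Y.obj) (h : n ≫ K.label.hom = y ≫ F.hom) :
    U ⟶ Z.obj :=
  (K.fam n).app (𝟙 U) (unitBranch F y) (K.comp_unitBranch_branchMap n y h)

lemma evalAt_congr {U : E} {n n' : U ⟶ K.R.obj} (hn : n = n') {y y' : U ⟶ Y.obj} (hy : y = y')
    (h : n ≫ K.label.hom = y ≫ F.hom) :
    K.evalAt n y h = K.evalAt n' y' (by rw [← hn, ← hy, h]) := by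
  subst hn hy; rfl

lemma comp_evalAt {U U' : E} (l : U' ⟶ U) (n : U ⟶ K.R.obj) (y : U ⟶ Y.obj)
    (h : n ≫ K.label.hom = y ≫ F.hom) : l ≫ K.evalAt n y h =
      K.evalAt (l ≫ n) (l ≫ y) (by rw [Category.assoc, h, Category.assoc]) := by
  have h' : 𝟙 U' ≫ (l ≫ n) ≫ K.label.hom = unitBranch F (l ≫ y) ≫ branchMap F :=
    K.comp_unitBranch_branchMap _ _ (by rw [Category.assoc, h, Category.assoc])
  refine Eq.trans ?_ (K.fam_comp n l (𝟙 U') (unitBranch F (l ≫ y)) h' (by simpa using h')).symm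
  rw [evalAt, (K.fam n).nat]
  exact (K.fam n).app_congr (by simp) (comp_unitBranch _ _) _

lemma evalAt_anchor {U : E} (n : U ⟶ K.R.obj) (y : U ⟶ Y.obj)
    (h : n ≫ K.label.hom = y ≫ F.hom) : K.evalAt n y h ≫ Z.anchor = y ≫ Y.anchor := by
  rw [evalAt, (K.fam_isNatFam n).anchor, unitBranch_branchArrow]
  simp [C.one_dom]

lemma evalAt_over {U : E} (n : U ⟶ K.R.obj) (y : U ⟶ Y.obj)
    (h : n ≫ K.label.hom = y ≫ F.hom) : K.evalAt n y h ≫ G.hom = y ≫ H.hom := by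
  rw [evalAt, K.fam_over, ← Category.assoc, unitBranch_branchElt]

lemma evalAt_restr {U : E} (n : U ⟶ K.R.obj) (y : U ⟶ Y.obj)
    (h : n ≫ K.label.hom = y ≫ F.hom) (f : U ⟶ C.C₁) (hn : n ≫ K.R.anchor = f ≫ C.cod)
    (hy : y ≫ Y.anchor = f ≫ C.cod) :
    K.evalAt (K.R.restr n f hn) (Y.restr y f hy) (by
      rw [K.label.restr, F.restr]; exact X.restr_congr h rfl _) =
      Z.restr (K.evalAt n y h) f ((K.evalAt_anchor n y h).trans hy) := by
  have hx : (y ≫ F.hom) ≫ X.anchor = f ≫ C.cod := by rw [Category.assoc, F.anchor, hy]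
  have hu : X.restr (y ≫ F.hom) f hx = unitBranch F (Y.restr y f hy) ≫ branchMap F := by
    rw [unitBranch_branchMap, F.restr]
  have hu' : (unitBranch F y ≫ branchArrow F) ≫ C.dom = f ≫ C.cod := by
    rw [unitBranch_branchArrow, ← hy]; simp [C.one_dom]
  have hl : 𝟙 U ≫ X.restr (n ≫ K.label.hom) f (K.label_anchor _ hn) =
      unitBranch F (Y.restr y f hy) ≫ branchMap F := by
    rw [Category.id_comp, ← hu]; exact X.restr_congr h rfl _
  refine (K.fam_restr n f hn (K.label_anchor n hn) (𝟙 U) _ _ hl).trans (Eq.symm ?_)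
  refine ((K.fam_isNatFam n).restr _ _ _ f hu').trans ?_
  refine (K.fam n).app_congr rfl ((branchRestr_unitBranch y f hy hu' hx hu).trans ?_) _
  exact branchReindex_congr (by rw [Category.id_comp, h]) (Category.id_comp _).symm rfl _ _

/-- A natural family is determined by evaluation. -/
lemma fam_eq_evalAt {T U : E} (n : T ⟶ K.R.obj) (k : U ⟶ T) (b : U ⟶ branchObj F)
    (h : k ≫ n ≫ K.label.hom = b ≫ branchMap F)
    (hn : (k ≫ n) ≫ K.R.anchor = (b ≫ branchArrow F) ≫ C.cod)
    (hy : K.R.restr (k ≫ n) (b ≫ branchArrow F) hn ≫ K.label.hom =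
      (b ≫ branchElt F) ≫ F.hom) :
    (K.fam n).app k b h =
      K.evalAt (K.R.restr (k ≫ n) (b ≫ branchArrow F) hn) (b ≫ branchElt F) hy := by
  have h' : (k ≫ n) ≫ K.label.hom = b ≫ branchMap F := by rw [Category.assoc, h]
  have hr : X.restr (b ≫ branchMap F) (b ≫ branchArrow F) (branch_anchor rfl) =
      unitBranch F (b ≫ branchElt F) ≫ branchMap F := by
    rw [unitBranch_branchMap, branch_hom]
  have hl : 𝟙 U ≫ X.restr ((k ≫ n) ≫ K.label.hom) (b ≫ branchArrow F) (K.label_anchor _ hn) =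
      unitBranch F (b ≫ branchElt F) ≫ branchMap F := by
    rw [Category.id_comp, ← hr]; exact X.restr_congr h' rfl _
  refine Eq.symm ((K.fam_restr (k ≫ n) _ hn (K.label_anchor _ hn) (𝟙 U) _ _ hl).trans ?_)
  refine (K.fam_comp n k (𝟙 U) _ ((Category.id_comp _).trans (h'.trans ?_)) ?_).trans ?_
  · rw [branchReindex_branchMap, Category.id_comp, h']
  · rw [branchReindex_branchMap, Category.id_comp, Category.id_comp, Category.assoc]
  · refine (K.fam n).app_congr (Category.id_comp _) (Eq.trans ?_ (branchReindex_unitBranch b hr)) _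
    exact branchReindex_congr (by rw [Category.id_comp, h']) (Category.id_comp _) rfl _ _

variable {P : InternalPresheaf C} {p : P ⟶ K.R} {q : P ⟶ Y} (hP : IsPullback p q K.label F)

/-- Evaluation as a map of presheaves. -/
def eval : P ⟶ Z where
  hom := K.evalAt p.hom q.hom (congrArg InternalPresheaf.Hom.hom hP.w)
  anchor := by rw [evalAt_anchor, q.anchor]
  restr {U} a f h := by
    have hw' : p.hom ≫ K.label.hom = q.hom ≫ F.hom := congrArg InternalPresheaf.Hom.hom hP.w
    have hw {U' : E} (k : U' ⟶ P.obj) : (k ≫ p.hom) ≫ K.label.hom = (k ≫ q.hom) ≫ F.hom := by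
      simpa using congrArg (k ≫ ·) hw'
    have hp : (a ≫ p.hom) ≫ K.R.anchor = f ≫ C.cod := by rw [Category.assoc, p.anchor, h]
    have hq : (a ≫ q.hom) ≫ Y.anchor = f ≫ C.cod := by rw [Category.assoc, q.anchor, h]
    exact (K.comp_evalAt _ _ _ hw').trans ((K.evalAt_congr (p.restr a f h) (q.restr a f h)
      (hw _)).trans ((K.evalAt_restr _ _ (hw a) f hp hq).trans
        (Z.restr_congr (K.comp_evalAt _ _ _ hw').symm rfl _)))

lemma comp_eval_hom {U : E} (z : U ⟶ P.obj) :
    z ≫ (K.eval hP).hom = K.evalAt (z ≫ p.hom) (z ≫ q.hom) (by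
      simpa using congrArg (z ≫ ·) (congrArg InternalPresheaf.Hom.hom hP.w)) :=
  K.comp_evalAt _ _ _ (congrArg InternalPresheaf.Hom.hom hP.w)

lemma eval_over : K.eval hP ≫ G = q ≫ H :=
  InternalPresheaf.hom_ext (K.evalAt_over _ _ (congrArg InternalPresheaf.Hom.hom hP.w))

end Eval

section Lift

variable {P T : InternalPresheaf C} {x : T ⟶ X} {p : P ⟶ T} {q : P ⟶ Y}
  (hP : IsPullback p q x F)

/-- The transpose `T ⟶ R` of a map `T ×_X Y ⟶ Z`. -/
def lift (t : P ⟶ Z) (ht : t ≫ G = q ≫ H) : T ⟶ K.R where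
  hom := K.ofFam (presheafFam hP t) (presheafFam_isNatFam hP t) (presheafFam_over hP t ht)
  anchor := by
    rw [← K.label.anchor, ← Category.assoc, ofFam_label, x.anchor]
  restr {U} a f h := by
    have := K.mono
    have hx : (a ≫ x.hom) ≫ X.anchor = f ≫ C.cod := by rw [Category.assoc, x.anchor, h]
    rw [← cancel_mono K.r, K.restr, Category.assoc, ofFam_r, comp_polyOf]
    refine Eq.trans ?_ (((famOp F Z.obj).congr (x' := polyOf _ ((presheafFam hP t).pull a))
      (by rw [Category.assoc, ofFam_r, comp_polyOf]) rfl _).trans (famOp_polyOf _ f hx _)).symm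
    refine polyOf_congr (x.restr _ _ _) fun {U'} k b hb hb' => ?_
    have hk : (k ≫ a) ≫ T.anchor = (k ≫ f) ≫ C.cod := by rw [Category.assoc, h, Category.assoc]
    have hbx : T.restr (k ≫ a) (k ≫ f) hk ≫ x.hom = b ≫ branchMap F := by
      rw [← hb, ← T.comp_restr k a f h, Category.assoc]
    have hkx : ((k ≫ a) ≫ x.hom) ≫ X.anchor = (k ≫ f) ≫ C.cod := by
      rw [Category.assoc _ x.hom, x.anchor, hk]
    refine ((presheafFam hP t).app_congr (T.comp_restr k a f h) rfl
      ((Category.assoc _ _ _).trans hb)).trans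
      ((presheafFam_restr hP t (k ≫ a) (k ≫ f) hk b hbx hkx
        ((x.restr _ _ hk).symm.trans hbx)).trans ?_)
    exact (presheafFam hP t).app_congr rfl
      (branchReindex_congr (Category.assoc _ _ _) rfl rfl _ _)
      (branchReindex_branchMap _ _ _ _ _).symm

lemma lift_label (t : P ⟶ Z) (ht : t ≫ G = q ≫ H) : K.lift hP t ht ≫ K.label = x :=
  InternalPresheaf.hom_ext (K.ofFam_label (presheafFam hP t) (presheafFam_isNatFam hP t)
    (presheafFam_over hP t ht))

variable {P' : InternalPresheaf C} {p' : P' ⟶ K.R} {q' : P' ⟶ Y}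
  (hP' : IsPullback p' q' K.label F)

lemma comp_eval (t : P ⟶ Z) (ht : t ≫ G = q ≫ H) (u : P ⟶ P')
    (h₁ : u ≫ p' = p ≫ K.lift hP t ht) (h₂ : u ≫ q' = q) : u ≫ K.eval hP' = t := by
  have hw : p.hom ≫ x.hom = q.hom ≫ F.hom := congrArg InternalPresheaf.Hom.hom hP.w
  have h₁' : u.hom ≫ p'.hom = p.hom ≫ (K.lift hP t ht).hom :=
    congrArg InternalPresheaf.Hom.hom h₁
  have hl : (p.hom ≫ (K.lift hP t ht).hom) ≫ K.label.hom = q.hom ≫ F.hom := by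
    rw [← hw, Category.assoc]
    exact congrArg (p.hom ≫ InternalPresheaf.Hom.hom ·) (K.lift_label hP t ht)
  apply InternalPresheaf.hom_ext
  refine (K.comp_eval_hom hP' _).trans ((K.evalAt_congr h₁'
    (congrArg InternalPresheaf.Hom.hom h₂) _).trans ?_)
  have hu : (𝟙 P.obj ≫ p.hom) ≫ x.hom = unitBranch F q.hom ≫ branchMap F := by
    rw [Category.id_comp, hw, unitBranch_branchMap]
  refine (K.fam_comp _ p.hom (𝟙 _) _ (K.comp_unitBranch_branchMap _ _ hl)
    ((Category.assoc _ _ _).symm.trans ?_)).trans ((K.fam_ofFam (presheafFam hP t)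
      (presheafFam_isNatFam hP t) (presheafFam_over hP t ht) _ _ _ hu).trans ?_)
  · rw [Category.id_comp, hl, unitBranch_branchMap]
  · refine (presheafFam_app hP t _ _ hu (𝟙 _) ?_ ?_).trans (Category.id_comp _)
    · refine (T.restr_one _ _ ?_).symm
      rw [unitBranch_branchArrow, Category.id_comp, ← Category.assoc, q.anchor, ← p.anchor,
        Category.assoc]
    · rw [Category.id_comp, unitBranch_branchElt]

/-- A map `s : T ⟶ R` over `X` is determined by its transpose `T ×_X Y ⟶ Z`; the pullback of `s`,
with which evaluation is composed, is called `u`. -/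
lemma hom_ext (hP : IsPullback p q x F) {s₁ s₂ : T ⟶ K.R} (hs₁ : s₁ ≫ K.label = x)
    (hs₂ : s₂ ≫ K.label = x)
    {u₁ u₂ : P ⟶ P'} (h₁ : u₁ ≫ p' = p ≫ s₁) (h₂ : u₂ ≫ p' = p ≫ s₂) (h₁' : u₁ ≫ q' = q)
    (h₂' : u₂ ≫ q' = q) (h : u₁ ≫ K.eval hP' = u₂ ≫ K.eval hP') : s₁ = s₂ := by
  have hs {s : T ⟶ K.R} (e : s ≫ K.label = x) {U : E} (k : U ⟶ T.obj) :
      k ≫ s.hom ≫ K.label.hom = k ≫ x.hom := congrArg (k ≫ InternalPresheaf.Hom.hom ·) e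
  have key {s : T ⟶ K.R} (e : s ≫ K.label = x) {u : P ⟶ P'} (h₁ : u ≫ p' = p ≫ s)
      (h₂ : u ≫ q' = q) {U : E} (k : U ⟶ T.obj) (b : U ⟶ branchObj F)
      (h : k ≫ s.hom ≫ K.label.hom = b ≫ branchMap F) (z : U ⟶ P.obj)
      (hz : z ≫ p.hom = T.restr k (b ≫ branchArrow F) (base_anchor k b ((hs e k).symm.trans h)))
      (hz' : z ≫ q.hom = b ≫ branchElt F) :
      (K.fam s.hom).app k b h = z ≫ (u ≫ K.eval hP').hom := by
    have hk := base_anchor k b ((hs e k).symm.trans h)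
    have hn : (k ≫ s.hom) ≫ K.R.anchor = (b ≫ branchArrow F) ≫ C.cod := by
      rw [Category.assoc, s.anchor, hk]
    have h₁' : u.hom ≫ p'.hom = p.hom ≫ s.hom := congrArg InternalPresheaf.Hom.hom h₁
    have h₂' : u.hom ≫ q'.hom = q.hom := congrArg InternalPresheaf.Hom.hom h₂
    have e₁ : (z ≫ u.hom) ≫ p'.hom = K.R.restr (k ≫ s.hom) (b ≫ branchArrow F) hn := by
      rw [Category.assoc, h₁', ← Category.assoc, hz, s.restr]
    have e₂ : (z ≫ u.hom) ≫ q'.hom = b ≫ branchElt F := by rw [Category.assoc, h₂', hz']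
    have hw : ((z ≫ u.hom) ≫ p'.hom) ≫ K.label.hom = ((z ≫ u.hom) ≫ q'.hom) ≫ F.hom := by
      simpa using congrArg ((z ≫ u.hom) ≫ ·) (congrArg InternalPresheaf.Hom.hom hP'.w)
    refine (K.fam_eq_evalAt s.hom k b h hn (by rw [← e₁, hw, e₂])).trans (Eq.symm ?_)
    rw [InternalPresheaf.comp_hom, ← Category.assoc]
    exact (K.comp_eval_hom hP' _).trans (K.evalAt_congr e₁ e₂ _)
  apply InternalPresheaf.hom_ext
  refine K.ext ?_ fun {U} k b hb hb' => ?_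
  · simpa using (hs hs₁ (𝟙 _)).trans (hs hs₂ (𝟙 _)).symm
  · have hk : k ≫ x.hom = b ≫ branchMap F := (hs hs₁ k).symm.trans hb
    have hz := InternalPresheaf.isPullback_hom hP
    have hw := restr_hom_eq k b hk (base_anchor k b hk)
    rw [key hs₁ h₁ h₁' k b hb (hz.lift _ _ hw) (hz.lift_fst _ _ _) (hz.lift_snd _ _ _),
      key hs₂ h₂ h₂' k b hb' (hz.lift _ _ hw) (hz.lift_fst _ _ _) (hz.lift_snd _ _ _), h]

end Lift

end NatFamPresheaf

/-- If `φ` is exponentiable in `E`, then `F` is exponentiable as a map of presheaves: with the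
presheaf of natural families, evaluation is a universal arrow from the pullback functor. -/
lemma isExponentiableMap_of_branchMap (F : Y ⟶ X) [IsExponentiableMap (branchMap F)] :
    IsExponentiableMap F := by
  refine isLeftAdjoint_iff_hasTerminal_costructuredArrow.2 fun B => ?_
  obtain ⟨K⟩ := nonempty_natFamPresheaf F B.hom (𝟙 Y)
  have hK := IsPullback.of_hasPullback K.label F
  let R : CostructuredArrow (Over.pullback F) B :=
    CostructuredArrow.mk (Y := Over.mk K.label) (Over.homMk (K.eval hK)
      ((K.eval_over hK).trans (Category.comp_id _)))
  have fst_map {A A' : Over X} (g : A ⟶ A') : ((Over.pullback F).map g).left ≫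
      pullback.fst A'.hom F = pullback.fst A.hom F ≫ g.left := pullback.lift_fst _ _ _
  have snd_map {A A' : Over X} (g : A ⟶ A') : ((Over.pullback F).map g).left ≫
      pullback.snd A'.hom F = pullback.snd A.hom F := pullback.lift_snd _ _ _
  refine IsTerminal.hasTerminal (X := R) (IsTerminal.ofUniqueHom (fun A => ?_) fun A g => ?_)
  · have hA := IsPullback.of_hasPullback A.left.hom F
    have hw : A.hom.left ≫ B.hom = pullback.snd A.left.hom F ≫ 𝟙 Y :=
      (Over.w A.hom).trans (Category.comp_id _).symm
    refine CostructuredArrow.homMk (Over.homMk (K.lift hA A.hom.left hw)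
      (K.lift_label hA A.hom.left hw)) ?_
    ext1
    exact K.comp_eval hA hK A.hom.left hw _ (fst_map _) (snd_map _)
  · ext1
    ext1
    have hA := IsPullback.of_hasPullback A.left.hom F
    have hw : A.hom.left ≫ B.hom = pullback.snd A.left.hom F ≫ 𝟙 Y :=
      (Over.w A.hom).trans (Category.comp_id _).symm
    refine K.hom_ext hK hA (Over.w g.left) (K.lift_label hA _ hw) (fst_map g.left)
      (fst_map (Over.homMk _ (K.lift_label hA _ hw) : A.left ⟶ Over.mk K.label)) (snd_map g.left)
      (snd_map _) ?_
    refine Eq.trans (congrArg CommaMorphism.left (CostructuredArrow.w g)) (Eq.symm ?_)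
    exact K.comp_eval hA hK A.hom.left hw _ (fst_map _) (snd_map _)

end NatFam

/-! ### Hereditarily natural trees -/

section Hereditary

variable {E : Type u} [Category.{v} E] [PositiveHeytingCategory E]

/-- The trees that hereditarily satisfy a definable predicate `N`: the largest domain of recursion
along the operation that is defined on the trees satisfying `N`, with values in the terminal
object. -/
lemma exists_hereditary {S : MorphismProperty E} (hS : S.IsStableUnderBaseChange)
    (hW : AxiomWE S) {B A : E} {f : B ⟶ A} (hf : S f) [IsExponentiableMap f]
    {V : Endofunctor.Algebra (polynomialFunctor f)} (hV : IsInitial V)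
    {N : ∀ ⦃T : E⦄, (T ⟶ V.a) → Prop} (hN : Definable ⊤ N) :
    ∃ (W : E) (j : W ⟶ V.a), Mono j ∧ ∀ {T : E} (v : T ⟶ V.a), (∃ w, w ≫ j = v) ↔
      N v ∧ ∀ {U : E} (k : U ⟶ T) (b : U ⟶ B) (h : (k ≫ v) ≫ wLabel hV = b ≫ f),
        ∃ w, w ≫ j = wChild hV (k ≫ v) b h := by
  obtain ⟨Λ, n, hn, -, H⟩ := hN
  let t : Fam f (n ≫ wLabel hV) (⊤_ E) :=
    { app := fun _ _ _ => terminal.from _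
      nat := fun _ _ _ _ => Subsingleton.elim _ _ }
  obtain ⟨G, g, hg, hch, hsup⟩ := exists_partial_recursion hS hW hf (wCoalg hV)
    (wCoalg_wellFounded hV) n (polyOf f t) (terminal.from Λ) (polyLabel_polyOf t).symm
    (fun x y h _ => (cancel_mono n).1 h)
  have hl {U : E} (x : U ⟶ Λ) : polyLabel f (x ≫ polyOf f t) = (x ≫ n) ≫ wLabel hV := by
    rw [comp_polyLabel, polyLabel_polyOf, Category.assoc]
  refine ⟨G, g ≫ n, hg, fun {T} v => ⟨?_, ?_⟩⟩
  · rintro ⟨w, rfl⟩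
    refine ⟨(H _).2 ⟨w ≫ g, Category.assoc _ _ _⟩, fun {U} k b h => ?_⟩
    obtain ⟨y, hy, -⟩ := hch (k ≫ w) b (by rw [← h]; simp [wCoalg]) (by
      rw [← Category.assoc, hl, ← h]; simp)
    exact ⟨y, hy.trans (wChild_congr hV (Category.assoc _ _ _) rfl
      (by rw [← h]; simp only [Category.assoc]))⟩
  · rintro ⟨hNv, hv⟩
    obtain ⟨d, rfl⟩ := (H v).1 hNv
    obtain ⟨x, rfl⟩ := hsup d fun k b h h' => by
      obtain ⟨y, hy⟩ := hv k b h
      exact ⟨y, hy, Subsingleton.elim _ _⟩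
    exact ⟨x, (Category.assoc _ _ _).symm⟩

variable {C : InternalCategory E} {Y X : InternalPresheaf C} {F : Y ⟶ X}
  [IsExponentiableMap (branchMap F)] {V : Endofunctor.Algebra (polynomialFunctor (branchMap F))}

/-- The tree `v` is natural: its immediate subtrees form a natural family. -/
abbrev NatTree (hV : IsInitial V) {T : E} (v : T ⟶ V.a) : Prop :=
  IsNatFam (treeOp hV).toPresheaf (wFam hV v)

lemma definable_natTree (hV : IsInitial V) {S : MorphismProperty E} (hS : AdmitsLogic S)
    (hφ : S (branchMap F)) (hcod : S C.cod) :
    Definable S (fun ⦃T : E⦄ (v : T ⟶ V.a) => NatTree hV v) :=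
  (Definable.isNatFam hS hφ hcod (treeOp hV).toPresheaf (wFam hV (𝟙 V.a))).congr fun T v =>
    ⟨fun h => h.congr (by simp) fun k b h h' => wChild_congr hV (Category.comp_id _) rfl
        ((congrArg (· ≫ _) (Category.comp_id _)).trans ((Category.assoc _ _ _).trans h')),
      fun h => h.congr (by simp) fun k b h h' => wChild_congr hV (Category.comp_id _).symm rfl
        ((Category.assoc _ _ _).trans h)⟩

lemma NatTree.restr {hV : IsInitial V} {T : E} {v : T ⟶ V.a} (hv : NatTree hV v) (f : T ⟶ C.C₁)
    (h : v ≫ (treeOp hV).anchor = f ≫ C.cod) : NatTree hV ((treeOp hV).op v f h) :=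
  (IsNatFam.restrict hv f ((Category.assoc _ _ _).trans h)).congr (treeOp_wLabel hV v f h).symm
    fun k b _ hb => (wChild_treeOp hV v f h k b ((Category.assoc _ _ _).trans hb)).symm

/-- A subobject of the W-type of `φ` whose elements are exactly the natural trees all of whose
immediate subtrees belong to it. By well-foundedness this determines the subobject, which consists
of the hereditarily natural trees. -/
structure HNTrees (hV : IsInitial V) where
  W : E
  j : W ⟶ V.a
  mono : Mono j
  factors_iff : ∀ {T : E} (v : T ⟶ V.a), (∃ w, w ≫ j = v) ↔
      NatTree hV v ∧ ∀ {U : E} (k : U ⟶ T) (b : U ⟶ branchObj F)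
        (h : (k ≫ v) ≫ wLabel hV = b ≫ branchMap F), ∃ w, w ≫ j = wChild hV (k ≫ v) b h

lemma nonempty_hnTrees {S : MorphismProperty E} (hS : S.IsStableUnderBaseChange)
    (hW : AxiomWE S) (hφ : S (branchMap F)) (hV : IsInitial V) : Nonempty (HNTrees hV) := by
  obtain ⟨W, j, hj, H⟩ := exists_hereditary hS hW hφ hV
    (definable_natTree hV AdmitsLogic.top trivial trivial)
  exact ⟨⟨W, j, hj, H⟩⟩

namespace HNTrees

variable {hV : IsInitial V} (K : HNTrees hV)

attribute [instance] HNTrees.mono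

lemma natTree {T : E} (w : T ⟶ K.W) : NatTree hV (w ≫ K.j) :=
  ((K.factors_iff _).1 ⟨w, rfl⟩).1

lemma exists_restr {T : E} (w : T ⟶ K.W) (f : T ⟶ C.C₁)
    (h : (w ≫ K.j) ≫ (treeOp hV).anchor = f ≫ C.cod) :
    ∃ y, y ≫ K.j = (treeOp hV).op (w ≫ K.j) f h := by
  refine (K.factors_iff _).2 ⟨(K.natTree w).restr f h, fun k b hb => ?_⟩
  rw [wChild_treeOp]
  exact ((K.factors_iff _).1 ⟨w, rfl⟩).2 _ _
    ((Category.assoc _ _ _).trans (branchReindex_branchMap _ _ _ _ _).symm)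

/-- The presheaf of hereditarily natural trees. -/
def presheaf : InternalPresheaf C := ((treeOp hV).sub K.j K.exists_restr).toPresheaf

lemma presheaf_anchor : K.presheaf.anchor = K.j ≫ (treeOp hV).anchor := rfl

lemma restr_j {T : E} (w : T ⟶ K.W) (f : T ⟶ C.C₁) (h : w ≫ K.presheaf.anchor = f ≫ C.cod) :
    K.presheaf.restr w f h ≫ K.j =
      (treeOp hV).op (w ≫ K.j) f ((Category.assoc _ _ _).trans h) :=
  (congrArg (· ≫ K.j) (RestrOp.toPresheaf_restr _ w f h)).trans
    ((treeOp hV).sub_op K.j K.exists_restr w f h)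

/-- The immediate subtrees of a hereditarily natural tree. -/
def child {T : E} (w : T ⟶ K.W) (b : T ⟶ branchObj F)
    (h : w ≫ K.j ≫ wLabel hV = b ≫ branchMap F) : T ⟶ K.W :=
  (((K.factors_iff _).1 ⟨w, rfl⟩).2 (𝟙 T) b (by simpa using h)).choose

lemma child_j {T : E} (w : T ⟶ K.W) (b : T ⟶ branchObj F)
    (h : w ≫ K.j ≫ wLabel hV = b ≫ branchMap F) :
    K.child w b h ≫ K.j = wChild hV (w ≫ K.j) b ((Category.assoc _ _ _).trans h) :=
  (((K.factors_iff _).1 ⟨w, rfl⟩).2 (𝟙 T) b (by simpa using h)).choose_spec.trans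
    (wChild_congr hV (Category.id_comp _) rfl _)

/-- The coalgebra of hereditarily natural trees. -/
def coalg : FibCoalg (branchMap F) K.W where
  label := K.j ≫ wLabel hV
  child := K.child
  nat l w b h := by
    rw [← cancel_mono K.j, Category.assoc, child_j, child_j, comp_wChild]
    exact wChild_congr hV (Category.assoc _ _ _).symm rfl _

lemma coalg_wellFounded : K.coalg.WellFounded :=
  (wCoalg_wellFounded hV).of_hom K.j rfl fun w b h => K.child_j w b h

/-- The family of immediate subtrees of a hereditarily natural tree. -/
def childFam {T : E} (w : T ⟶ K.W) : Fam (branchMap F) (w ≫ K.j ≫ wLabel hV) K.W where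
  app k b h := K.child (k ≫ w) b ((Category.assoc _ _ _).trans h)
  nat l k b h := by
    refine (K.coalg.nat l (k ≫ w) b ((Category.assoc _ _ _).trans h)).trans ?_
    exact K.coalg.child_congr (Category.assoc _ _ _).symm rfl _

lemma childFam_j {T U : E} (w : T ⟶ K.W) (k : U ⟶ T) (b : U ⟶ branchObj F)
    (h : k ≫ w ≫ K.j ≫ wLabel hV = b ≫ branchMap F)
    (h' : k ≫ (w ≫ K.j) ≫ wLabel hV = b ≫ branchMap F) :
    (K.childFam w).app k b h ≫ K.j = (wFam hV (w ≫ K.j)).app k b h' :=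
  (K.child_j (k ≫ w) b ((Category.assoc _ _ _).trans h)).trans
    (wChild_congr hV (Category.assoc _ _ _) rfl (by rw [← h]; simp only [Category.assoc]))

/-- The inclusion of the hereditarily natural trees into all trees, as a map of presheaves. -/
def inclusion : K.presheaf ⟶ (treeOp hV).toPresheaf where
  hom := K.j
  anchor := rfl
  restr w f h := (K.restr_j w f h).trans (RestrOp.toPresheaf_restr _ _ _ _).symm

/-- Naturality of families may be checked in the presheaf of all trees. -/
lemma isNatFam_of_map {T : E} {x : T ⟶ X.obj} {t : Fam (branchMap F) x K.W}
    (ht : IsNatFam (treeOp hV).toPresheaf (t.map K.j)) : IsNatFam K.presheaf t where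
  anchor k b h := (Category.assoc _ _ _).symm.trans (ht.anchor k b h)
  restr k b h g hg := by
    refine (cancel_mono K.j).1 ?_
    exact (K.inclusion.restr _ _ _).trans (ht.restr k b h g hg)

lemma childFam_isNatFam {T : E} (w : T ⟶ K.W) : IsNatFam K.presheaf (K.childFam w) :=
  K.isNatFam_of_map ((K.natTree w).congr (Category.assoc _ _ _) fun k b h h' =>
    (K.childFam_j w k b h' h).symm)

lemma exists_sup {T : E} {x : T ⟶ X.obj} (t : Fam (branchMap F) x K.W)
    (ht : IsNatFam K.presheaf t) : ∃ w, w ≫ K.j = wSup V (t.map K.j) := by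
  have ht' : IsNatFam (treeOp hV).toPresheaf (t.map K.j) := ht.map K.inclusion
  have hc {U : E} (k : U ⟶ T) (b : U ⟶ branchObj F)
      (h : (k ≫ wSup V (t.map K.j)) ≫ wLabel hV = b ≫ branchMap F)
      (h' : k ≫ x = b ≫ branchMap F) :
      wChild hV (k ≫ wSup V (t.map K.j)) b h = t.app k b h' ≫ K.j := wChild_wSup hV _ _ _ _
  refine (K.factors_iff _).2 ⟨ht'.congr (wSup_wLabel hV _).symm fun k b h h' => ?_,
    fun k b h => ⟨t.app k b (by simpa using h), (hc k b h _).symm⟩⟩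
  exact (hc k b ((Category.assoc _ _ _).trans h') h).symm

/-- A natural family of hereditarily natural trees has a hereditarily natural supremum. -/
def sup {T : E} {x : T ⟶ X.obj} (t : Fam (branchMap F) x K.W) (ht : IsNatFam K.presheaf t) :
    T ⟶ K.W :=
  (K.exists_sup t ht).choose

lemma sup_j {T : E} {x : T ⟶ X.obj} (t : Fam (branchMap F) x K.W) (ht : IsNatFam K.presheaf t) :
    K.sup t ht ≫ K.j = wSup V (t.map K.j) :=
  (K.exists_sup t ht).choose_spec

lemma sup_label {T : E} {x : T ⟶ X.obj} (t : Fam (branchMap F) x K.W)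
    (ht : IsNatFam K.presheaf t) : K.sup t ht ≫ K.j ≫ wLabel hV = x := by
  rw [← Category.assoc, sup_j, wSup_wLabel]

lemma childFam_sup {T U : E} {x : T ⟶ X.obj} (t : Fam (branchMap F) x K.W)
    (ht : IsNatFam K.presheaf t) (k : U ⟶ T) (b : U ⟶ branchObj F)
    (h : k ≫ K.sup t ht ≫ K.j ≫ wLabel hV = b ≫ branchMap F) (h' : k ≫ x = b ≫ branchMap F) :
    (K.childFam (K.sup t ht)).app k b h = t.app k b h' := by
  have h₁ : (k ≫ K.sup t ht ≫ K.j) ≫ wLabel hV = b ≫ branchMap F := by simpa using h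
  rw [← cancel_mono K.j, K.childFam_j _ _ _ _ (by simpa using h)]
  exact (wChild_congr hV (congrArg (k ≫ ·) (K.sup_j t ht)) rfl h₁).trans (wChild_wSup hV _ _ _ _)

/-- The hereditarily natural trees in the sense of subtrees are the elements of the presheaf of
hereditarily natural trees. The subtrees of a tree are the ends of the paths that start at it. -/
lemma factors_iff_isHereditarilyNaturalTree {S : MorphismProperty E} (hS : IsClassOfSmallMaps S)
    (hW : AxiomWE S) {T : E} (v : T ⟶ V.a) :
    (∃ w : T ⟶ K.W, w ≫ K.j = v) ↔ IsHereditarilyNaturalTree hV v := by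
  have hK : Definable ⊤ (fun ⦃T : E⦄ (v : T ⟶ V.a) => ∃ w : T ⟶ K.W, w ≫ K.j = v) :=
    ⟨K.W, K.j, K.mono, trivial, fun _ _ => Iff.rfl⟩
  have hlab {U : E} {w : U ⟶ V.a} {b : U ⟶ pullback (treeLabel hV w) (branchMap F)}
      (hb : pairBase b = 𝟙 U) : w ≫ wLabel hV = (b ≫ pullback.snd _ _) ≫ branchMap F := by
    refine Eq.trans ?_ ((congrArg (b ≫ ·) pullback.condition).trans (Category.assoc _ _ _).symm)
    refine Eq.trans ?_ ((congrArg (· ≫ _) hb).symm.trans (Category.assoc _ _ _))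
    rw [Category.id_comp, treeLabel_eq]
  have hchild {U : E} {w : U ⟶ V.a} {b : U ⟶ pullback (treeLabel hV w) (branchMap F)}
      (hb : pairBase b = 𝟙 U) : b ≫ treeFun hV w = wChild hV w (b ≫ pullback.snd _ _) (hlab hb) :=
    (comp_treeFun hV w b (𝟙 U) _ hb rfl).trans (wChild_congr hV (Category.id_comp _) rfl _)
  constructor
  · intro hv U k w hw
    rw [isNaturalTree_iff]
    -- the relation "if `v` is hereditarily natural, then so is `w`" on pairs `(w, v)`
    obtain ⟨M, m, hm, -, H⟩ := (hK.comap AdmitsLogic.top (prod.snd : V.a ⨯ V.a ⟶ V.a)).imp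
      AdmitsLogic.top (hK.comap AdmitsLogic.top (prod.fst : V.a ⨯ V.a ⟶ V.a))
    have hR {U : E} (x : U ⟶ V.a ⨯ V.a) : (Subobject.mk m).Factors x ↔ _ :=
      (Subobject.mk_factors_iff m x).trans (H x).symm
    have hcl : ∀ {U : E} (w v : U ⟶ V.a) (b : U ⟶ pullback (treeLabel hV w) (branchMap F)),
        pairBase b = 𝟙 U → (Subobject.mk m).Factors (prod.lift w v) →
        (Subobject.mk m).Factors (prod.lift (b ≫ treeFun hV w) v) := by
      intro U w v b hb h
      refine (hR _).2 fun U' l hl => ?_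
      obtain ⟨y, hy⟩ := (hR _).1 h l (by simpa using hl)
      have e : y ≫ K.j = l ≫ w := by simpa using hy
      have hl' : y ≫ K.j ≫ wLabel hV = (l ≫ b ≫ pullback.snd _ _) ≫ branchMap F := by
        rw [← Category.assoc, e, Category.assoc, hlab hb]; simp only [Category.assoc]
      refine ⟨K.child y _ hl', (K.child_j _ _ _).trans ?_⟩
      refine (wChild_congr hV e rfl ((Category.assoc _ _ _).trans hl')).trans ?_
      refine Eq.trans ?_ ((Category.assoc _ _ _).trans
        (congrArg (l ≫ ·) ((prod.lift_fst _ _).trans (hchild hb)))).symm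
      exact (comp_wChild hV l w _ (hlab hb)).symm
    obtain ⟨y, hy⟩ := (hR _).1 (hw (Subobject.mk m) ((hR _).2 fun U k hk => by simpa using hk)
      hcl) (𝟙 U) (by
        obtain ⟨y, rfl⟩ := hv
        exact ⟨k ≫ y, by simp⟩)
    have e : y ≫ K.j = w := by simpa using hy
    rw [← e]
    exact K.natTree y
  · intro hv
    obtain ⟨P, st, en, h₁, h₂, h₃⟩ := exists_paths hS hW hV
    -- by induction, all ends of paths that start at `v` are hereditarily natural
    let e : pullback st v ⟶ V.a := pullback.fst st v ≫ en
    have hnat {U : E} (y : U ⟶ pullback st v) : NatTree hV (y ≫ e) := by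
      refine (isNaturalTree_iff hV _).1 (hv (y ≫ pullback.snd st v) (y ≫ e) fun R hd hc => ?_)
      have hc' : ∀ {U : E} (w v : U ⟶ V.a) (b : U ⟶ branchObj F)
          (h : w ≫ wLabel hV = b ≫ branchMap F), (∃ l, l ≫ R.arrow = prod.lift w v) →
          ∃ l, l ≫ R.arrow = prod.lift (wChild hV w b h) v := by
        intro U' w v b hb hw
        obtain ⟨l, hl⟩ := hw
        have hb' : 𝟙 U' ≫ treeLabel hV w = b ≫ branchMap F := by
          rw [Category.id_comp, treeLabel_eq, hb]
        have := hc w v (pullback.lift (𝟙 U') b hb') (pullback.lift_fst _ _ _)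
          ((Subobject.factors_iff _ _).2 ⟨l, hl⟩)
        rw [hchild (pullback.lift_fst _ _ _)] at this
        obtain ⟨l', hl'⟩ := (Subobject.factors_iff _ _).1 this
        exact ⟨l', hl'.trans (congrArg (prod.lift · v)
          (wChild_congr hV rfl (pullback.lift_snd _ _ _) _))⟩
      obtain ⟨l, hl⟩ := h₃ R.arrow ⟨R.factorThru _ hd, R.factorThru_arrow _ hd⟩ hc'
        (y ≫ pullback.fst st v)
      refine (Subobject.factors_iff _ _).2 ⟨l, hl.trans ?_⟩
      simp only [e, Category.assoc, pullback.condition]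
    have key : ∀ ⦃T : E⦄ (u : T ⟶ V.a) ⦃U : E⦄ (l : U ⟶ T) (y : U ⟶ pullback st v),
        l ≫ u = y ≫ e → ∃ w, w ≫ K.j = y ≫ e := by
      refine wCoalg_wellFounded hV _ ((hK.comap AdmitsLogic.top e).all AdmitsLogic.top
        (g := e) trivial) fun T' u ih U l y hy => (K.factors_iff _).2 ⟨hnat y, ?_⟩
      intro U' k b h
      obtain ⟨π, hs, he⟩ := h₂ (k ≫ y ≫ pullback.fst st v) b (by rw [← h]; simp [e])
      have hw : π ≫ st = (k ≫ y ≫ pullback.snd st v) ≫ v := by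
        rw [hs]; simp only [Category.assoc, pullback.condition]
      have hu : (k ≫ l) ≫ u = (k ≫ y ≫ pullback.fst st v) ≫ en := by
        rw [Category.assoc, hy]; simp [e]
      have hπ : pullback.lift π _ hw ≫ e = wChild hV (k ≫ y ≫ e) b h := by
        rw [pullback.lift_fst_assoc, he]
        exact wChild_congr hV (by simp [e]) rfl _
      have hb : ((k ≫ l) ≫ u) ≫ wLabel hV = b ≫ branchMap F := by rw [hu, ← h]; simp [e]
      have := ih (k ≫ l) b hb (𝟙 U') (pullback.lift π _ hw) (by
        rw [Category.id_comp, hπ]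
        exact wChild_congr hV ((Category.assoc _ _ _).trans (congrArg (k ≫ ·) hy)) rfl hb)
      rwa [hπ] at this
    obtain ⟨π, hs, he⟩ := h₁ v
    have hw : π ≫ st = 𝟙 T ≫ v := by rw [hs, Category.id_comp]
    have hπ : pullback.lift π _ hw ≫ e = v := by rw [pullback.lift_fst_assoc, he]
    have := key v (𝟙 T) (pullback.lift π _ hw) (by rw [hπ, Category.id_comp])
    rwa [hπ] at this

end HNTrees

end Hereditary

/-! ### Recursion on hereditarily natural trees -/

section Recursion

variable {E : Type u} [Category.{v} E] [PositiveHeytingCategory E] {C : InternalCategory E}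
  {Y X Z Q : InternalPresheaf C} {F : Y ⟶ X} [IsExponentiableMap (branchMap F)]
  {V : Endofunctor.Algebra (polynomialFunctor (branchMap F))} {hV : IsInitial V}
  {G : Z ⟶ Q} {H : Y ⟶ Q}

/-- Recursion along a map `α` defined on natural families, on all trees: there is a largest
subobject `γ : D ⟶ V` on which it is possible; `ν` sends an element of `D` to the natural family
of the values at its children. -/
lemma exists_recursion_domain {S : MorphismProperty E} (hS : S.IsStableUnderBaseChange)
    (hW : AxiomWE S) (hφ : S (branchMap F)) (hV : IsInitial V) (N : NatFamPresheaf F G H)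
    (α : N.R.obj ⟶ Z.obj) :
    ∃ (D : E) (γ : D ⟶ V.a) (ν : D ⟶ N.R.obj), Mono γ ∧ γ ≫ wLabel hV = ν ≫ N.label.hom ∧
      (∀ {T U : E} (x : T ⟶ D) (k : U ⟶ T) (b : U ⟶ branchObj F)
        (h : (k ≫ x ≫ γ) ≫ wLabel hV = b ≫ branchMap F)
        (h' : k ≫ (x ≫ ν) ≫ N.label.hom = b ≫ branchMap F), ∃ c : U ⟶ D,
          c ≫ γ = wChild hV (k ≫ x ≫ γ) b h ∧ c ≫ ν ≫ α = (N.fam (x ≫ ν)).app k b h') ∧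
      (∀ {T : E} (v : T ⟶ V.a) (n : T ⟶ N.R.obj), v ≫ wLabel hV = n ≫ N.label.hom →
        (∀ {U : E} (k : U ⟶ T) (b : U ⟶ branchObj F)
          (h : (k ≫ v) ≫ wLabel hV = b ≫ branchMap F)
          (h' : k ≫ n ≫ N.label.hom = b ≫ branchMap F), ∃ c : U ⟶ D,
            c ≫ γ = wChild hV (k ≫ v) b h ∧ c ≫ ν ≫ α = (N.fam n).app k b h') →
        ∃ y : T ⟶ D, y ≫ γ = v ∧ y ≫ ν = n) := by
  have hl : pullback.fst (wLabel hV) N.label.hom ≫ wLabel hV =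
      polyLabel _ (pullback.snd (wLabel hV) N.label.hom ≫ N.r) := by
    rw [pullback.condition, N.polyLabel_r]
  obtain ⟨D, g, hg, hch, hsup⟩ := exists_partial_recursion hS hW hφ (wCoalg hV)
    (wCoalg_wellFounded hV) (pullback.fst (wLabel hV) N.label.hom) (pullback.snd _ _ ≫ N.r)
    (pullback.snd _ _ ≫ α) hl (fun x y h h' => pullback.hom_ext h (by
      have := N.mono
      rw [← cancel_mono N.r, Category.assoc, h', Category.assoc]))
  have hfam {T U : E} (n : T ⟶ N.R.obj) (k : U ⟶ T) (b : U ⟶ branchObj F) {p : U ⟶ _}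
      (hp : p = k ≫ n ≫ N.r) (h : polyLabel _ p = b ≫ branchMap F)
      (h' : k ≫ n ≫ N.label.hom = b ≫ branchMap F) : polyApp _ p b h = (N.fam n).app k b h' :=
    polyApp_congr hp rfl h
  refine ⟨D, g ≫ pullback.fst _ _, g ≫ pullback.snd _ _, hg, ?_, fun {T U} x k b h h' => ?_,
    fun {T} v n hvn H => ?_⟩
  · rw [Category.assoc, pullback.condition, Category.assoc]
  · have hb : polyLabel _ ((k ≫ x) ≫ g ≫ pullback.snd (wLabel hV) N.label.hom ≫ N.r) =
        b ≫ branchMap F := by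
      rw [← h', N.polyLabel_comp_r]; simp only [Category.assoc]
    obtain ⟨c, hc, hc'⟩ := hch (k ≫ x) b (by rw [← h]; simp [wCoalg]) hb
    refine ⟨c, hc.trans (wChild_congr hV (Category.assoc _ _ _) rfl (by rw [← h]; simp)), ?_⟩
    rw [Category.assoc, hc']
    exact hfam _ k b (by simp only [Category.assoc]) _ _
  · obtain ⟨y, hy⟩ := hsup (pullback.lift v n hvn) fun {U} k b h h' => by
      have hb : (k ≫ v) ≫ wLabel hV = b ≫ branchMap F := by
        rw [← h, pullback.lift_fst]; rfl
      obtain ⟨c, hc, hc'⟩ := H k b hb (by rw [← hb, Category.assoc, hvn])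
      refine ⟨c, hc.trans (wChild_congr hV (by rw [pullback.lift_fst]) rfl hb), ?_⟩
      simp only [Category.assoc] at hc'
      rw [hc']
      exact (hfam n k b (by rw [pullback.lift_snd_assoc]) _ _).symm
    exact ⟨y, by rw [← Category.assoc, hy, pullback.lift_fst],
      by rw [← Category.assoc, hy, pullback.lift_snd]⟩

namespace HNTrees

variable (K : HNTrees hV)

lemma child_congr {T : E} {w w' : T ⟶ K.W} (hw : w = w') {b b' : T ⟶ branchObj F} (hb : b = b')
    (h : w ≫ K.j ≫ wLabel hV = b ≫ branchMap F) :
    K.child w b h = K.child w' b' (by rw [← hw, ← hb, h]) := by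
  subst hw hb; rfl

/-- Naturality of a hereditarily natural tree. -/
lemma restr_child {T : E} (w : T ⟶ K.W) (b : T ⟶ branchObj F)
    (h : w ≫ K.j ≫ wLabel hV = b ≫ branchMap F) (g : T ⟶ C.C₁)
    (hg : (b ≫ branchArrow F) ≫ C.dom = g ≫ C.cod)
    (hc : K.child w b h ≫ K.presheaf.anchor = g ≫ C.cod) :
    K.presheaf.restr (K.child w b h) g hc =
      K.child w (branchRestr b g hg) (by rw [h, branchRestr_branchMap]) :=
  (K.presheaf.restr_congr (K.child_congr (Category.id_comp w).symm rfl h) rfl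
    hc).trans (((K.childFam_isNatFam w).restr (𝟙 T) b (by rw [Category.id_comp, h]) g hg).trans
      (K.child_congr (Category.id_comp w) rfl (by
        rw [Category.id_comp, h, branchRestr_branchMap])))

lemma child_anchor {T : E} (w : T ⟶ K.W) (b : T ⟶ branchObj F)
    (h : w ≫ K.j ≫ wLabel hV = b ≫ branchMap F) :
    K.child w b h ≫ K.presheaf.anchor = (b ≫ branchArrow F) ≫ C.dom :=
  (congrArg (· ≫ K.presheaf.anchor) (K.child_congr (Category.id_comp w).symm rfl h)).trans
    ((K.childFam_isNatFam w).anchor (𝟙 T) b (by rw [Category.id_comp, h]))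

lemma restr_label {T : E} (w : T ⟶ K.W) (f : T ⟶ C.C₁)
    (h : w ≫ K.presheaf.anchor = f ≫ C.cod)
    (h' : (w ≫ K.j ≫ wLabel hV) ≫ X.anchor = f ≫ C.cod) :
    K.presheaf.restr w f h ≫ K.j ≫ wLabel hV = X.restr (w ≫ K.j ≫ wLabel hV) f h' :=
  (Category.assoc _ _ _).symm.trans ((congrArg (· ≫ wLabel hV) (K.restr_j w f h)).trans
    ((treeOp_wLabel hV _ _ _).trans (X.restr_congr (Category.assoc _ _ _) rfl _)))

lemma child_restr {T : E} (w : T ⟶ K.W) (f : T ⟶ C.C₁) (h : w ≫ K.presheaf.anchor = f ≫ C.cod)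
    (b : T ⟶ branchObj F)
    (hb : K.presheaf.restr w f h ≫ K.j ≫ wLabel hV = b ≫ branchMap F)
    (h' : (w ≫ K.j ≫ wLabel hV) ≫ X.anchor = f ≫ C.cod)
    (hb' : X.restr (w ≫ K.j ≫ wLabel hV) f h' = b ≫ branchMap F) :
    K.child (K.presheaf.restr w f h) b hb =
      K.child w (branchReindex (w ≫ K.j ≫ wLabel hV) f h' b hb')
        (branchReindex_branchMap _ _ _ _ _).symm := by
  rw [← cancel_mono K.j]
  refine (K.child_j _ _ _).trans (Eq.trans ?_ (K.child_j _ _ _).symm)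
  have hl : (𝟙 T ≫ (treeOp hV).op (w ≫ K.j) f ((Category.assoc _ _ _).trans h)) ≫ wLabel hV =
      b ≫ branchMap F := by
    rw [Category.id_comp, ← K.restr_j w f h]; exact (Category.assoc _ _ _).trans hb
  refine (wChild_congr hV ((K.restr_j w f h).trans (Category.id_comp _).symm) rfl
    ((Category.assoc _ _ _).trans hb)).trans ((wChild_treeOp hV (w ≫ K.j) f _ (𝟙 T) b hl).trans ?_)
  exact wChild_congr hV (Category.id_comp _) (branchReindex_congr (by simp) (Category.id_comp _)
    rfl _ _) (by rw [branchReindex_branchMap, Category.assoc])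

/-- The map `g` satisfies the recursion equations for `α`: its value at a tree is the value of `α`
at the natural family `n` of its values at the children. -/
def IsRecursive (N : NatFamPresheaf F G H) (α : N.R ⟶ Z) (g : K.presheaf ⟶ Z) : Prop :=
  ∀ {T : E} (w : T ⟶ K.W), ∃ n : T ⟶ N.R.obj,
    n ≫ N.label.hom = w ≫ K.j ≫ wLabel hV ∧ w ≫ g.hom = n ≫ α.hom ∧
    ∀ {U : E} (k : U ⟶ T) (b : U ⟶ branchObj F) (h : k ≫ n ≫ N.label.hom = b ≫ branchMap F)
      (h' : k ≫ w ≫ K.j ≫ wLabel hV = b ≫ branchMap F),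
      (N.fam n).app k b h = (K.childFam w).app k b h' ≫ g.hom

/-- **Recursion.** For a map of presheaves `α`, from natural families in `Z` to `Z`, there is a map
of presheaves on hereditarily natural trees that sends a tree to the value of `α` at the family of
values at its children. That this map commutes with restriction has to be proved by induction
together with its existence, because `α` applies to natural families only. By `hG` the condition
`G(t(f, y)) = H(y)` on families is void. -/
theorem exists_recursion {S : MorphismProperty E} (hS : S.IsStableUnderBaseChange)
    (hW : AxiomWE S) (hφ : S (branchMap F)) (N : NatFamPresheaf F G H) (α : N.R ⟶ Z)
    (hG : ∀ {T : E} (z : T ⟶ Z.obj) (y : T ⟶ Y.obj), z ≫ Z.anchor = y ≫ Y.anchor →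
      z ≫ G.hom = y ≫ H.hom) :
    ∃ g : K.presheaf ⟶ Z, K.IsRecursive N α g := by
  obtain ⟨D, γ, ν, hγ, hlab, hchild, hsup⟩ := exists_recursion_domain hS hW hφ hV N α.hom
  let ζ : D ⟶ Z.obj := ν ≫ α.hom
  -- compatibility of the recursion with restriction at an element of its domain
  let R : ∀ ⦃T : E⦄, (T ⟶ D) → Prop := fun T y =>
    y ≫ ζ ≫ Z.anchor = y ≫ γ ≫ (treeOp hV).anchor ∧
    ∀ ⦃U : E⦄ (k : U ⟶ T) (e : U ⟶ pullback (γ ≫ (treeOp hV).anchor) C.cod),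
      k ≫ y = e ≫ pullback.fst _ _ → ∃ y' : U ⟶ pullback γ ((treeOp hV).op
          (pullback.fst (γ ≫ (treeOp hV).anchor) C.cod ≫ γ) (pullback.snd _ _)
          ((Category.assoc _ _ _).trans pullback.condition)), y' ≫ pullback.snd _ _ = e ∧
        ∃ h : (y' ≫ pullback.snd _ _ ≫ pullback.fst _ _ ≫ ζ) ≫ Z.anchor =
          (y' ≫ pullback.snd _ _ ≫ pullback.snd _ _) ≫ C.cod,
          Z.restr _ _ h = y' ≫ pullback.fst _ _ ≫ ζ
  let Q : ∀ ⦃T : E⦄, (T ⟶ K.W) → Prop := fun T w => ∃ y : T ⟶ D, y ≫ γ = w ≫ K.j ∧ R y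
  have hRd : Definable ⊤ R := by
    refine (Definable.eq AdmitsLogic.top _ _).and AdmitsLogic.top ?_
    refine Definable.all AdmitsLogic.top trivial ?_
    exact Definable.onSub AdmitsLogic.top trivial (Definable.restr_eq AdmitsLogic.top Z _ _ _)
  have hQ : Definable ⊤ Q :=
    (Definable.onSub AdmitsLogic.top (m := γ) trivial hRd).comap AdmitsLogic.top K.j
  have hR {T : E} {y : T ⟶ D} (hy : R y) (g : T ⟶ C.C₁)
      (hg : (y ≫ γ) ≫ (treeOp hV).anchor = g ≫ C.cod) (h : (y ≫ ζ) ≫ Z.anchor = g ≫ C.cod) :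
      ∃ y' : T ⟶ D, y' ≫ γ = (treeOp hV).op (y ≫ γ) g hg ∧ Z.restr (y ≫ ζ) g h = y' ≫ ζ := by
    obtain ⟨y', he, h', hy'⟩ := hy.2 (𝟙 T)
      (pullback.lift y g ((Category.assoc _ _ _).symm.trans hg)) (by simp)
    refine ⟨y' ≫ pullback.fst _ _, ?_, ?_⟩
    · refine (Category.assoc _ _ _).trans ((congrArg (y' ≫ ·) pullback.condition).trans
        ((Category.assoc _ _ _).symm.trans ((congrArg (· ≫ _) he).trans ?_)))
      exact ((treeOp hV).nat _ _ _ _).trans ((treeOp hV).congr (by simp) (by simp) _)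
    · rw [Category.assoc, ← hy']
      refine Z.restr_congr ?_ ?_ _
      · rw [← Category.assoc y', he, pullback.lift_fst_assoc]
      · rw [← Category.assoc y', he, pullback.lift_snd]
  have hfam {T U : E} (y : T ⟶ D) (w : T ⟶ K.W) (hy : y ≫ γ = w ≫ K.j) (k : U ⟶ T)
      (b : U ⟶ branchObj F) (h : k ≫ (y ≫ ν) ≫ N.label.hom = b ≫ branchMap F)
      (h' : (k ≫ w) ≫ K.j ≫ wLabel hV = b ≫ branchMap F) :
      ∃ c : U ⟶ D, c ≫ γ = K.child (k ≫ w) b h' ≫ K.j ∧ c ≫ ζ = (N.fam (y ≫ ν)).app k b h := by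
    obtain ⟨c, hc, hc'⟩ := hchild y k b (by
      rw [hy, ← Category.assoc, Category.assoc (k ≫ w), h']) h
    refine ⟨c, hc.trans (Eq.trans ?_ (K.child_j _ _ _).symm), hc'⟩
    exact wChild_congr hV (by rw [hy, Category.assoc]) rfl _
  -- if the recursion is possible at the children of `w`, compatibly with restriction, then their
  -- values form a natural family, and so the recursion is possible at `w`
  have hstep {T : E} (w : T ⟶ K.W) (ih : ∀ {U : E} (k : U ⟶ T) (b : U ⟶ branchObj F)
      (h : (k ≫ w) ≫ K.j ≫ wLabel hV = b ≫ branchMap F), Q (K.child (k ≫ w) b h)) :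
      ∃ y : T ⟶ D, y ≫ γ = w ≫ K.j := by
    choose c hc hRc using @ih
    let t : Fam (branchMap F) (w ≫ K.j ≫ wLabel hV) Z.obj :=
      { app := fun k b h => c k b ((Category.assoc _ _ _).trans h) ≫ ζ
        nat := fun l k b h => by
          rw [← Category.assoc]
          refine congrArg (· ≫ ζ) ((cancel_mono γ).1 ?_)
          rw [Category.assoc, hc, hc, ← Category.assoc]
          have h₀ : (k ≫ w) ≫ K.j ≫ wLabel hV = b ≫ branchMap F := (Category.assoc _ _ _).trans h
          exact congrArg (· ≫ K.j) ((K.coalg.nat l _ b h₀).trans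
            (K.child_congr (Category.assoc _ _ _).symm rfl (by
              rw [Category.assoc, h₀, Category.assoc]))) }
    have ht : IsNatFam Z t := by
      have ha {U : E} (k : U ⟶ T) (b : U ⟶ branchObj F)
          (h : (k ≫ w) ≫ K.j ≫ wLabel hV = b ≫ branchMap F) :
          (c k b h ≫ γ) ≫ (treeOp hV).anchor = (b ≫ branchArrow F) ≫ C.dom := by
        rw [hc, Category.assoc]; exact K.child_anchor _ b h
      have hz {U : E} (k : U ⟶ T) (b : U ⟶ branchObj F)
          (h : (k ≫ w) ≫ K.j ≫ wLabel hV = b ≫ branchMap F) :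
          (c k b h ≫ ζ) ≫ Z.anchor = (b ≫ branchArrow F) ≫ C.dom := by
        rw [Category.assoc, (hRc k b h).1, ← ha k b h, Category.assoc]
      refine ⟨fun k b h => hz k b _, fun k b h g hg => ?_⟩
      have h₀ := (Category.assoc _ _ _).trans h
      obtain ⟨y', h₁, h₂⟩ := hR (hRc k b h₀) g ((ha k b h₀).trans hg) ((hz k b h₀).trans hg)
      refine h₂.trans (congrArg (· ≫ ζ) ?_)
      refine (cancel_mono γ).1 (h₁.trans (Eq.trans ?_ (hc _ _ _).symm))
      refine ((treeOp hV).congr (hc k b h₀) rfl _).trans ((K.restr_j _ g ?_).symm.trans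
        (congrArg (· ≫ K.j) (K.restr_child _ b h₀ g hg _)))
      exact (K.child_anchor _ b h₀).trans hg
    let n := N.ofFam t ht fun k b h => (hG _ (b ≫ branchElt F)
      ((ht.anchor k b h).trans (branch_elt_anchor b).symm)).trans (Category.assoc _ _ _)
    obtain ⟨y, hy, -⟩ := hsup (w ≫ K.j) n
      ((Category.assoc _ _ _).trans (N.ofFam_label t ht _).symm) fun {U} k b h h' => by
        have h₀ : (k ≫ w) ≫ K.j ≫ wLabel hV = b ≫ branchMap F := by
          rw [← h]; simp only [Category.assoc]
        refine ⟨c k b h₀, (hc k b h₀).trans ((K.child_j _ _ _).trans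
          (wChild_congr hV (Category.assoc _ _ _) rfl _)), ?_⟩
        exact (N.fam_ofFam t ht _ k b h' ((Category.assoc _ _ _).symm.trans h₀)).symm
    exact ⟨y, hy⟩
  -- compatibility with restriction at `w` follows from that of `α` and the induction hypothesis
  have key : ∀ ⦃T : E⦄ (w : T ⟶ K.W), Q w := by
    refine K.coalg_wellFounded Q hQ fun T w ih => ?_
    obtain ⟨y, hy⟩ := hstep w fun k b h => ih k b h
    have hl : (y ≫ ν) ≫ N.label.hom = w ≫ K.j ≫ wLabel hV := by
      rw [Category.assoc, ← hlab, ← Category.assoc, hy, Category.assoc]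
    have hna : (y ≫ ν) ≫ N.R.anchor = w ≫ K.presheaf.anchor := by
      rw [← N.label.anchor, ← Category.assoc, hl]; simp only [Category.assoc]; rfl
    refine ⟨y, hy, ?_, fun U k e he => ?_⟩
    · change y ≫ (ν ≫ α.hom) ≫ Z.anchor = _
      rw [Category.assoc, α.anchor, ← Category.assoc, hna, ← Category.assoc, hy,
        presheaf_anchor, Category.assoc]
    have hf : (k ≫ w) ≫ K.presheaf.anchor = (e ≫ pullback.snd _ _) ≫ C.cod := by
      rw [Category.assoc e, ← pullback.condition, ← Category.assoc e, ← he, presheaf_anchor,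
        ← Category.assoc, Category.assoc k, ← hy]
      simp only [Category.assoc]
    have hn : ((k ≫ y) ≫ ν) ≫ N.R.anchor = (e ≫ pullback.snd _ _) ≫ C.cod := by
      rw [← hf, Category.assoc k, Category.assoc k, hna]; exact (Category.assoc _ _ _).symm
    have hl' : ((k ≫ y) ≫ ν) ≫ N.label.hom = (k ≫ w) ≫ K.j ≫ wLabel hV := by
      simpa only [Category.assoc] using congrArg (k ≫ ·) hl
    have hx : ((k ≫ w) ≫ K.j ≫ wLabel hV) ≫ X.anchor = (e ≫ pullback.snd _ _) ≫ C.cod := by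
      rw [← hl', N.label_anchor _ hn]
    let w' : U ⟶ K.W := K.presheaf.restr (k ≫ w) (e ≫ pullback.snd _ _) hf
    -- the children of `w'` are children of `w`
    have hw' {U' : E} (l : U' ⟶ U) (b : U' ⟶ branchObj F)
        (h : (l ≫ w') ≫ K.j ≫ wLabel hV = b ≫ branchMap F) :
        ∃ (b' : U' ⟶ branchObj F) (h' : ((l ≫ k) ≫ w) ≫ K.j ≫ wLabel hV = b' ≫ branchMap F)
          (hb : X.restr (l ≫ (k ≫ w) ≫ K.j ≫ wLabel hV) (l ≫ e ≫ pullback.snd _ _)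
            (by rw [Category.assoc l, hx, Category.assoc l]) = b ≫ branchMap F),
          b' = branchReindex _ _ _ b hb ∧
          K.child (l ≫ w') b h = K.child ((l ≫ k) ≫ w) b' h' := by
      have hf' : (l ≫ k ≫ w) ≫ K.presheaf.anchor = (l ≫ e ≫ pullback.snd _ _) ≫ C.cod :=
        (Category.assoc _ _ _).trans ((congrArg (l ≫ ·) hf).trans (Category.assoc _ _ _).symm)
      have e₁ : l ≫ w' = K.presheaf.restr (l ≫ k ≫ w) (l ≫ e ≫ pullback.snd _ _) hf' :=
        K.presheaf.comp_restr _ _ _ _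
      have hx' : ((l ≫ k ≫ w) ≫ K.j ≫ wLabel hV) ≫ X.anchor =
          (l ≫ e ≫ pullback.snd _ _) ≫ C.cod := by
        rw [Category.assoc l, Category.assoc l, hx, Category.assoc l]
      have hb' : X.restr ((l ≫ k ≫ w) ≫ K.j ≫ wLabel hV) (l ≫ e ≫ pullback.snd _ _) hx' =
          b ≫ branchMap F := by
        rw [← h, ← K.restr_label _ _ hf' hx']
        exact congrArg (· ≫ K.j ≫ wLabel hV) e₁.symm
      refine ⟨_, ?_, (X.restr_congr (Category.assoc _ _ _).symm rfl _).trans hb', rfl, ?_⟩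
      · rw [branchReindex_branchMap]; simp only [Category.assoc]
      · refine (K.child_congr e₁ rfl h).trans ((K.child_restr _ _ _ b _ hx' hb').trans ?_)
        exact K.child_congr (Category.assoc _ _ _).symm
          (branchReindex_congr (Category.assoc _ _ _) rfl rfl _ _) _
    obtain ⟨y', hy'⟩ := hstep w' fun l b h => by
      obtain ⟨b', h', -, -, hb⟩ := hw' l b h
      rw [hb]
      exact ih (l ≫ k) b' h'
    have hlw : (y' ≫ ν) ≫ N.label.hom = w' ≫ K.j ≫ wLabel hV := by
      rw [Category.assoc, ← hlab, ← Category.assoc, hy']; exact Category.assoc _ _ _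
    have hrn : N.R.restr ((k ≫ y) ≫ ν) (e ≫ pullback.snd _ _) hn = y' ≫ ν := by
      refine N.ext ?_ fun {U'} l b h h' => ?_
      · rw [N.label.restr, hlw]
        exact (X.restr_congr hl' rfl _).trans (K.restr_label _ _ _ hx).symm
      · obtain ⟨b', hb', hb, rfl, hc⟩ := hw' l b (by
          rw [← h', hlw]; exact Category.assoc _ _ _)
        obtain ⟨c₁, hc₁, hz₁⟩ := hfam (k ≫ y) (k ≫ w) (by rw [Category.assoc, hy, Category.assoc])
          l _ (by rw [hl', ← hb']; simp only [Category.assoc])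
          ((congrArg (· ≫ _) (Category.assoc _ _ _).symm).trans hb')
        obtain ⟨c₂, hc₂, hz₂⟩ := hfam y' w' hy' l b h' (by
          rw [← h', hlw]; exact Category.assoc _ _ _)
        have : c₁ = c₂ := by
          refine (cancel_mono γ).1 (hc₁.trans (Eq.trans (congrArg (· ≫ K.j) ?_) hc₂.symm))
          exact (K.child_congr (Category.assoc _ _ _).symm rfl _).trans hc.symm
        rw [← hz₂, ← this, hz₁]
        refine (N.fam_restr _ _ hn (N.label_anchor _ hn) l b h ?_).trans ?_
        · rw [← hb, ← X.comp_restr l _ _ hx]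
          exact congrArg (l ≫ ·) (X.restr_congr hl' rfl _)
        · exact (N.fam _).app_congr rfl (branchReindex_congr (by rw [hl']) rfl rfl _ _)
            (branchReindex_branchMap _ _ _ _ _).symm
    have hz : ((k ≫ y) ≫ ζ) ≫ Z.anchor = (e ≫ pullback.snd _ _) ≫ C.cod := by
      rw [← hn, ← α.anchor]; simp only [Category.assoc, ζ]
    have hr : Z.restr ((k ≫ y) ≫ ζ) (e ≫ pullback.snd _ _) hz = y' ≫ ζ := by
      refine (Z.restr_congr (Category.assoc _ _ _).symm rfl _).trans
        ((α.restr _ _ hn).symm.trans ?_)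
      rw [hrn, Category.assoc]
    refine ⟨pullback.lift y' e (hy'.trans ((K.restr_j _ _ _).trans (Eq.symm ?_))), by simp, ?_, ?_⟩
    · refine ((treeOp hV).nat _ _ _ _).trans ((treeOp hV).congr ?_ rfl _)
      rw [← Category.assoc, ← he, Category.assoc, hy]; exact (Category.assoc _ _ _).symm
    · simp only [pullback.lift_snd_assoc]
      rw [← hz, he]; simp only [Category.assoc]
    · refine Eq.trans (Z.restr_congr ?_ ?_ _) (hr.trans ?_)
      · simp only [pullback.lift_snd_assoc]
        rw [he, Category.assoc]
      · simp only [pullback.lift_snd_assoc]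
      · simp only [pullback.lift_fst_assoc]
  obtain ⟨y, hy, -⟩ := key (𝟙 K.W)
  rw [Category.id_comp] at hy
  have hRy {T : E} (w : T ⟶ K.W) : R (w ≫ y) := by
    obtain ⟨y', hy', h⟩ := key w
    have : y' = w ≫ y := by rw [← cancel_mono γ, hy', Category.assoc, hy]
    rwa [← this]
  have hya {T : E} (w : T ⟶ K.W) : ((w ≫ y) ≫ ζ) ≫ Z.anchor = w ≫ K.presheaf.anchor := by
    rw [Category.assoc, (hRy w).1, Category.assoc, ← Category.assoc y, hy]; rfl
  refine ⟨⟨y ≫ ζ, ?_, fun {T} w f h => ?_⟩, fun {T} w =>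
    ⟨w ≫ y ≫ ν, ?_, ?_, fun {U} k b h h' => ?_⟩⟩
  · have := hya (𝟙 K.W)
    rw [Category.id_comp] at this
    exact this.trans (Category.id_comp _)
  · have hwj : (w ≫ y) ≫ γ = w ≫ K.j := (Category.assoc _ _ _).trans (congrArg (w ≫ ·) hy)
    obtain ⟨y', h₁, h₂⟩ := hR (hRy w) f
      ((congrArg (· ≫ _) hwj).trans ((Category.assoc _ _ _).trans h)) ((hya w).trans h)
    refine Eq.trans ?_ (h₂.symm.trans (Z.restr_congr (Category.assoc _ _ _) rfl _))
    have : y' = K.presheaf.restr w f h ≫ y := by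
      refine (cancel_mono γ).1 (h₁.trans (Eq.trans ?_ (Category.assoc _ _ _).symm))
      refine Eq.trans ?_ ((K.restr_j w f h).symm.trans (congrArg (_ ≫ ·) hy.symm))
      exact (treeOp hV).congr hwj rfl _
    rw [this]; exact (Category.assoc _ _ _).symm
  · rw [Category.assoc, Category.assoc, ← hlab, ← Category.assoc y, hy]
  · simp only [ζ, Category.assoc]; rfl
  · have hk : (k ≫ w) ≫ K.j ≫ wLabel hV = b ≫ branchMap F := (Category.assoc _ _ _).trans h'
    obtain ⟨c, hc, hz⟩ := hfam (w ≫ y) w (by rw [Category.assoc, hy]) k b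
      (by rw [← h]; simp only [Category.assoc]) hk
    have : c = K.child (k ≫ w) b hk ≫ y := by
      rw [← cancel_mono γ, hc, Category.assoc, hy]
    refine (N.fam_congr (Category.assoc _ _ _).symm rfl rfl h).trans (hz.symm.trans ?_)
    rw [this, Category.assoc]; rfl

/-- Maps out of the hereditarily natural trees that satisfy the same recursion equations are
equal. -/
lemma recursion_unique (N : NatFamPresheaf F G H) (α : N.R ⟶ Z) {g₁ g₂ : K.presheaf ⟶ Z}
    (h₁ : K.IsRecursive N α g₁) (h₂ : K.IsRecursive N α g₂) : g₁ = g₂ := by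
  apply InternalPresheaf.hom_ext
  have key := K.coalg_wellFounded _ (Definable.eq AdmitsLogic.top g₁.hom g₂.hom) fun T w ih => by
    obtain ⟨n₁, hl₁, hw₁, h₁⟩ := h₁ w
    obtain ⟨n₂, hl₂, hw₂, h₂⟩ := h₂ w
    refine hw₁.trans (Eq.trans (congrArg (· ≫ α.hom) ?_) hw₂.symm)
    refine N.ext (hl₁.trans hl₂.symm) fun k b hb hb' => ?_
    have hb'' : k ≫ w ≫ K.j ≫ wLabel hV = b ≫ branchMap F := by rw [← hl₁, hb]
    rw [h₁ k b hb hb'', h₂ k b hb' hb'']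
    exact ih k b ((Category.assoc _ _ _).trans hb'')
  exact (Category.id_comp _).symm.trans ((key (𝟙 K.W)).trans (Category.id_comp _))

end HNTrees

end Recursion

/-! ### The W-type of a map of presheaves -/

section PresheafWType

lemma polyOf_app_eq {D : Type u} [Category.{v} D] [HasFiniteLimits D] {B A Z T : D} {f : B ⟶ A}
    [IsExponentiableMap f] {a a' : T ⟶ A} {t : Fam f a Z} {t' : Fam f a' Z}
    (h : polyOf f t = polyOf f t') {U : D} (k : U ⟶ T) (b : U ⟶ B) (hb : k ≫ a = b ≫ f)
    (hb' : k ≫ a' = b ≫ f) : t.app k b hb = t'.app k b hb' := by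
  have e {a : T ⟶ A} (t : Fam f a Z) (hb : k ≫ a = b ≫ f) :
      t.app k b hb = polyApp f (polyOf f (t.pull k)) b ((polyLabel_polyOf _).trans hb) :=
    ((polyApp_polyOf _ _ _).trans (t.app_congr (Category.id_comp _) rfl _)).symm
  rw [e t hb, e t' hb']
  exact polyApp_congr (by rw [← comp_polyOf, h, comp_polyOf]) rfl _

/-- The map to the terminal presheaf. -/
def InternalPresheaf.toOne {E : Type u} [Category.{v} E] [HasFiniteLimits E]
    {C : InternalCategory E} (Z : InternalPresheaf C) : Z ⟶ InternalPresheaf.one C where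
  hom := Z.anchor
  anchor := Category.comp_id _
  restr x f h := (Z.restr_anchor x f h).trans (pullback.lift_snd_assoc _ _ _ _).symm

variable {E : Type u} [Category.{v} E] [PositiveHeytingCategory E] {C : InternalCategory E}
  {Y X Z Z' : InternalPresheaf C} {F : Y ⟶ X}

lemma InternalPresheaf.comp_toOne (t : Z ⟶ Z') (t' : Z ⟶ Y) : t ≫ Z'.toOne = t' ≫ Y.toOne :=
  InternalPresheaf.hom_ext (t.anchor.trans t'.anchor.symm)

lemma IsNatFam.over_one {T : E} {x : T ⟶ X.obj} {t : Fam (branchMap F) x Z.obj} (ht : IsNatFam Z t)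
    {U : E} (k : U ⟶ T) (b : U ⟶ branchObj F) (h : k ≫ x = b ≫ branchMap F) :
    t.app k b h ≫ Z.toOne.hom = b ≫ branchElt F ≫ Y.toOne.hom :=
  ((ht.anchor k b h).trans (branch_elt_anchor b).symm).trans (Category.assoc _ _ _)

variable [IsExponentiableMap (branchMap F)]

/-- The presheaf of natural families in `Z`, without further conditions. -/
abbrev NatFams (F : Y ⟶ X) [IsExponentiableMap (branchMap F)] (Z : InternalPresheaf C) :=
  NatFamPresheaf F Z.toOne Y.toOne

namespace NatFams

variable (N : NatFams F Z) (N' : NatFams F Z')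

/-- The map on natural families induced by a map of presheaves. -/
def map (g : Z ⟶ Z') : N.R ⟶ N'.R :=
  N'.lift (IsPullback.of_hasPullback N.label F)
    (N.eval (IsPullback.of_hasPullback N.label F) ≫ g) (InternalPresheaf.comp_toOne _ _)

lemma map_label (g : Z ⟶ Z') : map N N' g ≫ N'.label = N.label :=
  N'.lift_label _ _ _

lemma comp_map_label (g : Z ⟶ Z') {T : E} (n : T ⟶ N.R.obj) :
    (n ≫ (map N N' g).hom) ≫ N'.label.hom = n ≫ N.label.hom :=
  (Category.assoc _ _ _).trans
    (congrArg (n ≫ InternalPresheaf.Hom.hom ·) (map_label N N' g))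

lemma fam_map (g : Z ⟶ Z') {T U : E} (n : T ⟶ N.R.obj) (k : U ⟶ T) (b : U ⟶ branchObj F)
    (h : k ≫ (n ≫ (map N N' g).hom) ≫ N'.label.hom = b ≫ branchMap F)
    (h' : k ≫ n ≫ N.label.hom = b ≫ branchMap F) :
    (N'.fam (n ≫ (map N N' g).hom)).app k b h = (N.fam n).app k b h' ≫ g.hom := by
  have hP := IsPullback.of_hasPullback N.label F
  have hP' := InternalPresheaf.isPullback_hom hP
  have hk : (k ≫ n) ≫ N.label.hom = b ≫ branchMap F := (Category.assoc _ _ _).trans h'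
  refine (N'.fam_comp _ n k b h (by
    rw [← h, Category.assoc k n, Category.assoc n])).trans ((N'.fam_ofFam (presheafFam hP _)
    (presheafFam_isNatFam hP _) (presheafFam_over hP _ (InternalPresheaf.comp_toOne _ _))
    _ _ _ hk).trans ?_)
  have hn := base_anchor (k ≫ n) b hk
  have hw := restr_hom_eq (k ≫ n) b hk hn
  refine (presheafFam_app hP _ (k ≫ n) b hk (hP'.lift _ _ hw) (hP'.lift_fst _ _ _)
    (hP'.lift_snd _ _ _)).trans ?_
  rw [InternalPresheaf.comp_hom, ← Category.assoc]
  refine congrArg (· ≫ g.hom) ((N.comp_eval_hom hP _).trans (Eq.symm ?_))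
  refine (N.fam_eq_evalAt n k b h' hn hw).trans (N.evalAt_congr (hP'.lift_fst _ _ hw).symm
    (hP'.lift_snd _ _ hw).symm _)

variable [IsExponentiableMap F]

/-- The family of maps of presheaves that corresponds to evaluation. -/
def evalFam : Fam F N.label Z :=
  Fam.ofHom (IsPullback.of_hasPullback N.label F) (N.eval (IsPullback.of_hasPullback N.label F))

/-- The map from the presheaf of natural families in `Z` to `P_F(Z)`. -/
def toPoly : N.R ⟶ (polynomialFunctor F).obj Z :=
  polyOf F (evalFam N)

lemma lift_toPoly {T : InternalPresheaf C} {x : T ⟶ X} (t : Fam F x Z) :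
    N.lift (IsPullback.of_hasPullback x F) (t.toHom (IsPullback.of_hasPullback x F))
      (InternalPresheaf.comp_toOne _ _) ≫ toPoly N = polyOf F t := by
  rw [toPoly, comp_polyOf]
  refine polyOf_congr (N.lift_label _ _ _) fun {U} k b h h' => ?_
  have hP := IsPullback.of_hasPullback x F
  have hP' := IsPullback.of_hasPullback N.label F
  have hl := N.lift_label hP (t.toHom hP) (InternalPresheaf.comp_toOne _ _)
  have e : hP'.lift (k ≫ N.lift hP (t.toHom hP) (InternalPresheaf.comp_toOne _ _)) b
        ((Category.assoc _ _ _).trans h) =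
      hP.lift k b h' ≫ hP'.lift (pullback.fst x F ≫ N.lift hP (t.toHom hP)
        (InternalPresheaf.comp_toOne _ _)) (pullback.snd x F) (by
          rw [Category.assoc, hl, pullback.condition]) := by
    apply hP'.hom_ext <;> simp
  refine (congrArg (· ≫ N.eval hP') e).trans ((Category.assoc _ _ _).trans ?_)
  rw [N.comp_eval hP hP' (t.toHom hP) (InternalPresheaf.comp_toOne _ _) _ (hP'.lift_fst _ _ _)
    (hP'.lift_snd _ _ _), t.lift_toHom]

instance toPoly_isIso : IsIso (toPoly N) := by
  have hP := IsPullback.of_hasPullback N.label F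
  let ψ := N.lift (IsPullback.of_hasPullback (polyLabel F (𝟙 ((polynomialFunctor F).obj Z))) F)
    ((polyFam (𝟙 _)).toHom (IsPullback.of_hasPullback _ F)) (InternalPresheaf.comp_toOne _ _)
  have h₁ : ψ ≫ toPoly N = 𝟙 _ := (lift_toPoly N _).trans (polyOf_polyFam _)
  refine ⟨ψ, ?_, h₁⟩
  have h₂ : (toPoly N ≫ ψ) ≫ toPoly N = toPoly N := by rw [Category.assoc, h₁, Category.comp_id]
  have hl : (toPoly N ≫ ψ) ≫ N.label = N.label := by
    have := congrArg (polyLabel F) h₂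
    rwa [comp_polyLabel, toPoly, polyLabel_polyOf] at this
  have h₃ : polyOf F ((evalFam N).pull (toPoly N ≫ ψ)) = polyOf F (evalFam N) :=
    (comp_polyOf _ _).symm.trans h₂
  refine N.hom_ext hP hP hl (Category.id_comp _)
    (u₁ := hP.lift (pullback.fst N.label F ≫ toPoly N ≫ ψ) (pullback.snd _ _)
      (by rw [Category.assoc, hl, hP.w])) (u₂ := 𝟙 _) (hP.lift_fst _ _ _)
    (by simp) (hP.lift_snd _ _ _) (by simp) ?_
  have := polyOf_app_eq h₃ (pullback.fst N.label F) (pullback.snd _ _) (by rw [hl, hP.w]) hP.w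
  refine Eq.trans this (congrArg (· ≫ N.eval hP) ?_)
  apply hP.hom_ext <;> simp

lemma toPoly_map (g : Z ⟶ Z') :
    toPoly N ≫ (polynomialFunctor F).map g = map N N' g ≫ toPoly N' := by
  rw [toPoly, polyOf_map, ← lift_toPoly N']
  refine congrArg (· ≫ toPoly N') ?_
  have e : ((evalFam N).map g).toHom (IsPullback.of_hasPullback N.label F) =
      N.eval (IsPullback.of_hasPullback N.label F) ≫ g :=
    congrArg (· ≫ g) (Fam.toHom_ofHom _ _)
  simp only [e, map]

end NatFams

namespace HNTrees

variable {V : Endofunctor.Algebra (polynomialFunctor (branchMap F))} {hV : IsInitial V}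
  (K : HNTrees hV) (N : NatFams F K.presheaf)

lemma sup_congr {T : E} {x x' : T ⟶ X.obj} (hx : x = x') {t : Fam (branchMap F) x K.W}
    {t' : Fam (branchMap F) x' K.W} (ht : IsNatFam K.presheaf t) (ht' : IsNatFam K.presheaf t')
    (h : ∀ {U : E} (k : U ⟶ T) (b : U ⟶ branchObj F) (h : k ≫ x = b ≫ branchMap F)
      (h' : k ≫ x' = b ≫ branchMap F), t.app k b h = t'.app k b h') :
    K.sup t ht = K.sup t' ht' := by
  rw [← cancel_mono K.j, sup_j, sup_j]
  exact wSup_congr V hx fun k b h₁ h₂ => congrArg (· ≫ K.j) (h k b h₁ h₂)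

lemma comp_sup {T T' : E} (l : T' ⟶ T) {x : T ⟶ X.obj} {t : Fam (branchMap F) x K.W}
    (ht : IsNatFam K.presheaf t) : l ≫ K.sup t ht = K.sup (t.pull l) (ht.pull l) := by
  rw [← cancel_mono K.j, Category.assoc, sup_j, comp_wSup]
  exact (wSup_congr V rfl fun _ _ _ _ => rfl).trans (K.sup_j (t.pull l) (ht.pull l)).symm

lemma sup_childFam {T : E} (w : T ⟶ K.W) : K.sup (K.childFam w) (K.childFam_isNatFam w) = w := by
  rw [← cancel_mono K.j, sup_j]
  exact (wSup_congr V (Category.assoc _ _ _).symm fun k b h h' => K.childFam_j w k b h h').trans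
    (wSup_wFam hV _)

/-- The value of the algebra structure at a natural family. -/
def supAt {T : E} (n : T ⟶ N.R.obj) : T ⟶ K.W :=
  K.sup (N.fam n) (N.fam_isNatFam n)

lemma supAt_label {T : E} (n : T ⟶ N.R.obj) :
    K.supAt N n ≫ K.j ≫ wLabel hV = n ≫ N.label.hom :=
  K.sup_label _ _

lemma comp_supAt {T T' : E} (l : T' ⟶ T) (n : T ⟶ N.R.obj) :
    l ≫ K.supAt N n = K.supAt N (l ≫ n) := by
  refine (K.comp_sup l _).trans (K.sup_congr (Category.assoc _ _ _).symm _ _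
    fun k b h h' => ?_)
  exact (N.fam_comp n l k b h' (by rw [← h]; simp only [Category.assoc])).symm

lemma supAt_anchor {T : E} (n : T ⟶ N.R.obj) :
    K.supAt N n ≫ K.presheaf.anchor = n ≫ N.R.anchor := by
  have : (K.supAt N n ≫ K.j ≫ wLabel hV) ≫ X.anchor = n ≫ N.R.anchor := by
    rw [supAt_label, Category.assoc, N.label.anchor]
  rw [← this, presheaf_anchor]
  simp only [Category.assoc]
  rfl

lemma supAt_restr {T : E} (n : T ⟶ N.R.obj) (f : T ⟶ C.C₁) (h : n ≫ N.R.anchor = f ≫ C.cod)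
    (h' : K.supAt N n ≫ K.presheaf.anchor = f ≫ C.cod) :
    K.supAt N (N.R.restr n f h) = K.presheaf.restr (K.supAt N n) f h' := by
  have hl : n ≫ N.label.hom = (K.supAt N n ≫ K.j) ≫ wLabel hV := by
    rw [Category.assoc, supAt_label]
  refine (cancel_mono K.j).1 ((K.sup_j _ _).trans (Eq.trans ?_ (K.restr_j _ f h').symm))
  refine wSup_congr V ((N.label.restr n f h).trans (X.restr_congr hl rfl _))
    fun {U} k b hb hb' => ?_
  have hb₁ : k ≫ X.restr (n ≫ N.label.hom) f (N.label_anchor n h) = b ≫ branchMap F := by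
    rw [← hb, N.label.restr]
  refine (congrArg (· ≫ K.j) (N.fam_restr n f h _ k b hb hb₁)).trans (Eq.symm ?_)
  refine (wChild_congr hV (congrArg (k ≫ ·) (K.sup_j _ _)) rfl
    ((Category.assoc _ _ _).trans (branchReindex_branchMap _ _ _ _ _).symm)).trans
      ((wChild_wSup hV _ _ _ _).trans (congrArg (· ≫ K.j) ?_))
  exact (N.fam n).app_congr rfl (branchReindex_congr (congrArg (k ≫ ·) hl.symm) rfl rfl _ _)
    (((congrArg (k ≫ ·) hl).trans (branchReindex_branchMap _ _ _ _ _).symm))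

/-- The operation `sup`, as a map of presheaves. -/
def supHom : N.R ⟶ K.presheaf where
  hom := K.supAt N (𝟙 _)
  anchor := by
    have := K.supAt_anchor N (𝟙 _)
    rwa [Category.id_comp] at this
  restr n f h :=
    (K.comp_supAt N _ _).trans ((congrArg (K.supAt N) (Category.comp_id _)).trans
      ((K.supAt_restr N n f h ((K.supAt_anchor N n).trans h)).trans
        (K.presheaf.restr_congr ((K.comp_supAt N _ _).trans (congrArg (K.supAt N)
          (Category.comp_id _))).symm rfl _)))

lemma comp_supHom {T : E} (n : T ⟶ N.R.obj) : n ≫ (K.supHom N).hom = K.supAt N n :=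
  (K.comp_supAt N n (𝟙 _)).trans (congrArg (K.supAt N) (Category.comp_id n))

/-- The natural family of the children of a hereditarily natural tree. -/
def children {T : E} (w : T ⟶ K.W) : T ⟶ N.R.obj :=
  N.ofFam (K.childFam w) (K.childFam_isNatFam w) (IsNatFam.over_one (K.childFam_isNatFam w))

lemma supAt_children {T : E} (w : T ⟶ K.W) : K.supAt N (K.children N w) = w := by
  refine Eq.trans ?_ (K.sup_childFam w)
  exact K.sup_congr (N.ofFam_label _ _ _) _ _ fun k b h h' => N.fam_ofFam _ _ _ k b h h'

variable {N}

/-- A map of presheaves satisfies the recursion equations for `α` if and only if it preserves the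
operations. -/
lemma recursion_iff {NZ : NatFams F Z} (α : NZ.R ⟶ Z) (g : K.presheaf ⟶ Z) :
    K.IsRecursive NZ α g ↔
      NatFams.map N NZ g ≫ α = K.supHom N ≫ g := by
  constructor
  · intro H
    apply InternalPresheaf.hom_ext
    obtain ⟨n, hn, hg, hf⟩ := H (K.supAt N (𝟙 _))
    refine Eq.trans (congrArg (· ≫ α.hom) ?_) hg.symm
    rw [supAt_label] at hn
    have hl := congrArg InternalPresheaf.Hom.hom (NatFams.map_label N NZ g)
    refine NZ.ext (hl.trans ((Category.id_comp _).symm.trans hn.symm)) fun {U} k b h h' => ?_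
    have h₁ : k ≫ 𝟙 _ ≫ N.label.hom = b ≫ branchMap F := by rw [← hn, h']
    have h₂ : k ≫ K.supAt N (𝟙 _) ≫ K.j ≫ wLabel hV = b ≫ branchMap F := by
      rw [supAt_label, h₁]
    rw [hf k b h' h₂]
    refine (NZ.fam_congr (Category.id_comp _).symm rfl rfl h).trans
      ((NatFams.fam_map N NZ g (𝟙 _) k b _ h₁).trans (congrArg (· ≫ g.hom) ?_))
    exact (K.childFam_sup _ _ k b h₂ h₁).symm
  · intro H T w
    have hn : K.children N w ≫ N.label.hom = w ≫ K.j ≫ wLabel hV := N.ofFam_label _ _ _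
    refine ⟨K.children N w ≫ (NatFams.map N NZ g).hom,
      (NatFams.comp_map_label N NZ g _).trans hn, ?_, fun k b h h' => ?_⟩
    · have := congrArg (K.children N w ≫ InternalPresheaf.Hom.hom ·) H
      refine Eq.trans ?_ (this.symm.trans (Category.assoc _ _ _).symm)
      refine Eq.trans ?_ (Category.assoc _ _ _)
      exact (congrArg (· ≫ g.hom) ((K.comp_supHom N _).trans (K.supAt_children N w))).symm
    · refine (NatFams.fam_map N NZ g _ k b h (by rw [hn, h'])).trans (congrArg (· ≫ g.hom) ?_)
      exact N.fam_ofFam _ _ _ k b _ h'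

lemma isPresheafOfHereditarilyNaturalTrees {S : MorphismProperty E} (hS : IsClassOfSmallMaps S)
    (hW : AxiomWE S) : IsPresheafOfHereditarilyNaturalTrees hV K.presheaf K.j where
  mono := K.mono
  factors_iff := K.factors_iff_isHereditarilyNaturalTree hS hW
  root := treeRoot_eq hV _
  restr w f h := (K.restr_j w f h).trans (treeRestr_eq hV _ _ _).symm

variable (N) [IsExponentiableMap F]

/-- The hereditarily natural trees as an algebra for `P_F`. -/
def algebra : Endofunctor.Algebra (polynomialFunctor F) where
  a := K.presheaf
  str := inv (NatFams.toPoly N) ≫ K.supHom N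

/-- Morphisms of algebras out of the algebra of hereditarily natural trees are the maps defined by
recursion. -/
lemma algebra_hom_iff {A : Endofunctor.Algebra (polynomialFunctor F)} (NA : NatFams F A.a)
    (g : K.presheaf ⟶ A.a) : (polynomialFunctor F).map g ≫ A.str = (K.algebra N).str ≫ g ↔
      NatFams.map N NA g ≫ NatFams.toPoly NA ≫ A.str = K.supHom N ≫ g := by
  have h₁ : (K.algebra N).str ≫ g = inv (NatFams.toPoly N) ≫ K.supHom N ≫ g :=
    Category.assoc _ _ _
  have h₂ := congrArg (· ≫ A.str) (NatFams.toPoly_map N NA g)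
  simp only [Category.assoc] at h₂
  rw [h₁, ← h₂, IsIso.eq_inv_comp]

lemma nonempty_isInitial {S : MorphismProperty E} (hS : S.IsStableUnderBaseChange)
    (hW : AxiomWE S) (hφ : S (branchMap F)) : Nonempty (IsInitial (K.algebra N)) := by
  have h (A : Endofunctor.Algebra (polynomialFunctor F)) : Nonempty (Unique (K.algebra N ⟶ A)) := by
    obtain ⟨NA⟩ := nonempty_natFamPresheaf F A.a.toOne Y.toOne
    obtain ⟨g, hg⟩ := K.exists_recursion hS hW hφ NA (NatFams.toPoly NA ≫ A.str)
      fun z y h => h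
    refine ⟨⟨⟨g, (K.algebra_hom_iff N NA g).2 ((K.recursion_iff _ g).1 hg)⟩⟩, fun g' => ?_⟩
    have hg' : K.IsRecursive NA _ g'.f :=
      (K.recursion_iff (N := N) _ g'.f).2 ((K.algebra_hom_iff N NA g'.f).1 g'.h)
    refine Endofunctor.Algebra.Hom.ext (K.recursion_unique NA _ hg' hg)
  exact ⟨IsInitial.ofUnique (h := fun A => (h A).some) _⟩

lemma isAlgebraOfTrees : IsAlgebraOfTrees (K.algebra N) K.j := by
  intro T x t
  have hP := IsPullback.of_hasPullback x F
  have hP' := IsPullback.of_hasPullback x.hom (branchMap F)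
  refine ⟨((presheafFam hP t).map K.j).toHom hP', fun {U} m z h₁ h₂ => ?_, ?_⟩
  · rw [Fam.nat]
    refine (congrArg (· ≫ K.j) (presheafFam_app hP t _ _ _ z (h₁.trans
      (T.restr_congr rfl (Category.assoc _ _ _).symm _)) ?_)).trans (Category.assoc _ _ _)
    rw [h₂, pairElt, Category.assoc]
  · have e : polyMk F x t = N.lift hP t (InternalPresheaf.comp_toOne _ _) ≫ NatFams.toPoly N := by
      refine (polyMk_eq_polyOf _ _).trans ((NatFams.lift_toPoly N _).symm.trans ?_)
      simp only [Fam.toHom_ofHom]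
    have e' : polyMk F x t ≫ (K.algebra N).str =
        N.lift hP t (InternalPresheaf.comp_toOne _ _) ≫ K.supHom N := by
      rw [e]
      exact (Category.assoc _ _ _).trans (congrArg (_ ≫ ·)
        (IsIso.hom_inv_id_assoc (NatFams.toPoly N) (K.supHom N)))
    rw [treeSup_eq, Fam.ofHom_toHom]
    refine (congrArg (InternalPresheaf.Hom.hom · ≫ K.j) e').trans
      ((congrArg (· ≫ K.j) (K.comp_supHom N _)).trans ((K.sup_j _ _).trans ?_))
    have ht := presheafFam_isNatFam hP t
    exact wSup_congr V (N.ofFam_label (presheafFam hP t) ht (IsNatFam.over_one ht))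
      fun k b h h' => congrArg (· ≫ K.j) (N.fam_ofFam _ ht (IsNatFam.over_one ht) k b h h')

end HNTrees

/-- The W-type of a pointwise small map of presheaves consists of the hereditarily natural trees. -/
theorem exists_wType_of_hereditarilyNaturalTrees {S : MorphismProperty E}
    (hS : IsClassOfSmallMaps S) (hW : AxiomWE S) (hφ : S (branchMap F)) [IsExponentiableMap F]
    {V : Endofunctor.Algebra (polynomialFunctor (branchMap F))} (hV : IsInitial V)
    (K : HNTrees hV) :
    ∃ W : Endofunctor.Algebra (polynomialFunctor F), W.a = K.presheaf ∧ Nonempty (IsInitial W) ∧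
      ∃ j : W.a.obj ⟶ V.a, IsPresheafOfHereditarilyNaturalTrees hV W.a j ∧
        IsAlgebraOfTrees W j := by
  obtain ⟨N⟩ := nonempty_natFamPresheaf F K.presheaf.toOne Y.toOne
  exact ⟨K.algebra N, rfl, K.nonempty_isInitial N hS.pullback_stable hW hφ, K.j,
    K.isPresheafOfHereditarilyNaturalTrees hS hW, K.isAlgebraOfTrees N⟩

end PresheafWType

/-! ### W-types in slices -/

section Slice

variable {E : Type u} [Category.{v} E] [HasFiniteLimits E] {A B I L : E} {φ : B ⟶ A} {p : L ⟶ I}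
  {q : L ⟶ A}

variable (φ p q) in
/-- The base change of `φ : B ⟶ A` along `q : L ⟶ A`, as a map in the slice over `I`. -/
def sliceMap : Over.mk (pullback.fst q φ ≫ p) ⟶ Over.mk p :=
  Over.homMk (pullback.fst q φ)

/-- A family over the base change of `φ`, in the slice, is a family over `φ`. -/
def Fam.ofSlice {T Z : Over I} {a : T ⟶ Over.mk p} (t : Fam (sliceMap φ p q) a Z) :
    Fam φ (a.left ≫ q) Z.left where
  app k b h := (t.app (U := Over.mk (k ≫ T.hom)) (Over.homMk k)
    (Over.homMk (pullback.lift (k ≫ a.left) b ((Category.assoc _ _ _).trans h))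
      ((pullback.lift_fst_assoc _ _ _ _).trans
        ((Category.assoc _ _ _).trans (congrArg (k ≫ ·) (Over.w a)))))
    (by ext; exact (pullback.lift_fst _ _ _).symm)).left
  nat {U U'} l k b h := by
    let l' : Over.mk ((l ≫ k) ≫ T.hom) ⟶ Over.mk (k ≫ T.hom) :=
      Over.homMk l (Category.assoc _ _ _).symm
    refine (congrArg CommaMorphism.left (t.nat l' _ _ _)).trans
      (congrArg CommaMorphism.left (t.app_congr ?_ ?_ _))
    · ext; rfl
    · ext
      exact pullback.hom_ext (by simp [l']) (by simp [l'])

/-- A family over `φ` whose values lie over the stage is a family in the slice. -/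
def Fam.toSlice {T Z : Over I} {a : T ⟶ Over.mk p} (t : Fam φ (a.left ≫ q) Z.left)
    (ht : ∀ {U : E} (k : U ⟶ T.left) (b : U ⟶ B) (h : k ≫ a.left ≫ q = b ≫ φ),
      t.app k b h ≫ Z.hom = k ≫ T.hom) : Fam (sliceMap φ p q) a Z where
  app {U} k b h := Over.homMk (t.app k.left (b.left ≫ pullback.snd q φ) (by
      have := congrArg CommaMorphism.left h
      have : k.left ≫ a.left = b.left ≫ pullback.fst q φ := this
      rw [← Category.assoc, this, Category.assoc, pullback.condition, Category.assoc]))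
    ((ht _ _ _).trans (Over.w k))
  nat l k b h := by
    ext
    exact (t.nat _ _ _ _).trans (t.app_congr rfl (Category.assoc _ _ _).symm _)

lemma Fam.ofSlice_map_toSlice {T Z Z' : Over I} {a : T ⟶ Over.mk p}
    (t : Fam φ (a.left ≫ q) Z.left) (ht : ∀ {U : E} (k : U ⟶ T.left) (b : U ⟶ B)
      (h : k ≫ a.left ≫ q = b ≫ φ), t.app k b h ≫ Z.hom = k ≫ T.hom) (g : Z ⟶ Z') :
    ((t.toSlice ht).map g).ofSlice = t.map g.left := by
  ext U k b h
  exact congrArg (· ≫ g.left) (t.app_congr rfl (pullback.lift_snd _ _ _) _)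

variable [IsExponentiableMap (sliceMap φ p q)]
  (U : Endofunctor.Algebra (polynomialFunctor (sliceMap φ p q)))

/-- The operation `sup` of an algebra in the slice, on families over `φ`. -/
def sliceSup {T : E} (a : T ⟶ L) (t : Fam φ (a ≫ q) U.a.left)
    (ht : ∀ {T' : E} (k : T' ⟶ T) (b : T' ⟶ B) (h : k ≫ a ≫ q = b ≫ φ),
      t.app k b h ≫ U.a.hom = k ≫ a ≫ p) : T ⟶ U.a.left :=
  (wSup U (T := Over.mk (a ≫ p)) (a := Over.homMk a) (Fam.toSlice t ht)).left

lemma sliceSup_hom {T : E} (a : T ⟶ L) (t : Fam φ (a ≫ q) U.a.left)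
    (ht : ∀ {T' : E} (k : T' ⟶ T) (b : T' ⟶ B) (h : k ≫ a ≫ q = b ≫ φ),
      t.app k b h ≫ U.a.hom = k ≫ a ≫ p) : sliceSup U a t ht ≫ U.a.hom = a ≫ p :=
  Over.w (wSup U (T := Over.mk (a ≫ p)) (a := Over.homMk a) (Fam.toSlice t ht))

lemma sliceSup_congr {T : E} {a a' : T ⟶ L} (ha : a = a') {t : Fam φ (a ≫ q) U.a.left}
    {t' : Fam φ (a' ≫ q) U.a.left}
    (ht : ∀ {T' : E} (k : T' ⟶ T) (b : T' ⟶ B) (h : k ≫ a ≫ q = b ≫ φ),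
      t.app k b h ≫ U.a.hom = k ≫ a ≫ p)
    (ht' : ∀ {T' : E} (k : T' ⟶ T) (b : T' ⟶ B) (h : k ≫ a' ≫ q = b ≫ φ),
      t'.app k b h ≫ U.a.hom = k ≫ a' ≫ p)
    (h : ∀ {T' : E} (k : T' ⟶ T) (b : T' ⟶ B) (h : k ≫ a ≫ q = b ≫ φ)
      (h' : k ≫ a' ≫ q = b ≫ φ), t.app k b h = t'.app k b h') :
    sliceSup U a t ht = sliceSup U a' t' ht' := by
  subst ha
  obtain rfl : t = t' := by
    ext T' k b hb
    exact h k b hb hb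
  rfl

lemma comp_sliceSup {T T' : E} (l : T' ⟶ T) (a : T ⟶ L) (t : Fam φ (a ≫ q) U.a.left)
    (ht : ∀ {T' : E} (k : T' ⟶ T) (b : T' ⟶ B) (h : k ≫ a ≫ q = b ≫ φ),
      t.app k b h ≫ U.a.hom = k ≫ a ≫ p) :
    l ≫ sliceSup U a t ht = sliceSup U (l ≫ a) ((t.pull l).cast (Category.assoc _ _ _))
      fun k b h => (ht _ _ _).trans (by simp only [Category.assoc]) := by
  let l' : Over.mk ((l ≫ a) ≫ p) ⟶ Over.mk (a ≫ p) := Over.homMk l (Category.assoc _ _ _).symm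
  refine (congrArg CommaMorphism.left (comp_wSup U l' _)).trans
    (congrArg CommaMorphism.left (wSup_congr U ?_ fun k b h h' => ?_))
  · ext; rfl
  · ext; rfl

variable {U}

/-- Recursion over a W-type in the slice into an object `Z` of `E`: the label of a node lies in `L`
and its branches are those of its image in `A`. It is recursion in the slice for the object
`Z × I`. -/
lemma exists_slice_recursion (hU : IsInitial U) {Z : E}
    (τ : ∀ {T : E} (a : T ⟶ L), Fam φ (a ≫ q) Z → (T ⟶ Z))
    (hτ : ∀ {T T' : E} (l : T' ⟶ T) (a : T ⟶ L) (t : Fam φ (a ≫ q) Z),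
      l ≫ τ a t = τ (l ≫ a) ((t.pull l).cast (Category.assoc _ _ _))) :
    ∃ r : U.a.left ⟶ Z, ∀ {T : E} (a : T ⟶ L) (t : Fam φ (a ≫ q) U.a.left)
      (ht : ∀ {T' : E} (k : T' ⟶ T) (b : T' ⟶ B) (h : k ≫ a ≫ q = b ≫ φ),
        t.app k b h ≫ U.a.hom = k ≫ a ≫ p), sliceSup U a t ht ≫ r = τ a (t.map r) := by
  let σ : SupAlg (sliceMap φ p q) (Over.mk (prod.snd : Z ⨯ I ⟶ I)) :=
    { sup := fun {T a} t =>
        Over.homMk (prod.lift (τ a.left (t.ofSlice.map prod.fst)) T.hom) (prod.lift_snd _ _)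
      nat := fun {T T'} l a t => by
        ext
        refine Limits.prod.hom_ext ?_ ?_
        · refine ((Category.assoc _ _ _).trans (congrArg (l.left ≫ ·) (prod.lift_fst _ _))).trans
            (Eq.trans ?_ (prod.lift_fst _ _).symm)
          refine (hτ _ _ _).trans (congrArg (τ _) ?_)
          ext U' k b h
          refine congrArg (· ≫ prod.fst) ?_
          let i : Over.mk (k ≫ T'.hom) ⟶ Over.mk ((k ≫ l.left) ≫ T.hom) :=
            Over.homMk (𝟙 _) (by simp)
          refine (Category.id_comp _).symm.trans ((congrArg CommaMorphism.left
            (t.nat i _ _ _)).trans (congrArg CommaMorphism.left (t.app_congr ?_ ?_ _)))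
          · ext
            exact Category.id_comp _
          · ext
            exact (Category.id_comp _).trans
              (pullback.hom_ext (by simp) (by simp))
        · exact ((Category.assoc _ _ _).trans (congrArg (l.left ≫ ·) (prod.lift_snd _ _))).trans
            ((Over.w l).trans (prod.lift_snd _ _).symm) }
  obtain ⟨g, hg, -⟩ := w_rec hU σ
  refine ⟨g.left ≫ prod.fst, fun {T} a t ht => ?_⟩
  have := congrArg (CommaMorphism.left · ≫ prod.fst)
    (hg (T := Over.mk (a ≫ p)) (a := Over.homMk a) (Fam.toSlice t ht))
  refine (Category.assoc _ _ _).symm.trans (this.trans ((prod.lift_fst _ _).trans ?_))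
  refine congrArg (τ a) ?_
  refine (congrArg (Fam.map · prod.fst) (Fam.ofSlice_map_toSlice
    (T := Over.mk (a ≫ p)) (Z := U.a) (a := Over.homMk a) t ht g)).trans ?_
  ext U' k b h
  exact Category.assoc _ _ _

end Slice

/-! ### Tagged trees -/

section Smallness

variable {E : Type u} [Category.{v} E] [PositiveHeytingCategory E]

/-- If a composite is small, then so is its first factor: its graph is a small subobject. -/
lemma AdmitsLogic.of_comp {S : MorphismProperty E} (hS : AdmitsLogic S) {X Y Z : E} (f : X ⟶ Y)
    (g : Y ⟶ Z) (h : S (f ≫ g)) : S f := by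
  let s : X ⟶ pullback (f ≫ g) g := pullback.lift (𝟙 X) f (Category.id_comp _)
  have hs : s ≫ pullback.fst _ _ = 𝟙 X := pullback.lift_fst _ _ _
  have : Mono s := mono_of_mono_fac hs
  have hd : Definable S (fun ⦃T : E⦄ (x : T ⟶ pullback (f ≫ g) g) => ∃ l, l ≫ s = x) := by
    refine (Definable.eq hS (pullback.fst _ _ ≫ f) (pullback.snd _ _)).congr
      fun T x => ⟨fun hx => ?_, ?_⟩
    · refine ⟨x ≫ pullback.fst _ _, pullback.hom_ext ?_ ?_⟩
      · rw [Category.assoc, hs, Category.comp_id]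
      · rw [← hx, Category.assoc, pullback.lift_snd, Category.assoc]
    · rintro ⟨l, rfl⟩
      simp [s]
  have := hS.composition _ _ (hd.mem hS.pullback_stable) (hS.pullback_stable.of_isPullback
    (IsPullback.of_hasPullback (f ≫ g) g) h)
  rwa [pullback.lift_snd] at this

/-- The small objects of a slice are the small maps. -/
lemma sliceSmall_terminal_iff {D : Type u} [Category.{v} D] [HasFiniteLimits D]
    {S : MorphismProperty D} [S.RespectsIso] {I : D} (A : Over I) :
    IsSmallObject (sliceSmall S I) A ↔ S A.hom := by
  let e : (⊤_ (Over I)) ≅ Over.mk (𝟙 I) := terminalIsTerminal.uniqueUpToIso Over.mkIdTerminal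
  have h : (terminal.from A).left ≫ e.hom.left = A.hom :=
    (Category.comp_id _).symm.trans (Over.w (terminal.from A ≫ e.hom))
  have : IsIso e.hom.left := Iso.isIso_hom ((Over.forget I).mapIso e)
  exact (MorphismProperty.cancel_right_of_respectsIso S (terminal.from A).left
    e.hom.left).symm.trans (iff_of_eq (congrArg (@S _ _) h))

/-- A map on a coalgebra, as a family of values at the children. -/
def FibCoalg.fam {B A J Z : E} {f : B ⟶ A} (γ : FibCoalg f J) (σ : J ⟶ Z) {a : J ⟶ A}
    (ha : a = γ.label) : Fam f a Z where
  app k b h := γ.child k b (by rw [← ha, h]) ≫ σ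
  nat l k b h := by rw [← Category.assoc, γ.nat]

namespace HNTrees

variable {C : InternalCategory E} {Y X : InternalPresheaf C} {F : Y ⟶ X}
  [IsExponentiableMap (branchMap F)]
  {V : Endofunctor.Algebra (polynomialFunctor (branchMap F))} {hV : IsInitial V} (K : HNTrees hV)

lemma j_mem {S : MorphismProperty E} (hS : IsPredicativeCategoryWithSmallMaps S)
    (hcod : S C.cod) (hφ : S (branchMap F)) : S K.j :=
  Definable.mem hS.pullback_stable (hS.definable_of_children hφ (wCoalg hV)
    (wCoalg_wellFounded hV) (definable_natTree hV hS.admitsLogic hφ hcod)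
    ⟨K.W, K.j, K.mono, trivial, fun _ _ => Iff.rfl⟩ fun _ v => K.factors_iff v)

lemma anchor_eq : K.presheaf.anchor = (K.j ≫ wLabel hV) ≫ X.anchor :=
  (Category.assoc _ _ _).symm

/-- The pairs `(f, w)` of a hereditarily natural tree `w` and an arrow `f` whose domain is the root
of `w`; the child of `(f, w)` at a branch `(g, y)` is `(fg, w')` with `w'` the child of `w`. The
codomain of `f` is then constant along branches. -/
def tagged : FibCoalg (branchMap F) (pullback C.dom K.presheaf.anchor) where
  label := pullback.snd C.dom K.presheaf.anchor ≫ K.j ≫ wLabel hV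
  child j b h :=
    have h' : (j ≫ pullback.snd C.dom K.presheaf.anchor) ≫ K.j ≫ wLabel hV = b ≫ branchMap F :=
      (Category.assoc _ _ _).trans h
    pullback.lift (C.compose (j ≫ pullback.fst C.dom K.presheaf.anchor) (b ≫ branchArrow F) (by
        rw [Category.assoc, pullback.condition, ← branch_anchor h', Category.assoc]
        exact (congrArg (j ≫ pullback.snd C.dom K.presheaf.anchor ≫ ·) K.anchor_eq).trans
          (Category.assoc _ _ _).symm))
      (K.child (j ≫ pullback.snd C.dom K.presheaf.anchor) b h')
      ((C.compose_dom _ _ _).trans (K.child_anchor _ b h').symm)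
  nat l j b h := by
    dsimp only
    refine pullback.hom_ext ?_ ?_
    · refine (Category.assoc _ _ _).trans ((congrArg (l ≫ ·) (pullback.lift_fst _ _ _)).trans
        (Eq.trans ?_ (pullback.lift_fst _ _ _).symm))
      refine (C.comp_compose _ _ _ _).trans ?_
      exact C.compose_congr (Category.assoc _ _ _).symm (Category.assoc _ _ _).symm _
    · refine (Category.assoc _ _ _).trans ((congrArg (l ≫ ·) (pullback.lift_snd _ _ _)).trans
        (Eq.trans ?_ (pullback.lift_snd _ _ _).symm))
      have h' : (j ≫ pullback.snd C.dom K.presheaf.anchor) ≫ K.j ≫ wLabel hV =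
        b ≫ branchMap F := (Category.assoc _ _ _).trans h
      exact (K.coalg.nat l _ b h').trans (K.child_congr (Category.assoc _ _ _).symm rfl
        ((Category.assoc _ _ _).trans ((congrArg (l ≫ ·) h').trans (Category.assoc _ _ _).symm)))

lemma tagged_child_fst {T : E} (j : T ⟶ pullback C.dom K.presheaf.anchor) (b : T ⟶ branchObj F)
    (h : j ≫ K.tagged.label = b ≫ branchMap F) :
    K.tagged.child j b h ≫ pullback.fst _ _ ≫ C.cod = j ≫ pullback.fst _ _ ≫ C.cod := by
  refine (pullback.lift_fst_assoc _ _ _ _).trans ?_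
  rw [C.compose_cod, Category.assoc]

lemma tagged_child_snd {T : E} (j : T ⟶ pullback C.dom K.presheaf.anchor) (b : T ⟶ branchObj F)
    (h : j ≫ K.tagged.label = b ≫ branchMap F) :
    K.tagged.child j b h ≫ pullback.snd _ _ =
      K.child (j ≫ pullback.snd _ _) b ((Category.assoc _ _ _).trans h) :=
  pullback.lift_snd _ _ _

lemma tagged_wellFounded : K.tagged.WellFounded :=
  K.coalg_wellFounded.of_hom (pullback.snd _ _) rfl K.tagged_child_snd

/-- The object of pairs `(f, x)` with `x ∈ X(dom f)`, the labels of the tagged trees. -/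
abbrev tagObj (X : InternalPresheaf C) : E := pullback C.dom X.anchor

variable (X) in
/-- The map sending `(f, x)` to the codomain of `f`. -/
abbrev tagCod : tagObj X ⟶ C.C₀ := pullback.fst C.dom X.anchor ≫ C.cod

variable (X) in
/-- The map sending `(f, x)` to `x`. -/
abbrev tagElt : tagObj X ⟶ X.obj := pullback.snd C.dom X.anchor

/-- The label of a tagged tree. -/
def tagLabel : pullback C.dom K.presheaf.anchor ⟶ tagObj X :=
  pullback.lift (pullback.fst _ _) (pullback.snd _ _ ≫ K.j ≫ wLabel hV) (by
    rw [pullback.condition, Category.assoc]; exact congrArg (_ ≫ ·) K.anchor_eq)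

lemma tagLabel_elt : K.tagLabel ≫ tagElt X = K.tagged.label := pullback.lift_snd _ _ _

lemma tagLabel_cod : K.tagLabel ≫ tagCod X = pullback.fst _ _ ≫ C.cod :=
  pullback.lift_fst_assoc _ _ _ _

/-- Tagged trees may be mapped to any algebra, in the slice over the object of objects, for the
branching type with labels `(f, x)`: recursion along the tagged trees never leaves a fibre. -/
lemma exists_tagged_recursion {S : MorphismProperty E} (hS : S.IsStableUnderBaseChange)
    (hW : AxiomWE S) (hφ : S (branchMap F))
    [IsExponentiableMap (sliceMap (branchMap F) (tagCod X) (tagElt X))]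
    (U : Endofunctor.Algebra
      (polynomialFunctor (sliceMap (branchMap F) (tagCod X) (tagElt X)))) :
    ∃ (σ : pullback C.dom K.presheaf.anchor ⟶ U.a.left)
      (ht : ∀ {T : E} (k : T ⟶ _) (b : T ⟶ branchObj F)
        (h : k ≫ K.tagLabel ≫ tagElt X = b ≫ branchMap F),
        (K.tagged.fam σ K.tagLabel_elt).app k b h ≫ U.a.hom = k ≫ K.tagLabel ≫ tagCod X),
      σ = sliceSup U K.tagLabel (K.tagged.fam σ K.tagLabel_elt) ht := by
  let J := pullback C.dom K.presheaf.anchor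
  let P := (polynomialFunctor (branchMap F)).obj U.a.left
  -- the pairs of a tagged tree and a family of elements of `U` over the codomain of the tag
  let D := pullback K.tagged.label (polyLab (branchMap F) U.a.left)
  let dj : D ⟶ J := pullback.fst _ _
  let dt : D ⟶ P := pullback.snd _ _
  have hD : dj ≫ K.tagged.label = polyLabel _ dt := by
    rw [← comp_polyLab, ← pullback.condition]
  have hDk {T : E} {k : T ⟶ D} {b : T ⟶ branchObj F}
      (h : k ≫ dj ≫ K.tagLabel ≫ tagElt X = b ≫ branchMap F) :
      k ≫ polyLabel _ dt = b ≫ branchMap F := by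
    rw [← hD, ← h, tagLabel_elt]
  let N := pullback (polyLabel _ dt) (branchMap F)
  have hN : pullback.fst (polyLabel _ dt) (branchMap F) ≫ polyLabel _ dt =
    pullback.snd _ _ ≫ branchMap F := pullback.condition
  obtain ⟨M, m, hm, -, H⟩ := Definable.all AdmitsLogic.top (S := ⊤) (g := pullback.fst _ _) trivial
    (Definable.eq AdmitsLogic.top ((polyFam dt).app _ _ hN ≫ U.a.hom)
      (pullback.fst _ _ ≫ dj ≫ K.tagLabel ≫ tagCod X))
  have hval {T T' : E} (k : T' ⟶ T) (x : T ⟶ D) (b : T' ⟶ branchObj F) (y : T' ⟶ N)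
      (hy : k ≫ x = y ≫ pullback.fst _ _) (hb : y ≫ pullback.snd _ _ = b)
      (h : (k ≫ x) ≫ polyLabel _ dt = b ≫ branchMap F) :
      y ≫ (polyFam dt).app _ _ hN = (polyFam dt).app (k ≫ x) b h :=
    ((polyFam dt).nat y _ _ hN).trans ((polyFam dt).app_congr hy.symm hb _)
  let t : Fam (branchMap F) ((m ≫ dj ≫ K.tagLabel) ≫ tagElt X) U.a.left :=
    ((polyFam dt).pull m).cast (by
      rw [← hD, Category.assoc, Category.assoc, tagLabel_elt])
  have ht {T : E} (k : T ⟶ M) (b : T ⟶ branchObj F)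
      (h : k ≫ (m ≫ dj ≫ K.tagLabel) ≫ tagElt X = b ≫ branchMap F) :
      t.app k b h ≫ U.a.hom = k ≫ (m ≫ dj ≫ K.tagLabel) ≫ tagCod X := by
    have hb : (k ≫ m) ≫ polyLabel _ dt = b ≫ branchMap F :=
      hDk (by rw [← h]; simp only [Category.assoc])
    have := (H m).2 ⟨𝟙 M, Category.id_comp m⟩ k (pullback.lift (k ≫ m) b hb) (by simp)
    rw [← Category.assoc, hval k m b _ (by simp) (by simp) hb, pullback.lift_fst_assoc] at this
    refine Eq.trans this ?_
    simp only [Category.assoc]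
  obtain ⟨G, g, hg, hch, hsup⟩ := exists_partial_recursion hS hW hφ K.tagged K.tagged_wellFounded
    (m ≫ dj) (m ≫ dt) (sliceSup U (m ≫ dj ≫ K.tagLabel) t ht)
    (by rw [Category.assoc, hD, comp_polyLabel]) fun x y h₁ h₂ =>
      (cancel_mono m).1 (pullback.hom_ext (by simpa using h₁) (by simpa using h₂))
  let ζ : G ⟶ U.a.left := g ≫ sliceSup U (m ≫ dj ≫ K.tagLabel) t ht
  have hζ {T : E} (y : T ⟶ G) : y ≫ ζ ≫ U.a.hom = (y ≫ g ≫ m ≫ dj) ≫ K.tagLabel ≫ tagCod X := by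
    rw [Category.assoc g, sliceSup_hom]
    simp only [Category.assoc]
  have hchild {T : E} (j : T ⟶ J) (b : T ⟶ branchObj F) (h : j ≫ K.tagged.label = b ≫ branchMap F) :
      K.tagged.child j b h ≫ K.tagLabel ≫ tagCod X = j ≫ K.tagLabel ≫ tagCod X := by
    rw [tagLabel_cod]; exact K.tagged_child_fst j b h
  have key : ∀ ⦃T : E⦄ (j : T ⟶ J), ∃ y : T ⟶ G, y ≫ g ≫ m ≫ dj = j := by
    refine K.tagged_wellFounded _ ⟨G, g ≫ m ≫ dj, hg, trivial, fun _ _ => Iff.rfl⟩ fun T j ih => ?_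
    choose c hc using @ih
    let s : Fam (branchMap F) (j ≫ K.tagged.label) U.a.left :=
      { app := fun k b h => c k b ((Category.assoc _ _ _).trans h) ≫ ζ
        nat := fun l k b h => by
          refine (Category.assoc _ _ _).symm.trans
            (congrArg (· ≫ ζ) ((cancel_mono (g ≫ m ≫ dj)).1 ?_))
          rw [Category.assoc, hc, hc, K.tagged.nat]
          exact K.tagged.child_congr (Category.assoc _ _ _).symm rfl _ }
    let x : T ⟶ D := pullback.lift j (polyOf (branchMap F) s) (by
      rw [comp_polyLab, polyLabel_polyOf])
    have hx₁ : x ≫ dj = j := pullback.lift_fst _ _ _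
    have hx₂ : x ≫ dt = polyOf (branchMap F) s := pullback.lift_snd _ _ _
    have hs {T' : E} (k : T' ⟶ T) (b : T' ⟶ branchObj F)
        (h : polyLabel _ (k ≫ x ≫ dt) = b ≫ branchMap F)
        (h' : (k ≫ j) ≫ K.tagged.label = b ≫ branchMap F) :
        polyApp _ (k ≫ x ≫ dt) b h = c k b h' ≫ ζ :=
      (polyApp_congr ((congrArg (k ≫ ·) hx₂).trans (comp_polyOf _ _)) rfl h).trans
        ((polyApp_polyOf _ _ _).trans (s.app_congr (Category.id_comp _) rfl
          ((Category.assoc _ _ _).symm.trans (by rw [Category.id_comp, h']))))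
    obtain ⟨d, hd⟩ := (H x).1 fun T' k y hy => by
      have h₀ : (k ≫ j) ≫ K.tagged.label = (y ≫ pullback.snd _ _) ≫ branchMap F := by
        rw [Category.assoc y, ← hN, ← Category.assoc y, ← hy, ← hD, ← hx₁]
        simp only [Category.assoc]
      have h₁ : (k ≫ x) ≫ polyLabel _ dt = (y ≫ pullback.snd _ _) ≫ branchMap F := by
        rw [hy, Category.assoc, hN, Category.assoc]
      have h₂ : (polyFam dt).app (k ≫ x) (y ≫ pullback.snd _ _) h₁ = c k _ h₀ ≫ ζ :=
        (polyApp_congr (Category.assoc _ _ _) rfl ((comp_polyLabel _ _ _).trans h₁)).trans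
          (hs k _ ((congrArg (polyLabel _) (Category.assoc _ _ _).symm).trans
            ((comp_polyLabel _ _ _).trans h₁)) h₀)
      refine (Category.assoc _ _ _).symm.trans
        ((congrArg (· ≫ U.a.hom) ((hval k x _ y hy rfl h₁).trans h₂)).trans ?_)
      refine (Category.assoc _ _ _).trans ((hζ _).trans ?_)
      rw [hc, hchild, ← Category.assoc y, ← hy, Category.assoc k x, ← Category.assoc x, hx₁,
        Category.assoc]
    have hd₁ : d ≫ m ≫ dj = j := by rw [← Category.assoc, hd, hx₁]
    have hd₂ : d ≫ m ≫ dt = x ≫ dt := by rw [← Category.assoc, hd]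
    obtain ⟨y, hy⟩ := hsup d fun {T'} k b h h' => by
      have h₀ : (k ≫ j) ≫ K.tagged.label = b ≫ branchMap F := by rw [← hd₁, h]
      refine ⟨c k b h₀, (hc k b h₀).trans (K.tagged.child_congr (by rw [hd₁]) rfl _), ?_⟩
      refine (hs k b (by rw [← hd₂, h']) h₀).symm.trans ?_
      exact polyApp_congr (by rw [hd₂]) rfl _
    exact ⟨y, by rw [← Category.assoc y, hy, hd₁]⟩
  obtain ⟨s, hs⟩ := key (𝟙 J)
  have hfam {T : E} (k : T ⟶ J) (b : T ⟶ branchObj F)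
      (h : k ≫ K.tagLabel ≫ tagElt X = b ≫ branchMap F)
      (h' : (k ≫ s ≫ g) ≫ (m ≫ dj ≫ K.tagLabel) ≫ tagElt X = b ≫ branchMap F) :
      (K.tagged.fam (s ≫ ζ) K.tagLabel_elt).app k b h = t.app (k ≫ s ≫ g) b h' := by
    have hk : (k ≫ s) ≫ g ≫ m ≫ dj = k := by rw [Category.assoc, hs, Category.comp_id]
    have h₁ : k ≫ K.tagged.label = b ≫ branchMap F := by rw [← h, tagLabel_elt]
    have h₂ : ((k ≫ s) ≫ g ≫ m ≫ dj) ≫ K.tagged.label = b ≫ branchMap F := by rw [hk, h₁]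
    obtain ⟨y, hy, hy'⟩ := hch (k ≫ s) b h₂ (by
      rw [← h₂, comp_polyLabel, comp_polyLabel, comp_polyLabel, ← hD]
      simp only [Category.assoc])
    have : y = K.tagged.child k b h₁ ≫ s := by
      refine (cancel_mono (g ≫ m ≫ dj)).1
        (hy.trans ((K.tagged.child_congr hk rfl h₂).trans (Eq.symm ?_)))
      rw [Category.assoc, hs, Category.comp_id]
    refine (Category.assoc _ _ _).symm.trans ((congrArg (· ≫ ζ) this.symm).trans (hy'.trans ?_))
    exact polyApp_congr (by simp only [Category.assoc]) rfl _
  have hlab : (s ≫ g) ≫ m ≫ dj ≫ K.tagLabel = K.tagLabel := by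
    simpa using congrArg (· ≫ K.tagLabel) hs
  have ht' {T : E} (k : T ⟶ J) (b : T ⟶ branchObj F)
      (h : k ≫ K.tagLabel ≫ tagElt X = b ≫ branchMap F) :
      (K.tagged.fam (s ≫ ζ) K.tagLabel_elt).app k b h ≫ U.a.hom = k ≫ K.tagLabel ≫ tagCod X := by
    have h' : (k ≫ s ≫ g) ≫ (m ≫ dj ≫ K.tagLabel) ≫ tagElt X = b ≫ branchMap F := by
      have : (k ≫ s ≫ g) ≫ (m ≫ dj ≫ K.tagLabel) ≫ tagElt X =
          k ≫ ((s ≫ g) ≫ m ≫ dj ≫ K.tagLabel) ≫ tagElt X := by simp only [Category.assoc]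
      rw [this, hlab, h]
    have : (k ≫ s ≫ g) ≫ (m ≫ dj ≫ K.tagLabel) ≫ tagCod X =
        k ≫ ((s ≫ g) ≫ m ≫ dj ≫ K.tagLabel) ≫ tagCod X := by simp only [Category.assoc]
    rw [hfam k b h h', ht, this, hlab]
  refine ⟨s ≫ ζ, ht', ?_⟩
  refine (Category.assoc _ _ _).symm.trans ((comp_sliceSup U (s ≫ g) _ t ht).trans
    (sliceSup_congr U hlab _ ht' fun k b h h' => ?_))
  exact (hfam k b h' (by rw [← h]; simp only [Category.assoc])).symm

end HNTrees

end Smallness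

/-! ### Smallness of the presheaf of hereditarily natural trees -/

namespace HNTrees

variable {E : Type u} [Category.{v} E] [PositiveHeytingCategory E] {C : InternalCategory E}
  {Y X : InternalPresheaf C} {F : Y ⟶ X} [IsExponentiableMap (branchMap F)]
  {V : Endofunctor.Algebra (polynomialFunctor (branchMap F))} {hV : IsInitial V} (K : HNTrees hV)

/-- Tagged trees embed into the W-type of the branching type with labels `(f, x)`, by a map over
`C₀` from which both the tag and the tree can be recovered, again by recursion. -/
lemma exists_tagged_embedding {S : MorphismProperty E} (hS : S.IsStableUnderBaseChange)
    (hW : AxiomWE S) (hφ : S (branchMap F))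
    [IsExponentiableMap (sliceMap (branchMap F) (tagCod X) (tagElt X))]
    {U : Endofunctor.Algebra
      (polynomialFunctor (sliceMap (branchMap F) (tagCod X) (tagElt X)))} (hU : IsInitial U) :
    ∃ (σ : pullback C.dom K.presheaf.anchor ⟶ U.a.left) (r : U.a.left ⟶ C.C₁ ⨯ V.a),
      σ ≫ U.a.hom = pullback.fst _ _ ≫ C.cod ∧
        σ ≫ r = prod.lift (pullback.fst _ _) (pullback.snd _ _ ≫ K.j) := by
  obtain ⟨σ, ht, hσ⟩ := K.exists_tagged_recursion hS hW hφ U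
  obtain ⟨r, hr⟩ := exists_slice_recursion hU (Z := V.a) (fun _ t => wSup V t)
    fun l a t => (comp_wSup V l t).trans
      (wSup_congr V (Category.assoc _ _ _).symm fun _ _ _ _ => rfl)
  obtain ⟨s, hs⟩ := exists_slice_recursion hU (Z := C.C₁)
    (fun a _ => a ≫ pullback.fst C.dom X.anchor) fun l a t => (Category.assoc _ _ _).symm
  have hσr : ∀ ⦃T : E⦄ (j : T ⟶ pullback C.dom K.presheaf.anchor),
      j ≫ σ ≫ r = j ≫ pullback.snd _ _ ≫ K.j := by
    refine K.tagged_wellFounded _ (Definable.eq AdmitsLogic.top _ _) fun T j ih => ?_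
    have h₁ : σ ≫ r = wSup V ((K.tagged.fam σ K.tagLabel_elt).map r) :=
      (congrArg (· ≫ r) hσ).trans (hr _ _ ht)
    refine (congrArg (j ≫ ·) h₁).trans ((comp_wSup V j _).trans
      (Eq.trans ?_ (wSup_wFam hV (j ≫ pullback.snd _ _ ≫ K.j))))
    refine wSup_congr V ?_ fun k b h h' => ?_
    · exact (congrArg (j ≫ ·) K.tagLabel_elt).trans ((congrArg (j ≫ ·)
        (Category.assoc _ _ _).symm).trans (Category.assoc _ _ _).symm)
    · have h₂ : (k ≫ j) ≫ K.tagged.label = b ≫ branchMap F := by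
        rw [← h, ← K.tagLabel_elt, Category.assoc]
      refine (Category.assoc _ _ _).trans ((ih k b h₂).trans ?_)
      refine (Category.assoc _ _ _).symm.trans
        ((congrArg (· ≫ K.j) (K.tagged_child_snd _ _ h₂)).trans ((K.child_j _ _ _).trans ?_))
      exact wChild_congr hV ((Category.assoc _ _ _).trans (Category.assoc _ _ _)) rfl _
  refine ⟨σ, prod.lift s r, ?_, ?_⟩
  · rw [← K.tagLabel_cod]
    exact (congrArg (· ≫ U.a.hom) hσ).trans (sliceSup_hom U _ _ ht)
  · refine Limits.prod.hom_ext ?_ ?_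
    · refine (Category.assoc _ _ _).trans ((congrArg (σ ≫ ·) (prod.lift_fst _ _)).trans
        (Eq.trans ?_ (prod.lift_fst _ _).symm))
      exact (congrArg (· ≫ s) hσ).trans ((hs _ _ ht).trans (pullback.lift_fst _ _ _))
    · refine (Category.assoc _ _ _).trans ((congrArg (σ ≫ ·) (prod.lift_snd _ _)).trans
        (Eq.trans ?_ (prod.lift_snd _ _).symm))
      exact (Category.id_comp _).symm.trans ((hσr (𝟙 _)).trans (Category.id_comp _))

/-- If `X` is small over `C₀`, then so is the presheaf of hereditarily natural trees. -/
theorem presheaf_anchor_mem {S : MorphismProperty E} (hS : IsPredicativeCategoryWithSmallMaps S)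
    (hWS : AxiomWS S) (hcod : S C.cod) (hφ : S (branchMap F)) (hX : S X.anchor) :
    S K.presheaf.anchor := by
  have hS' := hS.admitsLogic
  have hb := hS.pullback_stable
  obtain ⟨_, U, ⟨hU⟩, hUa⟩ := hWS C.C₀ (sliceMap (branchMap F) (tagCod X) (tagElt X))
    (hb.of_isPullback (IsPullback.of_hasPullback (tagElt X) (branchMap F)).flip hφ)
    ((sliceSmall_terminal_iff _).2 (hS.composition _ _
      (hb.of_isPullback (IsPullback.of_hasPullback C.dom X.anchor).flip hX) hcod))
  obtain ⟨σ, r, hσ, hr⟩ := K.exists_tagged_embedding hb hS.wTypes hφ hU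
  have hj := K.j_mem hS hcod hφ
  have := K.mono
  let i : pullback C.dom K.presheaf.anchor ⟶ C.C₁ ⨯ V.a :=
    prod.lift (pullback.fst _ _) (pullback.snd _ _ ≫ K.j)
  have hi₁ : i ≫ prod.fst = pullback.fst _ _ := prod.lift_fst _ _
  have hi₂ : i ≫ prod.snd = pullback.snd _ _ ≫ K.j := prod.lift_snd _ _
  -- `i` is a small mono: membership in it is a conjunction of `K.j` and an equality
  have : Mono i := ⟨fun x y h => pullback.hom_ext (by
      simpa [i] using congrArg (· ≫ prod.fst) h) ((cancel_mono K.j).1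
      (((Category.assoc _ _ _).trans ((congrArg (x ≫ ·) hi₂).symm.trans
      ((Category.assoc _ _ _).symm.trans ((congrArg (· ≫ prod.snd) h).trans
        ((Category.assoc _ _ _).trans (congrArg (y ≫ ·) hi₂)))))).trans
        (Category.assoc _ _ _).symm))⟩
  have hKj : Definable S (fun ⦃T : E⦄ (v : T ⟶ V.a) => ∃ l, l ≫ K.j = v) :=
    ⟨_, K.j, K.mono, hj, fun _ _ => Iff.rfl⟩
  have hi : S i := by
    refine Definable.mem hb (((hKj.comap hS' prod.snd).and hS'
      (Definable.eq hS' (prod.fst ≫ C.dom) (prod.snd ≫ (treeOp hV).anchor))).congr fun T x => ?_)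
    constructor
    · rintro ⟨⟨w, hw⟩, hx⟩
      refine ⟨pullback.lift (x ≫ prod.fst) w ?_, Limits.prod.hom_ext ?_ ?_⟩
      · rw [K.presheaf_anchor, Category.assoc, hx, ← Category.assoc, ← hw]
        exact Category.assoc _ _ _
      · exact (Category.assoc _ _ _).trans
          ((congrArg (_ ≫ ·) hi₁).trans (pullback.lift_fst _ _ _))
      · refine (Category.assoc _ _ _).trans ((congrArg (_ ≫ ·) hi₂).trans ?_)
        exact (pullback.lift_snd_assoc _ _ _ _).trans hw
    · rintro ⟨l, rfl⟩
      refine ⟨⟨l ≫ pullback.snd _ _, ?_⟩, ?_⟩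
      · rw [Category.assoc l i, hi₂]
        exact Category.assoc _ _ _
      · simp only [Category.assoc]
        refine congrArg (l ≫ ·) ?_
        refine ((Category.assoc _ _ _).symm.trans (congrArg (· ≫ C.dom) hi₁)).trans
          (pullback.condition.trans (Eq.symm ?_))
        exact ((Category.assoc _ _ _).symm.trans (congrArg (· ≫ (treeOp hV).anchor) hi₂)).trans
          (Category.assoc _ _ _)
  have hfst : S (pullback.fst C.dom K.presheaf.anchor ≫ C.cod) := by
    rw [← hσ]
    exact hS.composition _ _ (hS'.of_comp σ r (hr ▸ hi)) ((sliceSmall_terminal_iff _).1 hUa)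
  -- a tree with root `a` is tagged by the identity of `a`
  let e : K.presheaf.obj ⟶ pullback C.dom K.presheaf.anchor :=
    pullback.lift (K.presheaf.anchor ≫ C.one) (𝟙 _) (by
      rw [Category.assoc, C.one_dom, Category.comp_id, Category.id_comp])
  have he : S e := hS'.of_comp e (pullback.snd _ _) (by
    rw [pullback.lift_snd]; exact hS.id _)
  have : K.presheaf.anchor = e ≫ pullback.fst _ _ ≫ C.cod := by
    rw [pullback.lift_fst_assoc, Category.assoc, C.one_cod, Category.comp_id]
  rw [this]
  exact hS.composition _ _ he hfst

end HNTrees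

/-! ### Transport of W-types along equivalences -/

section Transport

universe v₁ v₂ v₃ v₄ u₁ u₂ u₃ u₄

/-- Right adjoints of functors that agree up to equivalences agree up to the same equivalences. -/
def rightAdjointIso {A : Type u₁} [Category.{v₁} A] {B : Type u₂} [Category.{v₂} B] {A' : Type u₃}
    [Category.{v₃} A'] {B' : Type u₄} [Category.{v₄} B'] {L : A ⥤ B} {R : B ⥤ A} {L' : A' ⥤ B'}
    {R' : B' ⥤ A'} (h : L ⊣ R) (h' : L' ⊣ R') (eA : A ≌ A') (eB : B ≌ B')
    (α : L ⋙ eB.functor ≅ eA.functor ⋙ L') : R ⋙ eA.functor ≅ eB.functor ⋙ R' :=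
  conjugateIsoEquiv (eA.symm.toAdjunction.comp h) (h'.comp eB.symm.toAdjunction)
    (calc L' ⋙ eB.inverse
      _ ≅ (eA.inverse ⋙ eA.functor) ⋙ L' ⋙ eB.inverse :=
        (Functor.leftUnitor _).symm ≪≫ Functor.isoWhiskerRight eA.counitIso.symm _
      _ ≅ eA.inverse ⋙ (L ⋙ eB.functor) ⋙ eB.inverse :=
        Functor.isoWhiskerLeft eA.inverse (Functor.isoWhiskerRight α.symm eB.inverse)
      _ ≅ eA.inverse ⋙ L :=
        Functor.isoWhiskerLeft (eA.inverse ⋙ L) eB.unitIso.symm ≪≫ Functor.rightUnitor _)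

/-- Initial algebras may be transported along an equivalence of categories. -/
lemma exists_isInitial_algebra_of_equivalence {A : Type u₁} [Category.{v₁} A] {A' : Type u₂}
    [Category.{v₂} A'] (e : A ≌ A') {P : A ⥤ A} {P' : A' ⥤ A'}
    (α : P ⋙ e.functor ≅ e.functor ⋙ P') {W' : Endofunctor.Algebra P'} (hW' : IsInitial W') :
    ∃ W : Endofunctor.Algebra P, Nonempty (IsInitial W) ∧
      Nonempty (e.functor.obj W.a ≅ W'.a) := by
  -- `Φ` sends a `P`-algebra to a `P'`-algebra; `W` is chosen with `Φ W` isomorphic to `W'`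
  let Φ (Z : Endofunctor.Algebra P) : Endofunctor.Algebra P' :=
    ⟨e.functor.obj Z.a, α.inv.app Z.a ≫ e.functor.map Z.str⟩
  let i : e.functor.obj (e.inverse.obj W'.a) ≅ W'.a := e.counitIso.app W'.a
  let W : Endofunctor.Algebra P :=
    ⟨e.inverse.obj W'.a, e.functor.preimage (α.hom.app _ ≫ P'.map i.hom ≫ W'.str ≫ i.inv)⟩
  have hstr : α.inv.app W.a ≫ e.functor.map W.str = P'.map i.hom ≫ W'.str ≫ i.inv := by
    rw [Functor.map_preimage, Iso.inv_hom_id_app_assoc]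
  let j : W' ⟶ Φ W :=
    { f := i.inv
      h := by
        refine (congrArg (P'.map i.inv ≫ ·) hstr).trans ?_
        rw [← P'.map_comp_assoc, i.inv_hom_id, P'.map_id, Category.id_comp] }
  let j' : Φ W ⟶ W' :=
    { f := i.hom
      h := by
        refine Eq.symm ((congrArg (· ≫ i.hom) hstr).trans ?_)
        simp only [Category.assoc, i.inv_hom_id, Category.comp_id] }
  have hΦ : IsInitial (Φ W) := hW'.ofIso ⟨j, j', by ext; exact i.inv_hom_id, by
    ext; exact i.hom_inv_id⟩
  refine ⟨W, ⟨IsInitial.ofUniqueHom (fun Z =>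
    { f := e.functor.preimage (hΦ.to (Φ Z)).f
      h := ?_ }) fun Z m => ?_⟩, ⟨i⟩⟩
  · apply e.functor.map_injective
    have h := (hΦ.to (Φ Z)).h
    have h' : P'.map (hΦ.to (Φ Z)).f ≫ α.inv.app Z.a ≫ e.functor.map Z.str =
      α.inv.app W.a ≫ e.functor.map W.str ≫ (hΦ.to (Φ Z)).f := h.trans (Category.assoc _ _ _)
    have hn := α.inv.naturality (e.functor.preimage (hΦ.to (Φ Z)).f)
    simp only [Functor.comp_map, Functor.map_preimage] at hn
    rw [Functor.map_comp, Functor.map_comp, e.functor.map_preimage (hΦ.to (Φ Z)).f,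
      ← cancel_epi (α.inv.app W.a), ← h', ← Category.assoc, ← hn, Category.assoc]
  · ext
    apply e.functor.map_injective
    rw [Functor.map_preimage]
    let m' : Φ W ⟶ Φ Z :=
      { f := e.functor.map m.f
        h := by
          have hn := α.inv.naturality m.f
          simp only [Functor.comp_map] at hn
          refine (Category.assoc _ _ _).symm.trans ((congrArg (· ≫ e.functor.map Z.str) hn).trans
            ((Category.assoc _ _ _).trans (Eq.trans ?_ (Category.assoc _ _ _).symm)))
          rw [← Functor.map_comp, ← Functor.map_comp, m.h] }
    exact congrArg Endofunctor.Algebra.Hom.f (hΦ.hom_ext m' (hΦ.to (Φ Z)))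

variable {D : Type u₁} [Category.{v₁} D] [HasFiniteLimits D] {D' : Type u₂} [Category.{v₂} D']
  [HasFiniteLimits D'] (e : D ≌ D') {B A : D} (f : B ⟶ A)

/-- Equivalences commute with pulling back. -/
def pullbackPostIso : Over.pullback f ⋙ (Over.postEquiv B e).functor ≅
    (Over.postEquiv A e).functor ⋙ Over.pullback (e.functor.map f) :=
  rightAdjointIso (Over.mapPullbackAdj f) (Over.mapPullbackAdj (e.functor.map f))
    (Over.postEquiv B e) (Over.postEquiv A e)
    (NatIso.ofComponents (fun X => Over.isoMk (Iso.refl _) ((Category.id_comp _).trans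
      (e.functor.map_comp _ _).symm)) fun g => by
        ext; exact (Category.comp_id _).trans (Category.id_comp _).symm)

lemma IsExponentiableMap.of_equivalence [IsExponentiableMap (e.functor.map f)] :
    IsExponentiableMap f :=
  Functor.isLeftAdjoint_of_iso (F := ((Over.postEquiv A e).functor ⋙
      Over.pullback (e.functor.map f)) ⋙ (Over.postEquiv B e).inverse)
    (Functor.isoWhiskerRight (pullbackPostIso e f).symm _ ≪≫
      Functor.isoWhiskerLeft (Over.pullback f) (Over.postEquiv B e).unitIso.symm ≪≫
      Functor.rightUnitor _)

/-- Equivalences commute with polynomial functors. -/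
def polynomialFunctorIso [IsExponentiableMap f] [IsExponentiableMap (e.functor.map f)] :
    polynomialFunctor f ⋙ e.functor ≅ e.functor ⋙ polynomialFunctor (e.functor.map f) :=
  calc polynomialFunctor f ⋙ e.functor
    _ ≅ Over.star B ⋙ ((Over.pullback f).rightAdjoint ⋙ (Over.postEquiv A e).functor) ⋙
        Over.forget _ := Iso.refl _
    _ ≅ (Over.star B ⋙ (Over.postEquiv B e).functor) ⋙
        (Over.pullback (e.functor.map f)).rightAdjoint ⋙ Over.forget _ :=
      Functor.isoWhiskerLeft (Over.star B) (Functor.isoWhiskerRight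
        (rightAdjointIso (Adjunction.ofIsLeftAdjoint _) (Adjunction.ofIsLeftAdjoint _)
          (Over.postEquiv A e) (Over.postEquiv B e) (pullbackPostIso e f)) (Over.forget _))
    _ ≅ (e.functor ⋙ Over.star _) ⋙
        (Over.pullback (e.functor.map f)).rightAdjoint ⋙ Over.forget _ :=
      Functor.isoWhiskerRight (rightAdjointIso (Over.forgetAdjStar B) (Over.forgetAdjStar _)
        (Over.postEquiv B e) e (Iso.refl _)) _

/-- The W-type of a map may be obtained from that of its image under an equivalence. -/
theorem exists_wType_of_equivalence [IsExponentiableMap (e.functor.map f)]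
    {W' : Endofunctor.Algebra (polynomialFunctor (e.functor.map f))} (hW' : IsInitial W') :
    ∃ _ : IsExponentiableMap f, ∃ W : Endofunctor.Algebra (polynomialFunctor f),
      Nonempty (IsInitial W) ∧ Nonempty (e.functor.obj W.a ≅ W'.a) :=
  have := IsExponentiableMap.of_equivalence e f
  ⟨this, exists_isInitial_algebra_of_equivalence e (polynomialFunctorIso e f) hW'⟩

end Transport

/-! ### The category of elements of an internal presheaf -/

section Elements

variable {E : Type u} [Category.{v} E] [HasFiniteLimits E] {C : InternalCategory E}

namespace InternalPresheaf

variable (I : InternalPresheaf C)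

/-- The arrow of `C` underlying an arrow of the category of elements of `I`. -/
abbrev elementsArrow : pullback I.anchor C.cod ⟶ C.C₁ := pullback.snd I.anchor C.cod

variable {I} in
lemma elementsArrow_dom {T : E} {f g : T ⟶ pullback I.anchor C.cod}
    (h : f ≫ I.act = g ≫ pullback.fst I.anchor C.cod) :
    (f ≫ I.elementsArrow) ≫ C.dom = (g ≫ I.elementsArrow) ≫ C.cod := by
  rw [Category.assoc, ← I.act_anchor, ← Category.assoc, h, Category.assoc, pullback.condition,
    Category.assoc]

/-- Composition in the category of elements of `I`. -/
def elementsComp : pullback I.act (pullback.fst I.anchor C.cod) ⟶ pullback I.anchor C.cod :=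
  pullback.lift (pullback.fst _ _ ≫ pullback.fst _ _)
    (C.compose (pullback.fst _ _ ≫ I.elementsArrow) (pullback.snd _ _ ≫ I.elementsArrow)
      (elementsArrow_dom pullback.condition))
    (by rw [C.compose_cod, Category.assoc, pullback.condition, Category.assoc])

variable {I} in
lemma lift_elementsComp_arrow {T : E} {f g : T ⟶ pullback I.anchor C.cod}
    (h : f ≫ I.act = g ≫ pullback.fst I.anchor C.cod) :
    (pullback.lift f g h ≫ I.elementsComp) ≫ I.elementsArrow =
      C.compose (f ≫ I.elementsArrow) (g ≫ I.elementsArrow) (elementsArrow_dom h) := by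
  refine (Category.assoc _ _ _).trans ((congrArg _ (pullback.lift_snd _ _ _)).trans ?_)
  rw [C.comp_compose]
  exact C.compose_congr (by simp) (by simp) _

variable {I} in
lemma lift_elementsComp_cod {T : E} {f g : T ⟶ pullback I.anchor C.cod}
    (h : f ≫ I.act = g ≫ pullback.fst I.anchor C.cod) :
    (pullback.lift f g h ≫ I.elementsComp) ≫ pullback.fst _ _ = f ≫ pullback.fst _ _ := by
  refine (Category.assoc _ _ _).trans ((congrArg _ (pullback.lift_fst _ _ _)).trans ?_)
  rw [← Category.assoc, pullback.lift_fst]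

variable {I} in
lemma lift_elementsComp_act {T : E} {f g : T ⟶ pullback I.anchor C.cod}
    (h : f ≫ I.act = g ≫ pullback.fst I.anchor C.cod) :
    (pullback.lift f g h ≫ I.elementsComp) ≫ I.act = g ≫ I.act := by
  have h₁ : (f ≫ pullback.fst I.anchor C.cod) ≫ I.anchor = (f ≫ I.elementsArrow) ≫ C.cod := by
    rw [Category.assoc, pullback.condition, Category.assoc]
  have h₂ : pullback.lift f g h ≫ I.elementsComp = pullback.lift (f ≫ pullback.fst _ _)
      (C.compose (f ≫ I.elementsArrow) (g ≫ I.elementsArrow) (elementsArrow_dom h))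
      (h₁.trans (C.compose_cod _ _ _).symm) :=
    pullback.hom_ext ((lift_elementsComp_cod h).trans (pullback.lift_fst _ _ _).symm)
      ((lift_elementsComp_arrow h).trans (pullback.lift_snd _ _ _).symm)
  rw [h₂]
  refine (I.act_comp _ _ _ h₁ (elementsArrow_dom h)).symm.trans (congrArg (· ≫ I.act) ?_)
  refine pullback.hom_ext ?_ (pullback.lift_snd _ _ _)
  rw [pullback.lift_fst, ← h]
  exact congrArg (· ≫ I.act) (pullback.hom_ext (by simp) (by simp))

/-- The category of elements of a presheaf `I`: an arrow with codomain `x ∈ I(a)` is an arrow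
`f : b ⟶ a`, and its domain is `x · f`. -/
def elements : InternalCategory E where
  C₀ := I.obj
  C₁ := pullback I.anchor C.cod
  dom := I.act
  cod := pullback.fst I.anchor C.cod
  one := pullback.lift (𝟙 _) (I.anchor ≫ C.one) (by simp [C.one_cod])
  comp := I.elementsComp
  one_dom := by simpa using I.act_one (𝟙 I.obj)
  one_cod := pullback.lift_fst _ _ _
  comp_dom := by
    have h := pullback.condition (f := I.act) (g := pullback.fst I.anchor C.cod)
    have e : pullback.lift _ _ h = 𝟙 _ := pullback.hom_ext (by simp) (by simp)
    simpa [e] using lift_elementsComp_act h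
  comp_cod := pullback.lift_fst _ _ _
  one_comp f := by
    refine pullback.hom_ext ((lift_elementsComp_cod _).trans (by simp))
      ((lift_elementsComp_arrow _).trans ?_)
    exact C.one_compose _ _ (by simp [pullback.condition_assoc]) |>.trans (by simp)
  comp_one f := by
    refine pullback.hom_ext (lift_elementsComp_cod _) ((lift_elementsComp_arrow _).trans ?_)
    exact C.compose_one _ _ (by
      have := I.act_anchor
      simp [reassoc_of% this])
  assoc f g h hfg hgh := by
    refine pullback.hom_ext ?_ ?_
    · refine (lift_elementsComp_cod _).trans ((lift_elementsComp_cod _).trans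
        (lift_elementsComp_cod _).symm)
    · refine (lift_elementsComp_arrow _).trans (Eq.trans ?_ (lift_elementsComp_arrow _).symm)
      refine (C.compose_congr (lift_elementsComp_arrow hfg) rfl _).trans
        ((C.compose_assoc _ _ _ (elementsArrow_dom hfg) (elementsArrow_dom hgh)).trans ?_)
      exact (C.compose_congr rfl (lift_elementsComp_arrow hgh) _).symm

variable {I} {J : InternalPresheaf C} (p : J ⟶ I)

/-- A presheaf over `I` is a presheaf on the category of elements of `I`. -/
def overOp : RestrOp I.elements J.obj where
  anchor := p.hom
  op x e h := J.restr x (e ≫ I.elementsArrow) (by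
    rw [← p.anchor]
    refine (Category.assoc _ _ _).symm.trans ((congrArg (· ≫ I.anchor) h).trans ?_)
    exact (Category.assoc _ _ _).trans ((congrArg (e ≫ ·) pullback.condition).trans
      (Category.assoc _ _ _).symm))
  nat l x e h := (J.comp_restr _ _ _ _).trans
    (J.restr_congr rfl (Category.assoc _ _ _).symm _)
  op_anchor x e h := by
    refine (p.restr _ _ _).trans (congrArg (· ≫ I.act) ?_)
    exact pullback.hom_ext ((pullback.lift_fst _ _ _).trans h) (pullback.lift_snd _ _ _)
  op_one x := J.restr_one x _ (by
    have h : I.elements.one ≫ I.elementsArrow = I.anchor ≫ C.one := pullback.lift_snd _ _ _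
    refine (Category.assoc _ _ _).trans (congrArg (x ≫ ·) ((Category.assoc _ _ _).trans ?_))
    exact (congrArg (p.hom ≫ ·) h).trans ((Category.assoc _ _ _).symm.trans
      (congrArg (· ≫ C.one) p.anchor)))
  op_op x e e' h h' := (J.restr_restr _ _ _ _ (elementsArrow_dom h')).trans
    (J.restr_congr rfl (lift_elementsComp_arrow h').symm _)

lemma overOp_restr {T : E} (x : T ⟶ J.obj) (f : T ⟶ C.C₁) (h : x ≫ J.anchor = f ≫ C.cod)
    (h' : (x ≫ p.hom) ≫ I.anchor = f ≫ C.cod) :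
    (overOp p).toPresheaf.restr x (pullback.lift (x ≫ p.hom) f h')
      (pullback.lift_fst _ _ _).symm = J.restr x f h :=
  ((overOp p).toPresheaf_restr _ _ _).trans (J.restr_congr rfl (pullback.lift_snd _ _ _) _)

variable (I) in
/-- The functor from presheaves over `I` to presheaves on the category of elements of `I`. -/
def overFunctor : Over I ⥤ InternalPresheaf I.elements where
  obj X := (overOp X.hom).toPresheaf
  map {X X'} g :=
    { hom := g.left.hom
      anchor := congrArg Hom.hom (Over.w g)
      restr x e h := by
        refine (congrArg (· ≫ _) ((overOp X.hom).toPresheaf_restr x e h)).trans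
          (Eq.trans ?_ ((overOp X'.hom).toPresheaf_restr _ e _).symm)
        exact g.left.restr _ _ _ }

instance : (overFunctor I).Faithful where
  map_injective {X X' g g'} h := by
    have h' : Hom.hom ((overFunctor I).map g) = Hom.hom ((overFunctor I).map g') := by rw [h]
    exact Over.OverMorphism.ext (hom_ext h')

instance : (overFunctor I).Full where
  map_surjective {X X'} g := by
    have hg : g.hom ≫ X'.hom.hom = X.hom.hom := g.anchor
    refine ⟨Over.homMk ⟨g.hom, ?_, fun x f h => ?_⟩ (hom_ext hg), rfl⟩
    · rw [← X'.hom.anchor, ← X.hom.anchor, ← hg]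
      exact (Category.assoc _ _ _).symm
    · have h' : (x ≫ X.hom.hom) ≫ I.anchor = f ≫ C.cod := by
        rw [← h, ← X.hom.anchor]; exact Category.assoc _ _ _
      have h'' : ((x ≫ g.hom) ≫ X'.hom.hom) ≫ I.anchor = f ≫ C.cod :=
        (congrArg (· ≫ I.anchor) ((Category.assoc _ _ _).trans (congrArg (x ≫ ·) hg))).trans h'
      refine (congrArg (· ≫ g.hom) (overOp_restr X.hom x f h h')).symm.trans
        ((g.restr x _ (pullback.lift_fst _ _ _).symm).trans
          (Eq.trans ?_ (overOp_restr X'.hom (x ≫ g.hom) f ?_ h'')))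
      · exact ((overOp X'.hom).toPresheaf).restr_congr rfl (pullback.hom_ext
          ((pullback.lift_fst _ _ _).trans (Eq.trans (((Category.assoc _ _ _).trans
            (congrArg (x ≫ ·) hg)).symm) (pullback.lift_fst _ _ _).symm))
          ((pullback.lift_snd _ _ _).trans (pullback.lift_snd _ _ _).symm)) _
      · rw [← X'.hom.anchor]
        exact (Category.assoc _ _ _).symm.trans h''

/-- A presheaf on the category of elements of `I`, as a presheaf on `C`. -/
def elementsOp (P : InternalPresheaf I.elements) : RestrOp C P.obj where
  anchor := P.anchor ≫ I.anchor
  op x f h := P.restr x (pullback.lift (x ≫ P.anchor) f ((Category.assoc _ _ _).trans h))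
    (pullback.lift_fst _ _ _).symm
  nat l x f h := (P.comp_restr _ _ _ _).trans (P.restr_congr rfl (pullback.hom_ext
    ((Category.assoc _ _ _).trans ((congrArg (l ≫ ·) (pullback.lift_fst _ _ _)).trans
      ((Category.assoc _ _ _).symm.trans (pullback.lift_fst _ _ _).symm)))
    ((Category.assoc _ _ _).trans ((congrArg (l ≫ ·) (pullback.lift_snd _ _ _)).trans
      (pullback.lift_snd _ _ _).symm))) _)
  op_anchor x f h := by
    refine (Category.assoc _ _ _).symm.trans ((congrArg (· ≫ I.anchor)
      (P.restr_anchor _ _ _)).trans ((Category.assoc _ _ _).trans ?_))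
    exact (congrArg (_ ≫ ·) I.act_anchor).trans (pullback.lift_snd_assoc _ _ _ _)
  op_one x := P.restr_one x _ (pullback.hom_ext
    ((pullback.lift_fst _ _ _).trans (Eq.symm ((Category.assoc _ _ _).trans (congrArg (x ≫ ·)
      ((Category.assoc _ _ _).trans ((congrArg (P.anchor ≫ ·) (pullback.lift_fst _ _ _)).trans
        (Category.comp_id _)))))))
    ((pullback.lift_snd _ _ _).trans (Eq.symm ((Category.assoc _ _ _).trans (congrArg (x ≫ ·)
      ((Category.assoc _ _ _).trans ((congrArg (P.anchor ≫ ·) (pullback.lift_snd _ _ _)).trans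
        (Category.assoc _ _ _).symm)))))))
  op_op x f g h h' := by
    let e : _ ⟶ pullback I.anchor C.cod :=
      pullback.lift (x ≫ P.anchor) f ((Category.assoc _ _ _).trans h)
    have he : x ≫ P.anchor = e ≫ pullback.fst _ _ := (pullback.lift_fst _ _ _).symm
    have hx : P.restr x e he ≫ P.anchor = e ≫ I.act := P.restr_anchor x e he
    have he' : (P.restr x e he ≫ P.anchor) ≫ I.anchor = g ≫ C.cod := by
      rw [hx, ← h']
      exact (Category.assoc _ _ _).trans ((congrArg (_ ≫ ·) I.act_anchor).trans
        (pullback.lift_snd_assoc _ _ _ _))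
    have hg : e ≫ I.act = pullback.lift _ g he' ≫ pullback.fst _ _ :=
      hx.symm.trans (pullback.lift_fst _ _ _).symm
    refine (P.restr_restr x _ _ he hg).trans (P.restr_congr rfl (pullback.hom_ext ?_ ?_) _)
    · exact (lift_elementsComp_cod hg).trans ((pullback.lift_fst _ _ _).trans
        (pullback.lift_fst _ _ _).symm)
    · exact (lift_elementsComp_arrow hg).trans ((C.compose_congr (pullback.lift_snd _ _ _)
        (pullback.lift_snd _ _ _) _).trans (pullback.lift_snd _ _ _).symm)

lemma elementsOp_anchor (P : InternalPresheaf I.elements) {T : E} (x : T ⟶ P.obj)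
    (f : T ⟶ C.C₁) (h : x ≫ (elementsOp P).toPresheaf.anchor = f ≫ C.cod) :
    (elementsOp P).toPresheaf.restr x f h ≫ P.anchor = I.restr (x ≫ P.anchor) f
      ((Category.assoc _ _ _).trans h) :=
  (congrArg (· ≫ P.anchor) ((elementsOp P).toPresheaf_restr x f h)).trans (P.restr_anchor _ _ _)

/-- The projection to `I` of a presheaf on the category of elements of `I`. -/
def elementsProj (P : InternalPresheaf I.elements) : (elementsOp P).toPresheaf ⟶ I where
  hom := P.anchor
  anchor := rfl
  restr x f h := elementsOp_anchor P x f h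

lemma overOp_elementsProj_restr (P : InternalPresheaf I.elements) {T : E} (x : T ⟶ P.obj)
    (e : T ⟶ pullback I.anchor C.cod) (h : x ≫ P.anchor = e ≫ pullback.fst _ _) :
    (overOp (elementsProj P)).toPresheaf.restr x e h = P.restr x e h := by
  refine ((overOp (elementsProj P)).toPresheaf_restr _ _ _).trans
    (((elementsOp P).toPresheaf_restr _ _ _).trans (P.restr_congr rfl ?_ _))
  exact pullback.hom_ext ((pullback.lift_fst _ _ _).trans h) (pullback.lift_snd _ _ _)

instance : (overFunctor I).EssSurj where
  mem_essImage P := ⟨Over.mk (elementsProj P), ⟨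
    { hom :=
        { hom := 𝟙 P.obj
          anchor := Category.id_comp _
          restr := fun x e h => (Category.comp_id _).trans
            ((overOp_elementsProj_restr P x e h).trans
              (P.restr_congr (Category.comp_id x).symm rfl h)) }
      inv :=
        { hom := 𝟙 P.obj
          anchor := Category.id_comp _
          restr := fun x e h => (Category.comp_id _).trans
            ((overOp_elementsProj_restr P x e h).symm.trans
              ((overOp (elementsProj P)).toPresheaf.restr_congr (Category.comp_id x).symm rfl h)) }
      hom_inv_id := hom_ext (Category.comp_id _)
      inv_hom_id := hom_ext (Category.comp_id _) }⟩⟩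

variable (I) in
/-- Presheaves over `I` are presheaves on the category of elements of `I`. -/
def overEquivalence : Over I ≌ InternalPresheaf I.elements :=
  have : (overFunctor I).IsEquivalence := { }
  (overFunctor I).asEquivalence

end InternalPresheaf

end Elements

/-! ### Small W-types in slices of presheaf categories -/

section SmallWTypes

variable {E : Type u} [Category.{v} E] [PositiveHeytingCategory E] {C : InternalCategory E}

open InternalPresheaf

lemma pointwiseSmall_isStableUnderBaseChange {S : MorphismProperty E}
    (hS : S.IsStableUnderBaseChange) : (pointwiseSmall S C).IsStableUnderBaseChange :=
  ⟨fun h hg => hS.of_isPullback (isPullback_hom h) hg⟩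

/-- The W-type of a pointwise small map between presheaves that are small over `C₀`. -/
lemma exists_small_wType {S : MorphismProperty E} (hS : IsPredicativeCategoryWithSmallMaps S)
    (hWS : AxiomWS S) (hcod : S C.cod) {Y X : InternalPresheaf C} (F : Y ⟶ X)
    (hF : pointwiseSmall S C F) (hX : S X.anchor) : ∃ _ : IsExponentiableMap F,
      ∃ W : Endofunctor.Algebra (polynomialFunctor F), Nonempty (IsInitial W) ∧ S W.a.anchor := by
  have hφ : S (branchMap F) := branchMap_mem hS.pullback_stable hS.composition hcod hF
  obtain ⟨_, V, ⟨hV⟩⟩ := hS.wTypes _ hφ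
  have := isExponentiableMap_of_branchMap F
  obtain ⟨K⟩ := nonempty_hnTrees hS.pullback_stable hS.wTypes hφ hV
  obtain ⟨W, hWa, hW, -⟩ :=
    exists_wType_of_hereditarilyNaturalTrees hS.toIsClassOfSmallMaps hS.wTypes hφ hV K
  refine ⟨this, W, hW, ?_⟩
  rw [hWa]
  exact K.presheaf_anchor_mem hS hWS hcod hφ hX

/-- A map in the slice over `I` corresponds to a map of presheaves on the category of elements of
`I`, to which `exists_small_wType` applies. -/
theorem axiomWS_pointwiseSmall {S : MorphismProperty E} (hS : IsPredicativeCategoryWithSmallMaps S)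
    (hWS : AxiomWS S) (hcod : S C.cod) : AxiomWS (pointwiseSmall S C) := by
  intro I B A f hf hA
  have hb := hS.pullback_stable
  have := pointwiseSmall_isStableUnderBaseChange (C := C) hb
  have hA' : S A.hom.hom := (sliceSmall_terminal_iff A).1 hA
  obtain ⟨_, W', ⟨hW'⟩, hWa⟩ := exists_small_wType hS hWS (C := I.elements)
    (hb.of_isPullback (IsPullback.of_hasPullback I.anchor C.cod).flip hcod)
    ((overEquivalence I).functor.map f) hf hA'
  obtain ⟨_, W, hW, ⟨i⟩⟩ := exists_wType_of_equivalence (overEquivalence I) f hW'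
  refine ⟨inferInstance, W, hW, (sliceSmall_terminal_iff W.a).2 ?_⟩
  have hi : i.hom.hom ≫ W'.a.anchor = W.a.hom.hom := i.hom.anchor
  have : IsIso i.hom.hom := Iso.isIso_hom ((InternalPresheaf.forget _).mapIso i)
  change S W.a.hom.hom
  rw [← hi]
  exact (S.cancel_left_of_respectsIso i.hom.hom W'.a.anchor).2 hWa

end SmallWTypes

end

theorem mainTheorem11 {E : Type u} [Category.{v} E] [PositiveHeytingCategory E]
    (S : MorphismProperty E) (hS : IsPredicativeCategoryWithSmallMaps S)
    (C : InternalCategory E) (hcod : S C.cod) :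
    AxiomWE (pointwiseSmall S C) ∧
    (AxiomWS S → AxiomWS (pointwiseSmall S C)) ∧
    ∀ {Y X : InternalPresheaf C} (F : Y ⟶ X), pointwiseSmall S C F →
      S (branchMap F) ∧
      ∃ (_ : IsExponentiableMap (branchMap F)) (_ : IsExponentiableMap F),
        ∀ (V : Endofunctor.Algebra (polynomialFunctor (branchMap F))) (hV : IsInitial V),
          ∃ (W : Endofunctor.Algebra (polynomialFunctor F)) (j : W.a.obj ⟶ V.a),
            Nonempty (IsInitial W) ∧
            IsPresheafOfHereditarilyNaturalTrees hV W.a j ∧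
            IsAlgebraOfTrees W j := by
  have hφ {Y X : InternalPresheaf C} (F : Y ⟶ X) (hF : pointwiseSmall S C F) : S (branchMap F) :=
    branchMap_mem hS.pullback_stable hS.composition hcod hF
  have h₃ : ∀ {Y X : InternalPresheaf C} (F : Y ⟶ X), pointwiseSmall S C F →
      S (branchMap F) ∧
      ∃ (_ : IsExponentiableMap (branchMap F)) (_ : IsExponentiableMap F),
        ∀ (V : Endofunctor.Algebra (polynomialFunctor (branchMap F))) (hV : IsInitial V),
          ∃ (W : Endofunctor.Algebra (polynomialFunctor F)) (j : W.a.obj ⟶ V.a),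
            Nonempty (IsInitial W) ∧
            IsPresheafOfHereditarilyNaturalTrees hV W.a j ∧
            IsAlgebraOfTrees W j := by
    intro Y X F hF
    have := hS.exponentiable _ (hφ F hF)
    have := isExponentiableMap_of_branchMap F
    refine ⟨hφ F hF, inferInstance, inferInstance, fun V hV => ?_⟩
    obtain ⟨K⟩ := nonempty_hnTrees hS.pullback_stable hS.wTypes (hφ F hF) hV
    obtain ⟨W, -, hW, j, h₁, h₂⟩ :=
      exists_wType_of_hereditarilyNaturalTrees hS.toIsClassOfSmallMaps hS.wTypes (hφ F hF) hV K
    exact ⟨W, j, hW, h₁, h₂⟩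
  refine ⟨fun Y X F hF => ?_, ?_, h₃⟩
  · obtain ⟨h, _, _, H⟩ := h₃ F hF
    obtain ⟨_, V, ⟨hV⟩⟩ := hS.wTypes _ h
    obtain ⟨W, -, hW, -⟩ := H V hV
    exact ⟨inferInstance, W, hW⟩
  · exact fun hWS => axiomWS_pointwiseSmall hS hWS hcod
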